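/- Let $k$ be a field of characteristic different from $2$ and let $n\ge 1$ be an integer. Let $E(n)$ be the Hopf algebra over $k$ generated by $c,x_1,\dots,x_n$ with relations $$c^2=1,\quad x_i^2=0,\quad cx_i=-x_ic,\quad x_ix_j=-x_jx_i\ (i<j),$$ coproduct $\Delta(c)=c\otimes c$, $\Delta(x_i)=1\otimes x_i+x_i\otimes c$, counit $\varepsilon(c)=1$, $\varepsilon(x_i)=0$ and antipode $S(c)=c$, $S(x_i)=cx_i$. For $P\subseteq\{1,\dots,n\}$ let $x_P$ be the product of the $x_j$, $j\in P$, in increasing order. Let $\mathcal U$ be the set of coquasi-triangular structures on $E(n)$, i.e. of convolution-invertible linear maps $r\colon E(n)\otimes E(n)\to k$ such that, for all $g,h,m$, $$r(gh\otimes m)=\sum r(g\otimes m_{(1)})\,r(h\otimes m_{(2)}),\qquad r(g\otimes hm)=\sum r(g_{(1)}\otimes m)\,r(g_{(2)}\otimes h),$$ $$\sum r(g_{(1)}\otimes h_{(1)})\,g_{(2)}h_{(2)}=\sum h_{(1)}g_{(1)}\,r(g_{(2)}\otimes h_{(2)}).$$ Let $Z_L(E(n))$ be the group, under convolution, of lazy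 $2$-cocycles, i.e. of convolution-invertible linear maps $\sigma\colon E(n)\otimes E(n)\to k$ such that, for all $g,h,m$, $$\sum\sigma(g_{(1)}\otimes h_{(1)})\,\sigma(g_{(2)}h_{(2)}\otimes m)=\sum\sigma(h_{(1)}\otimes m_{(1)})\,\sigma(g\otimes h_{(2)}m_{(2)}),$$ $$\sum\sigma(g_{(1)}\otimes h_{(1)})\,g_{(2)}h_{(2)}=\sum g_{(1)}h_{(1)}\,\sigma(g_{(2)}\otimes h_{(2)}).$$ This group acts on $\mathcal U$ by $\sigma\cdot r=(\sigma\circ\tau)*r*\sigma^{-1}$, where $\tau$ is the flip and $*$ is convolution. The group $\mathrm{Aut}_{Hopf}(E(n))$ acts on $Z_L(E(n))$ and on $\mathcal U$ by $\alpha\cdot f=f\circ(\alpha^{-1}\otimes\alpha^{-1})$. So the semidirect product $\mathcal H=Z_L(E(n))\rtimes \mathrm{Aut}_{Hopf}(E(n))$ acts on $\mathcal U$ by $(\sigma,\alpha)\cdot r=\sigma\cdot(\alpha\cdot r)$. For $A=(a_{ij})\in M_n(k)$ there is exactly one linear form $r_A$ on $E(n)\otimes E(n)$ with the following values for $a,b\in\{0,1\}$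 and $P,F\subseteq\{1,\dots,n\}$: $r_A(c^ax_P\otimes c^bx_F)=0$ if $|P|\ne|F|$, and if $P=\{p_1<\dots<p_s\}$ and $F=\{f_1<\dots<f_s\}$, then $$r_A(c^ax_P\otimes c^bx_F)=(-1)^{b(a+s)}(-1)^{s(s-1)/2}\sum_{\eta\in S_s}\mathrm{sign}(\eta)\prod_{i=1}^s a_{p_i,f_{\eta(i)}}.$$ The map $A\mapsto r_A$ is a bijection from $M_n(k)$ onto $\mathcal U$, and the following hold. 1. The $\mathcal H$-orbits on $\mathcal U$ are parametrized by the $n\times n$ matrices $$J_l=\begin{pmatrix}0&I_l&0\\-I_l&0&0\\0&0&0\end{pmatrix},\qquad 0\le l\le\left[\tfrac n2\right]:$$ the map sending $l$ to the $\mathcal H$-orbit of $r_{J_l}$ is a bijection from $\{0,1,\dots,[n/2]\}$ onto the set of $\mathcal H$-orbits on $\mathcal U$. 2. The $\mathcal H$-orbits on $\mathcal U$ correspond to the congruence classes of skew-symmetric matrices: there is a bijection from the set of $\mathcal H$-orbits on $\mathcal U$ onto the set of congruence classes ($S\sim M^{t}SM$ with $M\in GL_n(k)$) of skew-symmetric matrices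 in $M_n(k)$ that sends, for every $A\in M_n(k)$, the orbit of $r_A$ to the class of the skew-symmetric part $\frac12(A-A^t)$ of $A$. -/

import Mathlib

noncomputable section
namespace HopfForms
open scoped TensorProduct
open WithConv

section General
variable {k : Type*} {H : Type*} [Field k] [Ring H]

/-- Linear forms `H ⊗ H → k` with the convolution product
`(s * t) (g ⊗ h) = ∑ s (g₁ ⊗ h₁) t (g₂ ⊗ h₂)`; the unit is `ε ⊗ ε`. -/
abbrev Form (k H : Type*) [Field k] [Ring H] [HopfAlgebra k H] : Type _ :=
  WithConv (H ⊗[k] H →ₗ[k] k)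

variable [HopfAlgebra k H]

/-- Precomposition with a coalgebra map, as a homomorphism of convolution monoids. -/
def pull {C D A : Type*} [Ring A] [Algebra k A] [AddCommGroup C] [Module k C] [Coalgebra k C] [AddCommGroup D]
    [Module k D] [Coalgebra k D] (f : D →ₗc[k] C) :
    WithConv (C →ₗ[k] A) →* WithConv (D →ₗ[k] A) where
  toFun r := toConv (r.ofConv ∘ₗ f.toLinearMap)
  map_one' := by
    ext x; simp [LinearMap.convOne_def]
  map_mul' r s := by
    exact congrArg toConv (LinearMap.convMul_comp_coalgHom_distrib r s f)

section coaction
variable {C D A : Type*} [Ring A] [Algebra k A] [AddCommGroup C] [Module k C] [Coalgebra k C] [AddCommGroup D]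
    [Module k D] [Coalgebra k D]

/-- A `k`-valued map regarded as an `A`-valued one through `k → A`. -/
def emb (A : Type*) [Ring A] [Algebra k A] (r : WithConv (C →ₗ[k] k)) : WithConv (C →ₗ[k] A) :=
  toConv (Algebra.linearMap k A ∘ₗ r.ofConv)

/-- `c ⊗ d ↦ ρ (F c ⊗ d)`. -/
def phi1 (ρ : WithConv (A ⊗[k] D →ₗ[k] k)) (F : WithConv (C →ₗ[k] A)) : WithConv (C ⊗[k] D →ₗ[k] k) :=
  toConv (ρ.ofConv ∘ₗ F.ofConv.rTensor D)

/-- `d ⊗ c ↦ ρ (d ⊗ F c)`. -/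
def phi2 (ρ : WithConv (D ⊗[k] A →ₗ[k] k)) (F : WithConv (C →ₗ[k] A)) : WithConv (D ⊗[k] C →ₗ[k] k) :=
  toConv (ρ.ofConv ∘ₗ F.ofConv.lTensor D)

variable (k C D) in
/-- `c ⊗ d ↦ ε(d) c`. -/
def prL : C ⊗[k] D →ₗc[k] C := (Coalgebra.TensorProduct.rid k k C).toCoalgHom.comp
    (Coalgebra.TensorProduct.map (CoalgHom.id k C) (Coalgebra.counitCoalgHom k D))
variable (k C D) in
/-- `d ⊗ c ↦ ε(d) c`. -/
def prR : D ⊗[k] C →ₗc[k] C := (Coalgebra.TensorProduct.lid k C).toCoalgHom.comp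
    (Coalgebra.TensorProduct.map (Coalgebra.counitCoalgHom k D) (CoalgHom.id k C))

lemma prL_tmul (c : C) (d : D) : prL k C D (c ⊗ₜ d) = Coalgebra.counit (R := k) d • c := rfl
lemma prR_tmul (c : C) (d : D) : prR k C D (d ⊗ₜ c) = Coalgebra.counit (R := k) d • c := rfl

/-- The Sweedler representation of `c ⊗ d` obtained from those of `c` and `d`. -/
def tmulRepr {ι κ : Type*} {c : C} {d : D} (a : Coalgebra.Repr k c ι) (b : Coalgebra.Repr k d κ) :
    Coalgebra.Repr k (c ⊗ₜ[k] d) (ι × κ) where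
  index := a.index ×ˢ b.index
  left i := a.left i.1 ⊗ₜ b.left i.2
  right i := a.right i.1 ⊗ₜ b.right i.2
  eq := by
    simp [← a.eq, ← b.eq, TensorProduct.sum_tmul a.index, TensorProduct.tmul_sum,
      ← Finset.sum_product']

lemma sum_counit_smul_left {ι : Type*} {d : D} (b : Coalgebra.Repr k d ι) :
    ∑ i ∈ b.index, Coalgebra.counit (R := k) (b.right i) • b.left i = d := by
  simpa only [map_sum, TensorProduct.rid_tmul, one_smul]
    using congr(TensorProduct.rid k D $(Coalgebra.sum_tmul_counit_eq (R := k) b))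

lemma phi1_emb_mul (ρ : WithConv (A ⊗[k] D →ₗ[k] k)) (s : WithConv (C →ₗ[k] k))
    (F : WithConv (C →ₗ[k] A)) :
    phi1 ρ (emb A s * F) = pull (prL k C D) s * phi1 ρ F := by
  apply WithConv.ofConv_injective
  apply TensorProduct.ext'
  intro c d
  change ρ.ofConv (((emb A s * F : WithConv (C →ₗ[k] A)) c) ⊗ₜ[k] d) =
    (pull (prL k C D) s * phi1 ρ F : WithConv _).ofConv (c ⊗ₜ[k] d)
  let a := Coalgebra.Repr.arbitrary k c
  let b := Coalgebra.Repr.arbitrary k d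
  have e1 : (pull (prL k C D) s * phi1 ρ F : WithConv _).ofConv (c ⊗ₜ[k] d) =
      ∑ i ∈ a.index, ∑ j ∈ b.index,
        s.ofConv (Coalgebra.counit (R := k) (b.left j) • a.left i) * ρ.ofConv (F.ofConv (a.right i) ⊗ₜ[k] b.right j) := by
    rw [(tmulRepr a b).convMul_apply]
    exact Finset.sum_product _ _ _
  have e2 : ∑ j ∈ b.index, Coalgebra.counit (R := k) (b.left j) • b.right j = d :=
    Coalgebra.sum_counit_smul b
  rw [e1, a.convMul_apply]
  conv_lhs => rw [← e2]
  simp only [TensorProduct.sum_tmul, TensorProduct.tmul_sum, map_sum]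
  rw [Finset.sum_comm]
  refine Finset.sum_congr rfl fun x _ => Finset.sum_congr rfl fun y _ => ?_
  simp only [emb, LinearMap.comp_apply, Algebra.linearMap_apply, ← Algebra.smul_def,
    ← TensorProduct.smul_tmul', TensorProduct.tmul_smul, map_smul, smul_eq_mul]
  ring

lemma phi1_mul_emb (ρ : WithConv (A ⊗[k] D →ₗ[k] k)) (s : WithConv (C →ₗ[k] k))
    (F : WithConv (C →ₗ[k] A)) :
    phi1 ρ (F * emb A s) = phi1 ρ F * pull (prL k C D) s := by
  apply WithConv.ofConv_injective
  apply TensorProduct.ext'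
  intro c d
  change ρ.ofConv (((F * emb A s : WithConv (C →ₗ[k] A)) c) ⊗ₜ[k] d) =
    (phi1 ρ F * pull (prL k C D) s : WithConv _).ofConv (c ⊗ₜ[k] d)
  let a := Coalgebra.Repr.arbitrary k c
  let b := Coalgebra.Repr.arbitrary k d
  have e1 : (phi1 ρ F * pull (prL k C D) s : WithConv _).ofConv (c ⊗ₜ[k] d) =
      ∑ i ∈ a.index, ∑ j ∈ b.index,
        ρ.ofConv (F.ofConv (a.left i) ⊗ₜ[k] b.left j) * s.ofConv (Coalgebra.counit (R := k) (b.right j) • a.right i) := by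
    rw [(tmulRepr a b).convMul_apply]
    exact Finset.sum_product _ _ _
  have e2 : ∑ j ∈ b.index, Coalgebra.counit (R := k) (b.right j) • b.left j = d :=
    sum_counit_smul_left b
  rw [e1, a.convMul_apply]
  conv_lhs => rw [← e2]
  simp only [TensorProduct.sum_tmul, TensorProduct.tmul_sum, map_sum]
  rw [Finset.sum_comm]
  refine Finset.sum_congr rfl fun x _ => Finset.sum_congr rfl fun y _ => ?_
  simp only [emb, LinearMap.comp_apply, Algebra.linearMap_apply, ← Algebra.commutes, ← Algebra.smul_def,
    ← TensorProduct.smul_tmul', TensorProduct.tmul_smul, map_smul, smul_eq_mul]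
  ring

lemma phi2_emb_mul (ρ : WithConv (D ⊗[k] A →ₗ[k] k)) (s : WithConv (C →ₗ[k] k))
    (F : WithConv (C →ₗ[k] A)) :
    phi2 ρ (emb A s * F) = pull (prR k C D) s * phi2 ρ F := by
  apply WithConv.ofConv_injective
  apply TensorProduct.ext'
  intro d c
  change ρ.ofConv (d ⊗ₜ[k] ((emb A s * F : WithConv (C →ₗ[k] A)) c)) =
    (pull (prR k C D) s * phi2 ρ F : WithConv _).ofConv (d ⊗ₜ[k] c)
  let a := Coalgebra.Repr.arbitrary k c
  let b := Coalgebra.Repr.arbitrary k d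
  have e1 : (pull (prR k C D) s * phi2 ρ F : WithConv _).ofConv (d ⊗ₜ[k] c) =
      ∑ j ∈ b.index, ∑ i ∈ a.index,
        s.ofConv (Coalgebra.counit (R := k) (b.left j) • a.left i) * ρ.ofConv (b.right j ⊗ₜ[k] F.ofConv (a.right i)) := by
    rw [(tmulRepr b a).convMul_apply]
    exact Finset.sum_product _ _ _
  have e2 : ∑ j ∈ b.index, Coalgebra.counit (R := k) (b.left j) • b.right j = d :=
    Coalgebra.sum_counit_smul b
  rw [e1, a.convMul_apply]
  conv_lhs => rw [← e2]
  simp only [TensorProduct.sum_tmul, TensorProduct.tmul_sum, map_sum]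
  rw [Finset.sum_comm]
  refine Finset.sum_congr rfl fun x _ => Finset.sum_congr rfl fun y _ => ?_
  simp only [emb, LinearMap.comp_apply, Algebra.linearMap_apply, ← Algebra.smul_def,
    ← TensorProduct.smul_tmul', TensorProduct.tmul_smul, map_smul, smul_eq_mul]
  ring

lemma phi2_mul_emb (ρ : WithConv (D ⊗[k] A →ₗ[k] k)) (s : WithConv (C →ₗ[k] k))
    (F : WithConv (C →ₗ[k] A)) :
    phi2 ρ (F * emb A s) = phi2 ρ F * pull (prR k C D) s := by
  apply WithConv.ofConv_injective
  apply TensorProduct.ext'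
  intro d c
  change ρ.ofConv (d ⊗ₜ[k] ((F * emb A s : WithConv (C →ₗ[k] A)) c)) =
    (phi2 ρ F * pull (prR k C D) s : WithConv _).ofConv (d ⊗ₜ[k] c)
  let a := Coalgebra.Repr.arbitrary k c
  let b := Coalgebra.Repr.arbitrary k d
  have e1 : (phi2 ρ F * pull (prR k C D) s : WithConv _).ofConv (d ⊗ₜ[k] c) =
      ∑ j ∈ b.index, ∑ i ∈ a.index,
        ρ.ofConv (b.left j ⊗ₜ[k] F.ofConv (a.left i)) * s.ofConv (Coalgebra.counit (R := k) (b.right j) • a.right i) := by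
    rw [(tmulRepr b a).convMul_apply]
    exact Finset.sum_product _ _ _
  have e2 : ∑ j ∈ b.index, Coalgebra.counit (R := k) (b.right j) • b.left j = d :=
    sum_counit_smul_left b
  rw [e1, a.convMul_apply]
  conv_lhs => rw [← e2]
  simp only [TensorProduct.sum_tmul, TensorProduct.tmul_sum, map_sum]
  rw [Finset.sum_comm]
  refine Finset.sum_congr rfl fun x _ => Finset.sum_congr rfl fun y _ => ?_
  simp only [emb, LinearMap.comp_apply, Algebra.linearMap_apply, ← Algebra.commutes, ← Algebra.smul_def,
    ← TensorProduct.smul_tmul', TensorProduct.tmul_smul, map_smul, smul_eq_mul]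
  ring

end coaction
variable (k H)
/-- `g ⊗ h ⊗ m ↦ ε(m) g ⊗ h`. -/
def e12 : (H ⊗[k] H) ⊗[k] H →ₗc[k] H ⊗[k] H := prL k (H ⊗[k] H) H

/-- `g ⊗ h ⊗ m ↦ ε(g) h ⊗ m`. -/
def e23 : (H ⊗[k] H) ⊗[k] H →ₗc[k] H ⊗[k] H :=
  (prR k (H ⊗[k] H) H).comp (Coalgebra.TensorProduct.assoc k k H H H).toCoalgHom

/-- `g ⊗ h ⊗ m ↦ ε(h) g ⊗ m`. -/
def e13 : (H ⊗[k] H) ⊗[k] H →ₗc[k] H ⊗[k] H :=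
  Coalgebra.TensorProduct.map (prL k H H) (CoalgHom.id k H)

/-- `g ⊗ h ⊗ m ↦ gh ⊗ m`. -/
def mul12 : (H ⊗[k] H) ⊗[k] H →ₗc[k] H ⊗[k] H :=
  Coalgebra.TensorProduct.map (Bialgebra.mulCoalgHom k H) (CoalgHom.id k H)

/-- `g ⊗ h ⊗ m ↦ g ⊗ hm`. -/
def mul23 : (H ⊗[k] H) ⊗[k] H →ₗc[k] H ⊗[k] H :=
  (Coalgebra.TensorProduct.map (CoalgHom.id k H) (Bialgebra.mulCoalgHom k H)).comp
    (Coalgebra.TensorProduct.assoc k k H H H).toCoalgHom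

/-- The flip `g ⊗ h ↦ h ⊗ g`. -/
def flip : H ⊗[k] H →ₗc[k] H ⊗[k] H :=
  ((Bialgebra.TensorProduct.comm k H H : H ⊗[k] H ≃ₐc[k] H ⊗[k] H) : H ⊗[k] H →ₗc[k] H ⊗[k] H)

/-- `g ⊗ h ⊗ m ↦ h ⊗ g ⊗ m` -/
def swap12 : (H ⊗[k] H) ⊗[k] H →ₗc[k] (H ⊗[k] H) ⊗[k] H :=
  Coalgebra.TensorProduct.map (flip k H) (CoalgHom.id k H)
/-- `g ⊗ h ⊗ m ↦ g ⊗ m ⊗ h` -/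
def swap23 : (H ⊗[k] H) ⊗[k] H →ₗc[k] (H ⊗[k] H) ⊗[k] H :=
  (Coalgebra.TensorProduct.assoc k k H H H).symm.toCoalgHom.comp
  ((Coalgebra.TensorProduct.map (CoalgHom.id k H) (flip k H)).comp
    (Coalgebra.TensorProduct.assoc k k H H H).toCoalgHom)
variable {k H}

lemma e12_tmul (a b c : H) : e12 k H ((a ⊗ₜ b) ⊗ₜ c) = Coalgebra.counit (R := k) c • (a ⊗ₜ[k] b) := rfl
lemma e23_tmul (a b c : H) : e23 k H ((a ⊗ₜ b) ⊗ₜ c) = Coalgebra.counit (R := k) a • (b ⊗ₜ[k] c) := rfl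
lemma e13_tmul (a b c : H) : e13 k H ((a ⊗ₜ b) ⊗ₜ c) = (Coalgebra.counit (R := k) b • a) ⊗ₜ[k] c := rfl
lemma mul12_tmul (a b c : H) : mul12 k H ((a ⊗ₜ b) ⊗ₜ c) = (a * b) ⊗ₜ[k] c := rfl
lemma mul23_tmul (a b c : H) : mul23 k H ((a ⊗ₜ b) ⊗ₜ c) = a ⊗ₜ[k] (b * c) := rfl
lemma flip_tmul (a b : H) : flip k H (a ⊗ₜ b) = b ⊗ₜ[k] a := rfl
lemma swap12_tmul (a b c : H) : swap12 k H ((a ⊗ₜ b) ⊗ₜ c) = (b ⊗ₜ[k] a) ⊗ₜ c := rfl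
lemma swap23_tmul (a b c : H) : swap23 k H ((a ⊗ₜ b) ⊗ₜ c) = (a ⊗ₜ[k] c) ⊗ₜ b := rfl

lemma hom3_ext {P : Type*} [AddCommGroup P] [Module k P] [Coalgebra k P]
    {f g : (H ⊗[k] H) ⊗[k] H →ₗc[k] P}
    (h : ∀ a b c : H, f ((a ⊗ₜ b) ⊗ₜ c) = g ((a ⊗ₜ b) ⊗ₜ c)) : f = g := by
  have : f.toLinearMap = g.toLinearMap := by
    apply TensorProduct.ext_threefold
    intro a b c
    exact h a b c
  ext x
  exact LinearMap.congr_fun this x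

/-- Precomposition with a coalgebra map, on convolution-invertible forms. -/
def upull {C D : Type*} [AddCommGroup C] [Module k C] [Coalgebra k C] [AddCommGroup D]
    [Module k D] [Coalgebra k D] (f : D →ₗc[k] C) :
    (WithConv (C →ₗ[k] k))ˣ →* (WithConv (D →ₗ[k] k))ˣ := Units.map (pull f)

lemma upull_comp {C D E : Type*} [AddCommGroup C] [Module k C] [Coalgebra k C] [AddCommGroup D]
    [Module k D] [Coalgebra k D] [AddCommGroup E] [Module k E] [Coalgebra k E]
    (f : D →ₗc[k] C) (g : E →ₗc[k] D) (r : (WithConv (C →ₗ[k] k))ˣ) :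
    upull g (upull f r) = upull (f.comp g) r := rfl

/-- The multiplication `g ⊗ h ↦ gh`. -/
def mulForm (k H : Type*) [Field k] [Ring H] [HopfAlgebra k H] : WithConv (H ⊗[k] H →ₗ[k] H) :=
  toConv (LinearMap.mul' k H)
/-- The opposite multiplication `g ⊗ h ↦ hg`. -/
def mulOpForm (k H : Type*) [Field k] [Ring H] [HopfAlgebra k H] : WithConv (H ⊗[k] H →ₗ[k] H) :=
  pull (flip k H) (mulForm k H)

/-- `∑ s (g₁ ⊗ h₁) g₂h₂ = ∑ g₁h₁ s (g₂ ⊗ h₂)` for all `g`, `h`. -/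
def IsLazy (s : (Form k H)ˣ) : Prop := emb H (s : Form k H) * mulForm k H = mulForm k H * emb H (s : Form k H)

/-- Left 2-cocycle condition: for all `g`, `h`, `m`,
`∑ s (g₁ ⊗ h₁) s (g₂h₂ ⊗ m) = ∑ s (h₁ ⊗ m₁) s (g ⊗ h₂m₂)`. -/
def IsCocycle (s : (Form k H)ˣ) : Prop :=
  upull (e12 k H) s * upull (mul12 k H) s = upull (e23 k H) s * upull (mul23 k H) s

/-- `r` (convolution invertible) is a coquasi-triangular structure on `H`: for all `g`, `h`, `m`,
`r (gh ⊗ m) = ∑ r (g ⊗ m₁) r (h ⊗ m₂)`, `r (g ⊗ hm) = ∑ r (g₁ ⊗ m) r (g₂ ⊗ h)` and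
`∑ r (g₁ ⊗ h₁) g₂h₂ = ∑ h₁g₁ r (g₂ ⊗ h₂)`. -/
structure IsCQT (r : (Form k H)ˣ) : Prop where
  mul_left : upull (mul12 k H) r = upull (e13 k H) r * upull (e23 k H) r
  mul_right : upull (mul23 k H) r = upull (e13 k H) r * upull (e12 k H) r
  comm : emb H (r : Form k H) * mulForm k H = mulOpForm k H * emb H (r : Form k H)

lemma comm12_aux {s : Form k H} {F G : WithConv (H ⊗[k] H →ₗ[k] H)} (h : emb H s * F = G * emb H s) (t : Form k H) :
    pull (e12 k H) s * phi1 t F = phi1 t G * pull (e12 k H) s := by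
  have := congrArg (phi1 (D := H) t) h
  rwa [phi1_emb_mul, phi1_mul_emb] at this

lemma comm23_aux {s : Form k H} {F G : WithConv (H ⊗[k] H →ₗ[k] H)} (h : emb H s * F = G * emb H s) (t : Form k H) :
    pull (e23 k H) s * pull (Coalgebra.TensorProduct.assoc k k H H H).toCoalgHom (phi2 t F)
     = pull (Coalgebra.TensorProduct.assoc k k H H H).toCoalgHom (phi2 t G) * pull (e23 k H) s := by
  have := congrArg (fun z => pull (Coalgebra.TensorProduct.assoc k k H H H).toCoalgHom (phi2 (D := H) t z)) h
  simp only [phi2_emb_mul, phi2_mul_emb, map_mul] at this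
  exact this

lemma IsLazy.comm12 {s : (Form k H)ˣ} (h : IsLazy s) (t : (Form k H)ˣ) :
    upull (e12 k H) s * upull (mul12 k H) t = upull (mul12 k H) t * upull (e12 k H) s :=
  Units.ext (comm12_aux h t)

lemma IsLazy.comm23 {s : (Form k H)ˣ} (h : IsLazy s) (t : (Form k H)ˣ) :
    upull (e23 k H) s * upull (mul23 k H) t = upull (mul23 k H) t * upull (e23 k H) s :=
  Units.ext (comm23_aux h t)

lemma IsCQT.comm12 {s : (Form k H)ˣ} (h : IsCQT s) (t : (Form k H)ˣ) :
    upull (e12 k H) s * upull (mul12 k H) t =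
      upull ((mul12 k H).comp (swap12 k H)) t * upull (e12 k H) s := by
  refine Units.ext ((comm12_aux h.comm t).trans ?_)
  refine congrArg (· * _) ?_
  apply WithConv.ofConv_injective
  apply TensorProduct.ext_threefold
  intro a b c
  rfl

lemma IsCQT.comm23 {s : (Form k H)ˣ} (h : IsCQT s) (t : (Form k H)ˣ) :
    upull (e23 k H) s * upull (mul23 k H) t =
      upull ((mul23 k H).comp (swap23 k H)) t * upull (e23 k H) s := by
  refine Units.ext ((comm23_aux h.comm t).trans ?_)
  refine congrArg (· * _) ?_
  apply WithConv.ofConv_injective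
  apply TensorProduct.ext_threefold
  intro a b c
  rfl

/-- The action of a cocycle `s` on a form `r`: `(s ∘ τ) * r * s⁻¹`. -/
def twist (s r : (Form k H)ˣ) : (Form k H)ˣ := upull (flip k H) s * r * s⁻¹

lemma emb_mul (s t : Form k H) : emb H (s * t) = emb H s * emb H t :=
  congrArg toConv (LinearMap.algHom_comp_convMul_distrib (Algebra.ofId k H) s t)

lemma emb_one : emb H (1 : Form k H) = 1 := by
  apply WithConv.ofConv_injective
  ext
  simp [emb, LinearMap.convOne_def]

lemma emb_pull (f : H ⊗[k] H →ₗc[k] H ⊗[k] H) (s : Form k H) :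
    emb H (pull f s) = pull f (emb H s) := rfl

variable (k H) in
/-- The group `Z_L(H)` of lazy left 2-cocycles under convolution. -/
def lazyCocycles : Subgroup (Form k H)ˣ where
  carrier := {s | IsCocycle s ∧ IsLazy s}
  one_mem' := by
    refine ⟨by simp [IsCocycle], ?_⟩
    simp [IsLazy, emb_one]
  mul_mem' := by
    rintro s t ⟨hs, hs'⟩ ⟨ht, ht'⟩
    refine ⟨?_, ?_⟩
    · unfold IsCocycle at *
      simp only [map_mul]
      rw [mul_assoc, ← mul_assoc (upull (e12 k H) t), ht'.comm12, mul_assoc, ht, ← mul_assoc, hs,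
        mul_assoc, ← mul_assoc _ _ (upull (mul23 k H) t), ← ht'.comm23]
      simp only [mul_assoc]
    · unfold IsLazy at *
      rw [Units.val_mul, emb_mul, mul_assoc, ht', ← mul_assoc, hs', mul_assoc]
  inv_mem' := by
    rintro s ⟨hs, hs'⟩
    refine ⟨?_, ?_⟩
    · unfold IsCocycle at *
      rw [hs'.comm12, hs'.comm23] at hs
      simp only [map_inv]
      rw [← mul_inv_rev, ← mul_inv_rev, hs]
    · unfold IsLazy at *
      have h1 : emb H ((s⁻¹ : (Form k H)ˣ) : Form k H) * emb H (s : Form k H) = 1 := by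
        rw [← emb_mul, Units.inv_mul, emb_one]
      have h2 : emb H (s : Form k H) * emb H ((s⁻¹ : (Form k H)ˣ) : Form k H) = 1 := by
        rw [← emb_mul, Units.mul_inv, emb_one]
      calc _ = emb H ((s⁻¹ : (Form k H)ˣ) : Form k H) * mulForm k H *
            (emb H (s : Form k H) * emb H ((s⁻¹ : (Form k H)ˣ) : Form k H)) := by rw [h2, mul_one]
        _ = emb H ((s⁻¹ : (Form k H)ˣ) : Form k H) * (mulForm k H * emb H (s : Form k H)) *
             emb H ((s⁻¹ : (Form k H)ˣ) : Form k H) := by simp only [mul_assoc]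
        _ = _ := by rw [← hs', ← mul_assoc, h1, one_mul]

lemma group_aux1 {G : Type*} [Group G] {s12 s31 s13 s23 s32 r13 r23 X Y Z M M' N Q : G}
    (h1 : s31 * X = s12 * M') (h2 : X * r13 = r13 * Y) (h3 : s13 * Y = s32 * Z)
    (h4 : r23 * N = Z * r23) (h6 : s12 * M = s23 * N)
    (h7 : s12 * Q = Q * s12) (hQ : Q = M' * (r13 * r23) * M⁻¹) :
    Q = (s31 * r13 * s13⁻¹) * (s32 * r23 * s23⁻¹) := by
  have hM' : M' = s12⁻¹ * s31 * X := by rw [mul_assoc, h1, inv_mul_cancel_left]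
  have hM : M⁻¹ = N⁻¹ * s23⁻¹ * s12 := by
    rw [← mul_inv_rev, ← h6]; group
  have hN : r23 * N⁻¹ = Z⁻¹ * r23 := by
    rw [eq_inv_mul_iff_mul_eq, ← mul_assoc, ← h4]; group
  have hY : Y * Z⁻¹ = s13⁻¹ * s32 := by
    rw [eq_inv_mul_iff_mul_eq, ← mul_assoc, h3]; group
  have hc : Q = s12 * Q * s12⁻¹ := by rw [h7]; group
  rw [hc, hQ, hM', hM]
  calc _ = s31 * (X * r13) * (r23 * N⁻¹) * s23⁻¹ := by group
    _ = s31 * r13 * (Y * Z⁻¹) * r23 * s23⁻¹ := by rw [h2, hN]; group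
    _ = _ := by rw [hY]; group

lemma twist_isCQT {s r : (Form k H)ˣ} (hs : IsCocycle s) (hl : IsLazy s) (hr : IsCQT r) :
    IsCQT (twist s r) := by
  have cyc : ∀ f : (H ⊗[k] H) ⊗[k] H →ₗc[k] (H ⊗[k] H) ⊗[k] H,
      upull ((e12 k H).comp f) s * upull ((mul12 k H).comp f) s =
      upull ((e23 k H).comp f) s * upull ((mul23 k H).comp f) s := fun f => by
    have := congrArg (upull f) hs
    simpa only [map_mul, upull_comp] using this
  have c12 : ∀ f : (H ⊗[k] H) ⊗[k] H →ₗc[k] (H ⊗[k] H) ⊗[k] H,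
      upull ((e12 k H).comp f) r * upull ((mul12 k H).comp f) s =
      upull (((mul12 k H).comp (swap12 k H)).comp f) s * upull ((e12 k H).comp f) r := fun f => by
    have := congrArg (upull f) (hr.comm12 s)
    simpa only [map_mul, upull_comp] using this
  have c23 : ∀ f : (H ⊗[k] H) ⊗[k] H →ₗc[k] (H ⊗[k] H) ⊗[k] H,
      upull ((e23 k H).comp f) r * upull ((mul23 k H).comp f) s =
      upull (((mul23 k H).comp (swap23 k H)).comp f) s * upull ((e23 k H).comp f) r := fun f => by
    have := congrArg (upull f) (hr.comm23 s)
    simpa only [map_mul, upull_comp] using this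
  have E12_23 : (e12 k H).comp (swap23 k H) = e13 k H := hom3_ext fun a b c => by
    simp [swap23_tmul, e12_tmul, e13_tmul, TensorProduct.smul_tmul']
  have E23_23 : (e23 k H).comp (swap23 k H) = (flip k H).comp (e23 k H) := hom3_ext fun a b c => by
    simp [swap23_tmul, e23_tmul, flip_tmul]
  have E23_12 : (e23 k H).comp (swap12 k H) = e13 k H := hom3_ext fun a b c => by
    simp [swap12_tmul, e23_tmul, e13_tmul, TensorProduct.smul_tmul']
  have E12_12 : (e12 k H).comp (swap12 k H) = (flip k H).comp (e12 k H) := hom3_ext fun a b c => by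
    simp [swap12_tmul, e12_tmul, flip_tmul]
  -- `g ⊗ h ⊗ m ↦ m ⊗ g ⊗ h`
  let p := (swap12 k H).comp (swap23 k H)
  have p1 : (e12 k H).comp p = (flip k H).comp (e13 k H) := by
    simp only [p, ← CoalgHom.comp_assoc, E12_12]; rw [CoalgHom.comp_assoc, E12_23]
  have p2 : (e23 k H).comp p = e12 k H := hom3_ext fun a b c => by
    simp [p, swap12_tmul, swap23_tmul, e23_tmul, e12_tmul]
  have p3 : (mul23 k H).comp p = (flip k H).comp (mul12 k H) := hom3_ext fun a b c => rfl
  -- `g ⊗ h ⊗ m ↦ h ⊗ m ⊗ g`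
  let q := (swap23 k H).comp (swap12 k H)
  have q1 : (e12 k H).comp q = e23 k H := hom3_ext fun a b c => by
    simp [q, swap12_tmul, swap23_tmul, e23_tmul, e12_tmul]
  have q2 : (e23 k H).comp q = (flip k H).comp (e13 k H) := hom3_ext fun a b c => by
    simp [q, swap12_tmul, swap23_tmul, e23_tmul, e13_tmul, flip_tmul, TensorProduct.smul_tmul']
  have q3 : (mul12 k H).comp q = (flip k H).comp (mul23 k H) := hom3_ext fun a b c => rfl
  refine ⟨?_, ?_, ?_⟩
  · have h1 := cyc p
    have h3 := cyc (swap23 k H)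
    have h2 := c12 (swap23 k H)
    have h4 := c23 (CoalgHom.id k _)
    rw [p1, p2, p3] at h1
    rw [E12_23, E23_23] at h3
    rw [E12_23] at h2
    simp only [CoalgHom.comp_id] at h4
    have := group_aux1 (Q := upull (mul12 k H) (twist s r)) h1 h2.symm h3 h4 hs (hl.comm12 _)
      (by simp only [twist, map_mul, map_inv, hr.mul_left, upull_comp])
    simpa only [twist, map_mul, map_inv, upull_comp] using this
  · have h1 := cyc q
    have h3 := cyc (swap12 k H)
    have h2 := c23 (swap12 k H)
    have h4 := c12 (CoalgHom.id k _)
    rw [q1, q2, q3] at h1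
    rw [E23_12, E12_12] at h3
    rw [E23_12] at h2
    simp only [CoalgHom.comp_id] at h4
    have := group_aux1 (Q := upull (mul23 k H) (twist s r)) h1.symm h2.symm h3.symm h4 hs.symm
      (hl.comm23 _)
      (by simp only [twist, map_mul, map_inv, hr.mul_right, upull_comp])
    simpa only [twist, map_mul, map_inv, upull_comp] using this
  · have h1 : emb H (pull (flip k H) (s : Form k H)) * mulOpForm k H =
        mulOpForm k H * emb H (pull (flip k H) (s : Form k H)) := by
      have := congrArg (pull (flip k H)) hl
      rw [map_mul, map_mul] at this
      exact this
    have h2 := ((lazyCocycles k H).inv_mem ⟨hs, hl⟩).2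
    unfold IsLazy at h2
    change emb H (pull (flip k H) (s : Form k H) * (r : Form k H) * ((s⁻¹ : (Form k H)ˣ) : Form k H)) * _
      = _ * emb H (pull (flip k H) (s : Form k H) * (r : Form k H) * ((s⁻¹ : (Form k H)ˣ) : Form k H))
    rw [emb_mul, emb_mul, mul_assoc, h2, mul_assoc, ← mul_assoc (emb H (r : Form k H)), hr.comm,
      ← mul_assoc, ← mul_assoc, h1]
    simp only [mul_assoc]

/-- The group of Hopf algebra automorphisms of `H`, under composition (`a * b = a ∘ b`).
A bialgebra automorphism of a Hopf algebra automatically commutes with the antipode. -/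
instance autGroup : Group (H ≃ₐc[k] H) where
  mul a b := b.trans a
  one := BialgEquiv.refl k H
  inv a := a.symm
  mul_assoc _ _ _ := rfl
  one_mul _ := rfl
  mul_one _ := rfl
  inv_mul_cancel a := BialgEquiv.ext fun x => a.symm_apply_apply x

/-- The coalgebra map underlying an automorphism. -/
def toHom (a : H ≃ₐc[k] H) : H →ₗc[k] H := ((a : H ≃ₗc[k] H) : H →ₗc[k] H)

/-- `a ⊗ a`. -/
def tens (a : H ≃ₐc[k] H) : H ⊗[k] H →ₗc[k] H ⊗[k] H := Coalgebra.TensorProduct.map (toHom a) (toHom a)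

lemma toHom_apply (a : H ≃ₐc[k] H) (x : H) : toHom a x = a x := rfl

lemma hom2_ext {P : Type*} [AddCommGroup P] [Module k P] [Coalgebra k P]
    {f g : H ⊗[k] H →ₗc[k] P}
    (h : ∀ a b : H, f (a ⊗ₜ b) = g (a ⊗ₜ b)) : f = g := by
  have : f.toLinearMap = g.toLinearMap := TensorProduct.ext' fun a b => h a b
  ext x
  exact LinearMap.congr_fun this x

lemma tens_tmul (a : H ≃ₐc[k] H) (x y : H) : tens a (x ⊗ₜ y) = a x ⊗ₜ[k] a y := rfl

lemma tens_comp (a b : H ≃ₐc[k] H) : (tens a).comp (tens b) = tens (a * b) :=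
  hom2_ext fun _ _ => rfl

/-- The action of automorphisms on convolution-invertible forms: `a · r = r ∘ (a⁻¹ ⊗ a⁻¹)`. -/
def transport : (H ≃ₐc[k] H) →* MulAut (Form k H)ˣ where
  toFun a := 
    { toFun := upull (tens a⁻¹)
      invFun := upull (tens a)
      left_inv := fun r => by
        rw [upull_comp, tens_comp, inv_mul_cancel]
        exact Units.ext (WithConv.ofConv_injective (TensorProduct.ext' fun _ _ => rfl))
      right_inv := fun r => by
        rw [upull_comp, tens_comp, mul_inv_cancel]
        exact Units.ext (WithConv.ofConv_injective (TensorProduct.ext' fun _ _ => rfl))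
      map_mul' := map_mul _ }
  map_one' := MulEquiv.ext fun r => 
    Units.ext (WithConv.ofConv_injective (TensorProduct.ext' fun _ _ => rfl))
  map_mul' a b := MulEquiv.ext fun r => by
    change upull (tens (a * b)⁻¹) r = upull (tens a⁻¹) (upull (tens b⁻¹) r)
    rw [upull_comp, tens_comp, mul_inv_rev]

/-- `a ⊗ a ⊗ a`. -/
def tens3 (a : H ≃ₐc[k] H) : (H ⊗[k] H) ⊗[k] H →ₗc[k] (H ⊗[k] H) ⊗[k] H :=
  Coalgebra.TensorProduct.map (tens a) (toHom a)

lemma tens3_tmul (a : H ≃ₐc[k] H) (x y z : H) :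
  tens3 a ((x ⊗ₜ y) ⊗ₜ z) = (a x ⊗ₜ[k] a y) ⊗ₜ[k] a z := rfl

lemma e12_tens (a : H ≃ₐc[k] H) : (tens a).comp (e12 k H) = (e12 k H).comp (tens3 a) :=
  hom3_ext fun x y z => by simp [e12_tmul, tens_tmul, tens3_tmul]
lemma e23_tens (a : H ≃ₐc[k] H) : (tens a).comp (e23 k H) = (e23 k H).comp (tens3 a) :=
  hom3_ext fun x y z => by simp [e23_tmul, tens_tmul, tens3_tmul]
lemma e13_tens (a : H ≃ₐc[k] H) : (tens a).comp (e13 k H) = (e13 k H).comp (tens3 a) :=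
  hom3_ext fun x y z => by simp [e13_tmul, tens_tmul, tens3_tmul]
lemma mul12_tens (a : H ≃ₐc[k] H) : (tens a).comp (mul12 k H) = (mul12 k H).comp (tens3 a) :=
  hom3_ext fun x y z => by simp [mul12_tmul, tens_tmul, tens3_tmul]
lemma mul23_tens (a : H ≃ₐc[k] H) : (tens a).comp (mul23 k H) = (mul23 k H).comp (tens3 a) :=
  hom3_ext fun x y z => by simp [mul23_tmul, tens_tmul, tens3_tmul]

/-- Postcomposition with an automorphism. -/
def post (a : H ≃ₐc[k] H) (F : WithConv (H ⊗[k] H →ₗ[k] H)) : WithConv (H ⊗[k] H →ₗ[k] H) :=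
  toConv ((a : H →ₐ[k] H).toLinearMap ∘ₗ F.ofConv)

lemma post_mul (a : H ≃ₐc[k] H) (F G : WithConv (H ⊗[k] H →ₗ[k] H)) :
    post a (F * G) = post a F * post a G :=
  congrArg toConv (LinearMap.algHom_comp_convMul_distrib (a : H →ₐ[k] H) F G)

lemma post_emb (a : H ≃ₐc[k] H) (s : Form k H) : post a (emb H s) = emb H s := by
  apply WithConv.ofConv_injective
  apply TensorProduct.ext'
  intro x y
  exact AlgHomClass.commutes a (s.ofConv (x ⊗ₜ y))

lemma post_pull_mulForm (a : H ≃ₐc[k] H) : post a (pull (tens a⁻¹) (mulForm k H)) = mulForm k H := by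
  apply WithConv.ofConv_injective
  apply TensorProduct.ext'
  intro x y
  change a (a.symm x * a.symm y) = x * y
  simp

lemma post_pull_mulOpForm (a : H ≃ₐc[k] H) : post a (pull (tens a⁻¹) (mulOpForm k H)) = mulOpForm k H := by
  apply WithConv.ofConv_injective
  apply TensorProduct.ext'
  intro x y
  change a (a.symm y * a.symm x) = y * x
  simp

lemma transport_apply (a : H ≃ₐc[k] H) (s : (Form k H)ˣ) : transport a s = upull (tens a⁻¹) s := rfl

lemma transport_val (a : H ≃ₐc[k] H) (s : (Form k H)ˣ) :
    ((transport a s : (Form k H)ˣ) : Form k H) = pull (tens a⁻¹) (s : Form k H) := rfl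

lemma transport_comm {a : H ≃ₐc[k] H} {s : Form k H} {F G : WithConv (H ⊗[k] H →ₗ[k] H)}
    (hF : post a (pull (tens a⁻¹) F) = F) (hG : post a (pull (tens a⁻¹) G) = G)
    (h : emb H s * F = G * emb H s) :
    emb H (pull (tens a⁻¹) s) * F = G * emb H (pull (tens a⁻¹) s) := by
  have := congrArg (fun z => post a (pull (tens a⁻¹) z)) h
  simpa only [map_mul, post_mul, hF, hG, ← emb_pull, post_emb] using this

lemma transport_isLazyCocycle {a : H ≃ₐc[k] H} {s : (Form k H)ˣ} (h : s ∈ lazyCocycles k H) :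
    transport a s ∈ lazyCocycles k H := by
  refine ⟨?_, ?_⟩
  · have := congrArg (upull (tens3 a⁻¹)) h.1
    simpa only [IsCocycle, transport_apply, map_mul, upull_comp, e12_tens, e23_tens, mul12_tens,
      mul23_tens] using this
  · exact transport_comm (post_pull_mulForm a) (post_pull_mulForm a) h.2

lemma transport_isCQT {a : H ≃ₐc[k] H} {r : (Form k H)ˣ} (h : IsCQT r) :
    IsCQT (transport a r) := by
  refine ⟨?_, ?_, ?_⟩
  · have := congrArg (upull (tens3 a⁻¹)) h.1
    simpa only [transport_apply, map_mul, upull_comp, e12_tens, e23_tens, e13_tens, mul12_tens,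
      mul23_tens] using this
  · have := congrArg (upull (tens3 a⁻¹)) h.2
    simpa only [transport_apply, map_mul, upull_comp, e12_tens, e23_tens, e13_tens, mul12_tens,
      mul23_tens] using this
  · exact transport_comm (post_pull_mulForm a) (post_pull_mulOpForm a) h.3

variable (k H) in
/-- The action of Hopf automorphisms on `Z_L(H)` by group automorphisms. -/
def autOnLazy : (H ≃ₐc[k] H) →* MulAut (lazyCocycles k H) where
  toFun a :=
    { toFun := fun s => ⟨transport a s, transport_isLazyCocycle s.2⟩
      invFun := fun s => ⟨transport a⁻¹ s, transport_isLazyCocycle s.2⟩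
      left_inv := fun s => Subtype.ext (by simp)
      right_inv := fun s => Subtype.ext (by simp)
      map_mul' := fun s t => Subtype.ext (map_mul _ _ _) }
  map_one' := MulEquiv.ext fun s => Subtype.ext (by simp)
  map_mul' a b := MulEquiv.ext fun s => Subtype.ext (by simp)

variable (k H) in
/-- The set of coquasi-triangular structures on `H`. -/
def CQT : Type _ := {r : (Form k H)ˣ // IsCQT r}

lemma twist_mul (s t r : (Form k H)ˣ) : twist (s * t) r = twist s (twist t r) := by
  simp only [twist, map_mul, mul_inv_rev, mul_assoc]

lemma transport_twist (a : H ≃ₐc[k] H) (s r : (Form k H)ˣ) :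
    transport a (twist s r) = twist (transport a s) (transport a r) := by
  have : transport a (upull (flip k H) s) = upull (flip k H) (transport a s) := by
    simp only [transport_apply, upull_comp]
    exact congrArg (fun f => upull f s) (hom2_ext fun _ _ => rfl)
  simp only [twist, map_mul, map_inv, this]

variable (k H) in
/-- The semidirect product `Z_L(H) ⋊ Aut_Hopf(H)`. -/
abbrev TwistGroup : Type _ := lazyCocycles k H ⋊[autOnLazy k H] (H ≃ₐc[k] H)

/-- `(s, a) · r = s · (a · r)`. -/
instance : MulAction (TwistGroup k H) (CQT k H) where
  smul g r := ⟨twist (g.left : (Form k H)ˣ) (transport g.right r.1),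
    twist_isCQT g.left.2.1 g.left.2.2 (transport_isCQT r.2)⟩
  one_smul r := Subtype.ext (by
    change twist 1 (transport 1 r.1) = r.1
    simp [twist])
  mul_smul g h r := Subtype.ext (by
    change twist ((g.left : (Form k H)ˣ) * transport g.right h.left) (transport (g.right * h.right) r.1) =
      twist g.left (transport g.right (twist h.left (transport h.right r.1)))
    rw [twist_mul, transport_twist, map_mul, MulAut.mul_apply])
end General

section En

/-- The generators `c`, `x_1, …, x_n`. -/
inductive Gen (n : ℕ) : Type
  | c : Gen n
  | x : Fin n → Gen n

open FreeAlgebra in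
/-- The defining relations of `E(n)`. -/
inductive Rel (k : Type*) [Field k] (n : ℕ) : FreeAlgebra k (Gen n) → FreeAlgebra k (Gen n) → Prop
  | c_sq : Rel k n (ι k Gen.c * ι k Gen.c) 1
  | x_sq (i : Fin n) : Rel k n (ι k (Gen.x i) * ι k (Gen.x i)) 0
  | c_x (i : Fin n) : Rel k n (ι k Gen.c * ι k (Gen.x i)) (-(ι k (Gen.x i) * ι k Gen.c))
  | x_x (i j : Fin n) (h : i < j) :
      Rel k n (ι k (Gen.x i) * ι k (Gen.x j)) (-(ι k (Gen.x j) * ι k (Gen.x i)))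

/-- The algebra `E(n)` generated by `c`, `x_1, …, x_n` subject to the relations `Rel`. -/
def E (k : Type*) [Field k] (n : ℕ) : Type _ := RingQuot (Rel k n)

variable (k : Type*) [Field k] (n : ℕ)
instance : Ring (E k n) := inferInstanceAs (Ring (RingQuot (Rel k n)))
instance : Algebra k (E k n) := inferInstanceAs (Algebra k (RingQuot (Rel k n)))

namespace E
/-- The quotient map from the free algebra. -/
def mk : FreeAlgebra k (Gen n) →ₐ[k] E k n := RingQuot.mkAlgHom k (Rel k n)
/-- The image of a generator in `E(n)`. -/
def gen (g : Gen n) : E k n := mk k n (FreeAlgebra.ι k g)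
/-- The generator `c`. -/
def c : E k n := gen k n Gen.c
/-- The generators `x_i`. -/
def x (i : Fin n) : E k n := gen k n (Gen.x i)

variable {k n}
lemma mk_rel {a b : FreeAlgebra k (Gen n)} (h : Rel k n a b) : mk k n a = mk k n b :=
  RingQuot.mkAlgHom_rel k h
lemma c_sq : c k n * c k n = 1 := by
  have := mk_rel (Rel.c_sq (k := k) (n := n))
  rw [map_mul, map_one] at this; exact this
lemma x_sq (i : Fin n) : x k n i * x k n i = 0 := by
  have := mk_rel (Rel.x_sq (k := k) (n := n) i)
  rw [map_mul, map_zero] at this; exact this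
lemma c_x (i : Fin n) : c k n * x k n i = -(x k n i * c k n) := by
  have := mk_rel (Rel.c_x (k := k) (n := n) i)
  rw [map_mul, map_neg, map_mul] at this; exact this
lemma x_c (i : Fin n) : x k n i * c k n = -(c k n * x k n i) := by rw [c_x, neg_neg]
lemma x_x (i j : Fin n) : x k n i * x k n j = -(x k n j * x k n i) := by
  have key : ∀ i j : Fin n, i < j → x k n i * x k n j = -(x k n j * x k n i) := fun i j h => by
    have := mk_rel (Rel.x_x (k := k) (n := n) i j h)
    rw [map_mul, map_neg, map_mul] at this; exact this
  rcases lt_trichotomy i j with h | h | h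
  · exact key i j h
  · subst h; simp [x_sq]
  · rw [key j i h, neg_neg]

section lift
variable {A : Type*} [Ring A] [Algebra k A]

/-- The universal property of `E(n)`. -/
def lift (c' : A) (x' : Fin n → A) (hc : c' * c' = 1) (hx : ∀ i, x' i * x' i = 0)
    (hcx : ∀ i, c' * x' i = -(x' i * c')) (hxx : ∀ i j, x' i * x' j = -(x' j * x' i)) :
    E k n →ₐ[k] A :=
  RingQuot.liftAlgHom k ⟨FreeAlgebra.lift k (fun g => match g with | .c => c' | .x i => x' i), by
    intro a b h
    cases h with
    | c_sq => simp [hc]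
    | x_sq i => simp [hx]
    | c_x i => simp [hcx]
    | x_x i j _ => simpa using hxx i j⟩

lemma lift_c (c' : A) (x' : Fin n → A) (hc hx hcx hxx) : lift (k := k) c' x' hc hx hcx hxx (c k n) = c' := by
  refine (RingQuot.liftAlgHom_mkAlgHom_apply k _ _ _).trans ?_
  simp
lemma lift_x (c' : A) (x' : Fin n → A) (hc hx hcx hxx) (i : Fin n) :
    lift (k := k) c' x' hc hx hcx hxx (x k n i) = x' i := by
  refine (RingQuot.liftAlgHom_mkAlgHom_apply k _ _ _).trans ?_
  simp

lemma hom_ext {f g : E k n →ₐ[k] A} (hc : f (c k n) = g (c k n)) (hx : ∀ i, f (x k n i) = g (x k n i)) :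
    f = g := by
  apply RingQuot.ringQuot_ext'
  apply FreeAlgebra.hom_ext
  funext t
  cases t
  · exact hc
  · exact hx _
end lift

variable (k n)
/-- The coproduct: `Δ(c) = c ⊗ c`, `Δ(x_i) = 1 ⊗ x_i + x_i ⊗ c`. -/
def comulHom : E k n →ₐ[k] E k n ⊗[k] E k n :=
  lift (c k n ⊗ₜ c k n) (fun i => 1 ⊗ₜ x k n i + x k n i ⊗ₜ c k n)
    (by simp [c_sq, Algebra.TensorProduct.one_def])
    (fun i => by simp [mul_add, add_mul, x_sq, c_sq, x_c, TensorProduct.tmul_neg])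
    (fun i => by simp [mul_add, add_mul, x_c, TensorProduct.tmul_neg, TensorProduct.neg_tmul, c_sq]; abel)
    (fun i j => by
      simp only [mul_add, add_mul, Algebra.TensorProduct.tmul_mul_tmul, one_mul, mul_one, c_sq,
        x_c, x_x i j, TensorProduct.tmul_neg, TensorProduct.neg_tmul]; abel)

/-- The counit: `ε(c) = 1`, `ε(x_i) = 0`. -/
def counitHom : E k n →ₐ[k] k := lift 1 (fun _ => 0) (by simp) (by simp) (by simp) (by simp)

lemma comulHom_c : comulHom k n (c k n) = c k n ⊗ₜ c k n := lift_c ..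
lemma comulHom_x (i) : comulHom k n (x k n i) = 1 ⊗ₜ x k n i + x k n i ⊗ₜ c k n := lift_x ..
lemma counitHom_c : counitHom k n (c k n) = 1 := lift_c ..
lemma counitHom_x (i) : counitHom k n (x k n i) = 0 := lift_x ..

instance : Bialgebra k (E k n) :=
  Bialgebra.ofAlgHom (comulHom k n) (counitHom k n)
    (hom_ext (by simp [comulHom_c]) (fun i => by
      simp [comulHom_c, comulHom_x, TensorProduct.tmul_add, TensorProduct.add_tmul,
        Algebra.TensorProduct.one_def, add_assoc]))
    (hom_ext (by simp [comulHom_c, counitHom_c]) (fun i => by simp [comulHom_x, counitHom_x]))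
    (hom_ext (by simp [comulHom_c, counitHom_c]) (fun i => by
      simp [comulHom_x, counitHom_x, counitHom_c]))

lemma comul_c : Coalgebra.comul (R := k) (c k n) = c k n ⊗ₜ c k n := comulHom_c k n
lemma comul_x (i : Fin n) : Coalgebra.comul (R := k) (x k n i) = 1 ⊗ₜ x k n i + x k n i ⊗ₜ c k n :=
  comulHom_x k n i
lemma counit_c : Coalgebra.counit (R := k) (c k n) = 1 := counitHom_c k n
lemma counit_x (i : Fin n) : Coalgebra.counit (R := k) (x k n i) = 0 := counitHom_x k n i

open MulOpposite in
/-- The antipode as an anti-homomorphism: `S(c) = c`, `S(x_i) = c x_i`. -/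
def antipodeHom : E k n →ₐ[k] (E k n)ᵐᵒᵖ :=
  lift (op (c k n)) (fun i => op (c k n * x k n i))
    (by rw [← op_mul, c_sq, op_one])
    (fun i => by
      rw [← op_mul, mul_assoc, ← mul_assoc (x k n i), x_c, neg_mul, mul_assoc, x_sq]; simp)
    (fun i => by
      rw [← op_mul, ← op_mul, ← op_neg, ← mul_assoc, c_sq, mul_assoc, x_c, mul_neg, ← mul_assoc, c_sq])
    (fun i j => by
      have h : ∀ i j, c k n * x k n i * (c k n * x k n j) = -(x k n i * x k n j) := fun i j => by
        rw [mul_assoc, ← mul_assoc (x k n i), x_c, neg_mul, mul_neg, mul_assoc, ← mul_assoc, c_sq,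
          one_mul]
      rw [← op_mul, ← op_mul, ← op_neg, h, h, x_x j i])

/-- The antipode as a linear map. -/
def antipode : E k n →ₗ[k] E k n :=
  (MulOpposite.opLinearEquiv k).symm.toLinearMap ∘ₗ (antipodeHom k n).toLinearMap

lemma antipode_c : antipode k n (c k n) = c k n := by
  simp [antipode, antipodeHom, lift_c]
lemma antipode_x (i : Fin n) : antipode k n (x k n i) = c k n * x k n i := by
  simp [antipode, antipodeHom, lift_x]
lemma antipode_one : antipode k n 1 = 1 := by simp [antipode]
lemma antipode_mul (a b : E k n) : antipode k n (a * b) = antipode k n b * antipode k n a := by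
  simp [antipode]

lemma induction {P : E k n → Prop} (hk : ∀ r : k, P (algebraMap k _ r)) (hc : P (c k n))
    (hx : ∀ i, P (x k n i)) (hadd : ∀ a b, P a → P b → P (a + b)) (hmul : ∀ a b, P a → P b → P (a * b))
    (a : E k n) : P a := by
  obtain ⟨a, rfl⟩ := RingQuot.mkAlgHom_surjective k (Rel k n) a
  induction a using FreeAlgebra.induction with
  | grade0 r => rw [AlgHom.commutes]; exact hk r
  | grade1 g => cases g; exacts [hc, hx _]
  | mul a b ha hb => rw [map_mul]; exact hmul _ _ ha hb
  | add a b ha hb => rw [map_add]; exact hadd _ _ ha hb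

lemma antipode_left (a : E k n) : LinearMap.mul' k (E k n)
    ((antipode k n).rTensor (E k n) (Coalgebra.comul a)) = algebraMap k (E k n) (Coalgebra.counit a) := by
  induction a using induction with
  | hk r => simp [Algebra.algebraMap_eq_smul_one, Algebra.TensorProduct.one_def, antipode_one]
  | hc => simp [comul_c, counit_c, antipode_c, c_sq]
  | hx i =>
    have h : c k n * x k n i * c k n = -x k n i := by
      rw [mul_assoc, x_c, mul_neg, ← mul_assoc, c_sq, one_mul]
    simp [comul_x, counit_x, antipode_x, antipode_one, h]
  | hadd a b ha hb => simp only [map_add, ha, hb]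
  | hmul a b ha hb =>
    let A := Coalgebra.Repr.arbitrary k a
    let B := Coalgebra.Repr.arbitrary k b
    rw [← A.eq] at ha
    rw [← B.eq] at hb
    rw [Bialgebra.comul_mul, Bialgebra.counit_mul, ← A.eq, ← B.eq]
    simp only [map_sum, LinearMap.rTensor_tmul, LinearMap.mul'_apply] at ha hb
    simp only [Finset.sum_mul, Finset.mul_sum, map_sum, Algebra.TensorProduct.tmul_mul_tmul,
      LinearMap.rTensor_tmul, LinearMap.mul'_apply, antipode_mul, map_mul]
    rw [Algebra.commutes, ← hb, Finset.sum_mul]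
    refine Finset.sum_congr rfl fun j _ => ?_
    rw [mul_assoc, ← Algebra.commutes, ← ha, Finset.sum_mul, Finset.mul_sum]
    exact Finset.sum_congr rfl fun i _ => by simp only [mul_assoc]

lemma antipode_right (a : E k n) : LinearMap.mul' k (E k n)
    ((antipode k n).lTensor (E k n) (Coalgebra.comul a)) = algebraMap k (E k n) (Coalgebra.counit a) := by
  induction a using induction with
  | hk r => simp [Algebra.algebraMap_eq_smul_one, Algebra.TensorProduct.one_def, antipode_one]
  | hc => simp [comul_c, counit_c, antipode_c, c_sq]
  | hx i => simp [comul_x, counit_x, antipode_x, antipode_c, c_x]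
  | hadd a b ha hb => simp only [map_add, ha, hb]
  | hmul a b ha hb =>
    let A := Coalgebra.Repr.arbitrary k a
    let B := Coalgebra.Repr.arbitrary k b
    rw [← A.eq] at ha
    rw [← B.eq] at hb
    rw [Bialgebra.comul_mul, Bialgebra.counit_mul, ← A.eq, ← B.eq]
    simp only [map_sum, LinearMap.lTensor_tmul, LinearMap.mul'_apply] at ha hb
    simp only [Finset.sum_mul, Finset.mul_sum, map_sum, Algebra.TensorProduct.tmul_mul_tmul,
      LinearMap.lTensor_tmul, LinearMap.mul'_apply, antipode_mul, map_mul]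
    rw [Finset.sum_comm, ← ha, Finset.sum_mul]
    refine Finset.sum_congr rfl fun i _ => ?_
    rw [mul_assoc, ← Algebra.commutes, ← hb, Finset.sum_mul, Finset.mul_sum]
    exact Finset.sum_congr rfl fun j _ => by simp only [mul_assoc]

instance : HopfAlgebra k (E k n) where
  antipode := antipode k n
  mul_antipode_rTensor_comul := LinearMap.ext (antipode_left k n)
  mul_antipode_lTensor_comul := LinearMap.ext (antipode_right k n)

/-- The element `c^a x_P`, where `x_P` is the product of the `x_j`, `j ∈ P`, in increasing order. -/
def monomial (a : Fin 2) (P : Finset (Fin n)) : E k n :=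
  c k n ^ (a : ℕ) * ((P.sort (· ≤ ·)).map (x k n)).prod

variable {k n}

/-- The value `r_A(c^a x_P ⊗ c^b x_F)`. It is zero unless `|P| = |F| = s`, and then it is
`(-1)^(b(a+s)) (-1)^(s(s-1)/2) ∑ η ∈ S_s, sign(η) ∏ i, A (p_i) (f_{η(i)})`, where
`p_1 < ⋯ < p_s` and `f_1 < ⋯ < f_s` are the elements of `P` and `F`. -/
def structureValue (A : Matrix (Fin n) (Fin n) k) (a : Fin 2) (P : Finset (Fin n))
    (b : Fin 2) (F : Finset (Fin n)) : k :=
  if h : F.card = P.card then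
    (-1) ^ ((b : ℕ) * ((a : ℕ) + P.card)) * (-1) ^ (P.card * (P.card - 1) / 2) *
      ∑ η : Equiv.Perm (Fin P.card), ((Equiv.Perm.sign η : ℤ) : k) *
        ∏ i : Fin P.card, A (P.orderEmbOfFin rfl i) (F.orderEmbOfFin h (η i))
  else 0

/-- `r` is the form `r_A` attached to the matrix `A`. The elements `c^a x_P` span `E(n)`, so the
values below determine `r`. -/
def IsStructureOf (A : Matrix (Fin n) (Fin n) k) (r : CQT k (E k n)) : Prop :=
  ∀ (a : Fin 2) (P : Finset (Fin n)) (b : Fin 2) (F : Finset (Fin n)),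
    (r.1 : Form k (E k n)).ofConv (monomial k n a P ⊗ₜ monomial k n b F) = structureValue A a P b F
end E

section Matrices
variable (k : Type*) [Field k] (n : ℕ)

/-- The `n × n` block matrix with rows of blocks `(0, I_l, 0)`, `(-I_l, 0, 0)`, `(0, 0, 0)`
(meaningful when `2 l ≤ n`). -/
def J (l : ℕ) : Matrix (Fin n) (Fin n) k := Matrix.of fun i j =>
  if (i : ℕ) < l ∧ (j : ℕ) = i + l then 1 else if (j : ℕ) < l ∧ (i : ℕ) = j + l then -1 else 0

/-- Skew-symmetric `n × n` matrices. -/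
def SkewMatrix : Type _ := {S : Matrix (Fin n) (Fin n) k // S.transpose = -S}

/-- Congruence of skew-symmetric matrices: `T = Mᵀ S M` for some invertible `M`. -/
def congruence : Setoid (SkewMatrix k n) where
  r S T := ∃ M : Matrix (Fin n) (Fin n) k, IsUnit M ∧ T.1 = M.transpose * S.1 * M
  iseqv :=
    { refl := fun S => ⟨1, isUnit_one, by simp⟩
      symm := by
        rintro S T ⟨M, ⟨u, rfl⟩, h⟩
        refine ⟨((u⁻¹ : (Matrix (Fin n) (Fin n) k)ˣ) : Matrix (Fin n) (Fin n) k), (u⁻¹).isUnit, ?_⟩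
        have h1 : (u : Matrix (Fin n) (Fin n) k) * ((u⁻¹ : (Matrix (Fin n) (Fin n) k)ˣ) :
          Matrix (Fin n) (Fin n) k) = 1 := u.mul_inv
        have h2 := congrArg Matrix.transpose h1
        rw [Matrix.transpose_mul, Matrix.transpose_one] at h2
        rw [h]
        simp only [← mul_assoc, h2, one_mul]
        rw [mul_assoc, h1, mul_one]
      trans := by
        rintro S T V ⟨M, hM, h⟩ ⟨N, hN, h'⟩
        refine ⟨M * N, hM.mul hN, ?_⟩
        rw [h', h, Matrix.transpose_mul]
        simp only [mul_assoc] }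

variable {k n}

/-- The skew-symmetric part `(A - Aᵀ) / 2`. -/
def skewPart (A : Matrix (Fin n) (Fin n) k) : SkewMatrix k n :=
  ⟨(2 : k)⁻¹ • (A - A.transpose), by
    rw [Matrix.transpose_smul, Matrix.transpose_sub, Matrix.transpose_transpose, ← smul_neg, neg_sub]⟩

end Matrices
end En

end HopfForms
end

noncomputable section
namespace HopfForms
open scoped TensorProduct
open WithConv

/-! ### Linear forms on tensor products and their partial evaluations. -/

section Linear
variable {k : Type*} [Field k] {C D B : Type*} [AddCommGroup C] [Module k C] [AddCommGroup D]
  [Module k D] [AddCommGroup B] [Module k B]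

/-! A coquasi-triangular structure `r` is read as the map `g ↦ r (g ⊗ -)` into the convolution
algebra `E(n)^*`. The first axiom and invertibility make it an algebra map (`mul_left_iff`,
`IsCQT.ev_one`). The other two axioms, for a given algebra map, become equalities of the form "one
algebra map of `g` corresponds to another", so they need checking on `c` and `x_i` only.

In `E(n)^*` live the character `chi` (`c ↦ -1`, `x_i ↦ 0`) and, for each vector `v`, the skew
derivation `xi v` with `x_j ↦ v_j`. They obey the defining relations of `E(n)`, so every matrix `A`
gives an algebra map `c ↦ chi`, `x_i ↦ xi (A i)`, and hence a structure. Its values on monomials are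
minors of `A`, by Laplace expansion. Conversely the axioms force `r (c ⊗ -) = chi` and `r (x_i ⊗ -)
= xi` of the row `(r (x_i ⊗ x_j))_j` (`evHom_eq_dualHom`), so structures are exactly matrices. No
basis of `E(n)` is used: two functionals agree as soon as their difference is a skew derivation
vanishing on generators (`eq_zero_of_rule`).

On matrices the two parts of the group act as follows. A lazy cocycle `s` subtracts a multiple of
`mat s + (mat s)ᵀ` (`mat_twist`); the plus sign comes from `r (c ⊗ c) = -1`. So the skew part is
untouched. Every matrix occurs as `mat s`, because the quotient of two coquasi-triangular structures
is a lazy cocycle (`IsCQT.inv_mul_mem_lazyCocycles`); hence the symmetric part can be changed at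
will. A Hopf automorphism acts by a congruence (`mat_transport`), and every congruence arises from a
linear substitution of the `x_i` (`linAut`). Orbits are therefore congruence classes of
skew-symmetric parts (`orbit_iff`).

In characteristic different from 2 a skew-symmetric matrix is alternating, so it has a symplectic
basis, which yields some `J_l` (`exists_congr_J`). The rank `2 l` separates these. -/

lemma form_ext {s t : WithConv (C ⊗[k] D →ₗ[k] B)}
    (h : ∀ c d, s.ofConv (c ⊗ₜ d) = t.ofConv (c ⊗ₜ d)) : s = t :=
  WithConv.ofConv_injective (TensorProduct.ext' h)

lemma conv_ext {s t : WithConv (C →ₗ[k] B)}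
    (h : ∀ c, s.ofConv c = t.ofConv c) : s = t :=
  WithConv.ofConv_injective (LinearMap.ext h)

/-- `c ↦ r (c ⊗ -)`. -/
def ev (r : WithConv (C ⊗[k] D →ₗ[k] k)) : C →ₗ[k] WithConv (D →ₗ[k] k) :=
  (WithConv.linearEquiv k _).symm.toLinearMap ∘ₗ TensorProduct.curry r.ofConv

lemma ev_apply (r : WithConv (C ⊗[k] D →ₗ[k] k)) (c : C) (d : D) :
    (ev r c).ofConv d = r.ofConv (c ⊗ₜ d) := rfl
end Linear

/-! ### Convolution algebras of maps out of a tensor product of coalgebras. -/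

section Convolution
variable {k : Type*} [Field k] {C D A : Type*} [Ring A] [Algebra k A] [AddCommGroup C] [Module k C]
  [Coalgebra k C] [AddCommGroup D] [Module k D] [Coalgebra k D]

/-- Precomposition with a coalgebra map, as a homomorphism of convolution algebras. -/
def pullAlg (A : Type*) [Ring A] [Algebra k A] (f : D →ₗc[k] C) :
    WithConv (C →ₗ[k] A) →ₐ[k] WithConv (D →ₗ[k] A) :=
  AlgHom.ofLinearMap
    { toFun := pull f
      map_add' := fun _ _ => rfl
      map_smul' := fun _ _ => rfl } (map_one (pull f)) (map_mul (pull f))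

/-- `emb` as a homomorphism of convolution algebras. -/
def embAlg (k C A : Type*) [Field k] [Ring A] [Algebra k A] [AddCommGroup C] [Module k C] [Coalgebra k C] :
    WithConv (C →ₗ[k] k) →ₐ[k] WithConv (C →ₗ[k] A) :=
  AlgHom.ofLinearMap
    { toFun := emb A
      map_add' := fun s t => by
        apply WithConv.ofConv_injective; ext x; simp [emb]
      map_smul' := fun s t => by
        apply WithConv.ofConv_injective; ext x
        change algebraMap k A (s • t.ofConv x) = s • algebraMap k A (t.ofConv x)
        rw [smul_eq_mul, map_mul, Algebra.smul_def] }
    (by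
      apply WithConv.ofConv_injective; ext x
      simp [emb, LinearMap.convOne_def])
    (fun s t => congrArg toConv (LinearMap.algHom_comp_convMul_distrib (Algebra.ofId k A) s t))

lemma embAlg_apply (s : WithConv (C →ₗ[k] k)) (x : C) :
    (embAlg k C A s).ofConv x = algebraMap k A (s.ofConv x) := rfl

/-- Each factor sees the other leg only through the counit, so the double Sweedler sum collapses.
With the mirror image below, maps supported on different legs commute whenever their values do. -/
lemma pull_prL_mul_pull_prR (F : WithConv (C →ₗ[k] A)) (G : WithConv (D →ₗ[k] A)) (c : C) (d : D) :
    (pull (prL k C D) F * pull (prR k D C) G).ofConv (c ⊗ₜ d) = F.ofConv c * G.ofConv d := by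
  let a := Coalgebra.Repr.arbitrary k c
  let b := Coalgebra.Repr.arbitrary k d
  rw [(tmulRepr a b).convMul_apply]
  refine (Finset.sum_product _ _ _).trans ?_
  have e1 : ∑ i ∈ a.index, Coalgebra.counit (R := k) (a.right i) • a.left i = c :=
    sum_counit_smul_left a
  have e2 : ∑ j ∈ b.index, Coalgebra.counit (R := k) (b.left j) • b.right j = d :=
    Coalgebra.sum_counit_smul b
  conv_rhs => rw [← e1, ← e2]
  simp only [map_sum, Finset.sum_mul_sum]
  refine Finset.sum_congr rfl fun i _ => Finset.sum_congr rfl fun j _ => ?_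
  change F.ofConv (Coalgebra.counit (R := k) (b.left j) • a.left i) *
    G.ofConv (Coalgebra.counit (R := k) (a.right i) • b.right j) = _
  simp only [map_smul, smul_mul_assoc, mul_smul_comm]
  rw [smul_comm]

lemma pull_prR_mul_pull_prL (F : WithConv (C →ₗ[k] A)) (G : WithConv (D →ₗ[k] A)) (c : C) (d : D) :
    (pull (prR k D C) G * pull (prL k C D) F).ofConv (c ⊗ₜ d) = G.ofConv d * F.ofConv c := by
  let a := Coalgebra.Repr.arbitrary k c
  let b := Coalgebra.Repr.arbitrary k d
  rw [(tmulRepr a b).convMul_apply]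
  refine (Finset.sum_product _ _ _).trans ?_
  have e1 : ∑ i ∈ a.index, Coalgebra.counit (R := k) (a.left i) • a.right i = c :=
    Coalgebra.sum_counit_smul a
  have e2 : ∑ j ∈ b.index, Coalgebra.counit (R := k) (b.right j) • b.left j = d :=
    sum_counit_smul_left b
  conv_rhs => rw [← e1, ← e2]
  simp only [map_sum, Finset.sum_mul_sum]
  rw [Finset.sum_comm]
  refine Finset.sum_congr rfl fun i _ => Finset.sum_congr rfl fun j _ => ?_
  change G.ofConv (Coalgebra.counit (R := k) (a.left j) • b.left i) *
    F.ofConv (Coalgebra.counit (R := k) (b.right i) • a.right j) = _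
  simp only [map_smul, smul_mul_assoc, mul_smul_comm]
  rw [smul_comm]

/-- Forms on `C ⊗ D` from maps `C → (D → k)`. -/
def uncurry (k C D : Type*) [Field k] [AddCommGroup C] [Module k C] [Coalgebra k C]
    [AddCommGroup D] [Module k D] [Coalgebra k D] :
    WithConv (C →ₗ[k] WithConv (D →ₗ[k] k)) →* WithConv (C ⊗[k] D →ₗ[k] k) where
  toFun F := toConv (TensorProduct.lift ((WithConv.linearEquiv k _).toLinearMap ∘ₗ F.ofConv))
  map_one' := form_ext fun c d => by
    simp [LinearMap.convOne_def, Algebra.algebraMap_eq_smul_one, mul_comm]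
  map_mul' F G := form_ext fun c d => by
    let a := Coalgebra.Repr.arbitrary k c
    let b := Coalgebra.Repr.arbitrary k d
    change ((F * G).ofConv c).ofConv d = _
    rw [a.convMul_apply, (tmulRepr a b).convMul_apply]
    refine Eq.trans ?_ (Finset.sum_product _ _ _).symm
    rw [WithConv.ofConv_sum, LinearMap.sum_apply]
    refine Finset.sum_congr rfl fun i _ => ?_
    rw [b.convMul_apply]
    rfl

lemma uncurry_apply (F : WithConv (C →ₗ[k] WithConv (D →ₗ[k] k))) (c : C) (d : D) :
    (uncurry k C D F).ofConv (c ⊗ₜ d) = (F.ofConv c).ofConv d := rfl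

end Convolution

/-! ### Coquasi-triangular structures as algebra maps into the dual; their quotients. -/

section General
variable {k : Type*} {H : Type*} [Field k] [Ring H] [HopfAlgebra k H]

/-- `h ↦ r (- ⊗ h)`. -/
def coev (r : Form k H) : H →ₗ[k] WithConv (H →ₗ[k] k) := ev (pull (flip k H) r)

lemma coev_apply (r : Form k H) (g h : H) : (coev r h).ofConv g = r.ofConv (g ⊗ₜ h) := rfl

/-- After currying the last leg, both factors are maps into the dual algebra pulled back from the
two projections of `H ⊗ H`, so their convolution is a product in the dual. -/
lemma e13_mul_e23_apply (s t : Form k H) (g h m : H) :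
    (pull (e13 k H) s * pull (e23 k H) t).ofConv ((g ⊗ₜ h) ⊗ₜ m) = (ev s g * ev t h).ofConv m := by
  have h1 : pull (e13 k H) s = uncurry k (H ⊗[k] H) H (pull (prL k H H) (toConv (ev s))) := by
    apply WithConv.ofConv_injective; apply TensorProduct.ext_threefold; intro a b c; rfl
  have h2 : pull (e23 k H) t = uncurry k (H ⊗[k] H) H (pull (prR k H H) (toConv (ev t))) := by
    apply WithConv.ofConv_injective; apply TensorProduct.ext_threefold; intro a b c
    change t.ofConv (Coalgebra.counit (R := k) a • (b ⊗ₜ[k] c)) =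
      (ev t (Coalgebra.counit (R := k) a • b)).ofConv c
    simp [ev_apply]
  rw [h1, h2, ← map_mul, uncurry_apply, pull_prL_mul_pull_prR]

lemma e23_mul_e13_apply (s t : Form k H) (g h m : H) :
    (pull (e23 k H) s * pull (e13 k H) t).ofConv ((g ⊗ₜ h) ⊗ₜ m) = (ev s h * ev t g).ofConv m := by
  have h1 : pull (e13 k H) t = uncurry k (H ⊗[k] H) H (pull (prL k H H) (toConv (ev t))) := by
    apply WithConv.ofConv_injective; apply TensorProduct.ext_threefold; intro a b c; rfl
  have h2 : pull (e23 k H) s = uncurry k (H ⊗[k] H) H (pull (prR k H H) (toConv (ev s))) := by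
    apply WithConv.ofConv_injective; apply TensorProduct.ext_threefold; intro a b c
    change s.ofConv (Coalgebra.counit (R := k) a • (b ⊗ₜ[k] c)) =
      (ev s (Coalgebra.counit (R := k) a • b)).ofConv c
    simp [ev_apply]
  rw [h1, h2, ← map_mul, uncurry_apply, pull_prR_mul_pull_prL]

/-- A cyclic permutation of the three legs, combined with the flip, reduces this to
`e23_mul_e13_apply`. -/
lemma e13_mul_e12_apply (s t : Form k H) (g h m : H) :
    (pull (e13 k H) s * pull (e12 k H) t).ofConv ((g ⊗ₜ h) ⊗ₜ m) =
      (coev s m * coev t h).ofConv g := by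
  rw [coev, coev, ← e23_mul_e13_apply]
  have h1 : (e13 k H).comp ((swap12 k H).comp (swap23 k H)) = (flip k H).comp (e23 k H) :=
    hom3_ext fun a b c => by
      simp [swap12_tmul, swap23_tmul, e23_tmul, e13_tmul, flip_tmul, TensorProduct.smul_tmul']
  have h2 : (e12 k H).comp ((swap12 k H).comp (swap23 k H)) = (flip k H).comp (e13 k H) :=
    hom3_ext fun a b c => by
      simp [swap12_tmul, swap23_tmul, e12_tmul, e13_tmul, flip_tmul]
  have h3 : pull ((swap12 k H).comp (swap23 k H)) (pull (e13 k H) s * pull (e12 k H) t) =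
      pull (e23 k H) (pull (flip k H) s) * pull (e13 k H) (pull (flip k H) t) := by
    rw [map_mul]
    change pull ((e13 k H).comp ((swap12 k H).comp (swap23 k H))) s *
      pull ((e12 k H).comp ((swap12 k H).comp (swap23 k H))) t = _
    rw [h1, h2]; rfl
  exact congrArg (fun z => z.ofConv ((h ⊗ₜ m) ⊗ₜ g)) h3

lemma mul_left_iff (r : (Form k H)ˣ) :
    upull (mul12 k H) r = upull (e13 k H) r * upull (e23 k H) r ↔
      ∀ g h, ev r.1 (g * h) = ev r.1 g * ev r.1 h := by
  rw [Units.ext_iff]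
  constructor
  · intro e g h
    refine conv_ext fun m => ?_
    rw [← e13_mul_e23_apply]
    exact congrArg (fun z => z.ofConv ((g ⊗ₜ h) ⊗ₜ m)) e
  · intro e
    apply WithConv.ofConv_injective; apply TensorProduct.ext_threefold; intro g h m
    refine Eq.trans ?_ (e13_mul_e23_apply r.1 r.1 g h m).symm
    rw [← e]; rfl

lemma mul_right_iff (r : (Form k H)ˣ) :
    upull (mul23 k H) r = upull (e13 k H) r * upull (e12 k H) r ↔
      ∀ h m, coev r.1 (h * m) = coev r.1 m * coev r.1 h := by
  rw [Units.ext_iff]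
  constructor
  · intro e h m
    refine conv_ext fun g => ?_
    rw [← e13_mul_e12_apply]
    exact congrArg (fun z => z.ofConv ((g ⊗ₜ h) ⊗ₜ m)) e
  · intro e
    apply WithConv.ofConv_injective; apply TensorProduct.ext_threefold; intro g h m
    refine Eq.trans ?_ (e13_mul_e12_apply r.1 r.1 g h m).symm
    rw [← e]; rfl

lemma isUnit_ev_one (r : (Form k H)ˣ) : IsUnit (ev r.1 (1 : H)) := by
  let f : H →ₗc[k] H ⊗[k] H := (Coalgebra.TensorProduct.map (Bialgebra.unitBialgHom k H).toCoalgHom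
    (CoalgHom.id k H)).comp (Coalgebra.TensorProduct.lid k H).symm.toCoalgHom
  refine ⟨Units.map (pull f) r, conv_ext fun x => ?_⟩
  change (r : Form k H).ofConv (f x) = (r : Form k H).ofConv (1 ⊗ₜ x)
  congr 1
  change algebraMap k H 1 ⊗ₜ[k] x = 1 ⊗ₜ x
  rw [map_one]

lemma IsCQT.ev_mul {r : (Form k H)ˣ} (hr : IsCQT r) (g h : H) :
    ev r.1 (g * h) = ev r.1 g * ev r.1 h := (mul_left_iff r).1 hr.mul_left g h

lemma IsCQT.coev_mul {r : (Form k H)ˣ} (hr : IsCQT r) (h m : H) :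
    coev r.1 (h * m) = coev r.1 m * coev r.1 h := (mul_right_iff r).1 hr.mul_right h m

/-- The axioms do not mention the unit: multiplicativity makes `r (1 ⊗ -)` idempotent, and an
invertible idempotent is the unit. -/
lemma IsCQT.ev_one {r : (Form k H)ˣ} (hr : IsCQT r) : ev r.1 (1 : H) = 1 := by
  have h := hr.ev_mul 1 1
  rw [mul_one] at h
  exact (isUnit_ev_one r).mul_left_cancel (by rw [← h, mul_one])

lemma IsCQT.coev_one {r : (Form k H)ˣ} (hr : IsCQT r) : coev r.1 (1 : H) = 1 := by
  have h := hr.coev_mul 1 1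
  rw [mul_one] at h
  exact (isUnit_ev_one (upull (flip k H) r)).mul_left_cancel (by
    change coev r.1 1 * coev r.1 1 = coev r.1 1 * 1
    rw [← h, mul_one])

lemma emb_inv_mul (s : (Form k H)ˣ) : emb H ((s⁻¹ : (Form k H)ˣ) : Form k H) * emb H s.1 = 1 := by
  rw [← emb_mul, Units.inv_mul, emb_one]

lemma emb_mul_inv (s : (Form k H)ˣ) : emb H s.1 * emb H ((s⁻¹ : (Form k H)ˣ) : Form k H) = 1 := by
  rw [← emb_mul, Units.mul_inv, emb_one]

lemma mul12_swap (r : (Form k H)ˣ) (hr : IsCQT r) :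
    upull ((mul12 k H).comp (swap12 k H)) r = upull (e23 k H) r * upull (e13 k H) r := by
  have E23_12 : (e23 k H).comp (swap12 k H) = e13 k H := hom3_ext fun a b c => by
    simp [swap12_tmul, e23_tmul, e13_tmul, TensorProduct.smul_tmul']
  have E13_12 : (e13 k H).comp (swap12 k H) = e23 k H := hom3_ext fun a b c => by
    simp [swap12_tmul, e23_tmul, e13_tmul, TensorProduct.smul_tmul']
  rw [← upull_comp, hr.mul_left, map_mul, upull_comp, upull_comp, E23_12, E13_12]

/-- Both sides of the cocycle identity equal `r₂₃ * r₁₃ * r₁₂`. -/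
lemma IsCQT.isCocycle {r : (Form k H)ˣ} (hr : IsCQT r) : IsCocycle r := by
  rw [IsCocycle, hr.comm12 r, mul12_swap r hr, hr.mul_right, mul_assoc]

/-- The quotient of two coquasi-triangular structures is a lazy cocycle. -/
lemma IsCQT.inv_mul_mem_lazyCocycles {a b : (Form k H)ˣ} (ha : IsCQT a) (hb : IsCQT b) :
    b⁻¹ * a ∈ lazyCocycles k H := by
  refine ⟨?_, ?_⟩
  · have a12 := ha.comm12 b
    have b12 := hb.comm12 b
    have a23 := ha.comm23 b
    have b23 := hb.comm23 b
    have ca := ha.isCocycle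
    have cb := hb.isCocycle
    unfold IsCocycle at ca cb ⊢
    simp only [map_mul, map_inv]
    -- Both `x` and `y` conjugate `m` to the same element, so `y⁻¹ * x` commutes with `m`. With `m`
    -- and `n` the pullbacks of `b` and `a` along a multiplication, this splits the cocycle identity
    -- of the quotient into those of `a` and `b`.
    have aux : ∀ {G : Type _} [Group G] {x y m n m' : G}, x * m = m' * x → y * m = m' * y →
        y⁻¹ * x * (m⁻¹ * n) = (y * m)⁻¹ * (x * n) := by
      intro G _ x y m n m' h1 h2
      have : m' = x * m * x⁻¹ := by rw [h1]; group
      rw [h2, this]; group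
    rw [aux a12 b12, aux a23 b23, ca, cb]
  · unfold IsLazy
    -- `a` exchanges the multiplication with its opposite, and `b⁻¹` exchanges them back; the
    -- composite is lazy.
    have key : emb H ((b⁻¹ : (Form k H)ˣ) : Form k H) * mulOpForm k H =
        mulForm k H * emb H ((b⁻¹ : (Form k H)ˣ) : Form k H) := by
     calc _ = emb H ((b⁻¹ : (Form k H)ˣ) : Form k H) * mulOpForm k H *
          (emb H b.1 * emb H ((b⁻¹ : (Form k H)ˣ) : Form k H)) := by rw [emb_mul_inv, mul_one]
      _ = emb H ((b⁻¹ : (Form k H)ˣ) : Form k H) * (mulOpForm k H * emb H b.1) *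
          emb H ((b⁻¹ : (Form k H)ˣ) : Form k H) := by simp only [mul_assoc]
      _ = _ := by rw [← hb.comm, ← mul_assoc, emb_inv_mul, one_mul]
    rw [Units.val_mul, emb_mul, mul_assoc, ha.comm, ← mul_assoc, key, mul_assoc]
end General

/-! ### Coquasi-triangular structures built from an algebra map into the dual. -/

section General
variable {k : Type*} {H : Type*} [Field k] [Ring H] [HopfAlgebra k H]

lemma cst_mul_apply_aux (g : H) (F : WithConv (H →ₗ[k] H)) (h : H) :
    ((toConv ((Coalgebra.counit (R := k) (A := H)).smulRight g) : WithConv (H →ₗ[k] H)) * F).ofConv h =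
      g * F.ofConv h := by
  let b := Coalgebra.Repr.arbitrary k h
  rw [b.convMul_apply]
  conv_rhs => rw [← Coalgebra.sum_counit_smul b]
  simp only [map_sum, Finset.mul_sum]
  refine Finset.sum_congr rfl fun i _ => ?_
  change (Coalgebra.counit (R := k) (b.left i) • g) * _ = _
  rw [map_smul, smul_mul_assoc, mul_smul_comm]

lemma mul_cst_apply_aux (g : H) (F : WithConv (H →ₗ[k] H)) (h : H) :
    (F * (toConv ((Coalgebra.counit (R := k) (A := H)).smulRight g) : WithConv (H →ₗ[k] H))).ofConv h =
      F.ofConv h * g := by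
  let b := Coalgebra.Repr.arbitrary k h
  rw [b.convMul_apply]
  conv_rhs => rw [← sum_counit_smul_left b]
  simp only [map_sum, Finset.sum_mul]
  refine Finset.sum_congr rfl fun i _ => ?_
  change _ * (Coalgebra.counit (R := k) (b.right i) • g) = _
  rw [map_smul, smul_mul_assoc, mul_smul_comm]

/-- The constant map `h ↦ ε(h) g`, as an algebra homomorphism in `g`. -/
def cst (k H : Type*) [Field k] [Ring H] [HopfAlgebra k H] : H →ₐ[k] WithConv (H →ₗ[k] H) :=
  AlgHom.ofLinearMap
    ((WithConv.linearEquiv k _).symm.toLinearMap ∘ₗ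
      LinearMap.smulRightₗ (Coalgebra.counit (R := k) (A := H)))
    (conv_ext fun h => (Algebra.algebraMap_eq_smul_one _).symm)
    (fun a b => conv_ext fun h => by
      refine Eq.trans ?_ (cst_mul_apply_aux a _ h).symm
      exact (mul_smul_comm _ _ _).symm)

lemma cst_mul_apply (g : H) (F : WithConv (H →ₗ[k] H)) (h : H) :
    (cst k H g * F).ofConv h = g * F.ofConv h := cst_mul_apply_aux g F h

lemma mul_cst_apply (g : H) (F : WithConv (H →ₗ[k] H)) (h : H) :
    (F * cst k H g).ofConv h = F.ofConv h * g := mul_cst_apply_aux g F h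

/-- One factor takes central scalar values. This commutation is what allows `leftHom` and `rightHom`
to be defined by lifting from the tensor product, hence to be algebra maps. -/
lemma embAlg_commute_cst (f : WithConv (H →ₗ[k] k)) (g : H) :
    Commute (embAlg k H H f) (cst k H g) :=
  conv_ext fun h => by
    rw [mul_cst_apply, cst_mul_apply, embAlg_apply, Algebra.commutes]

/-- The form `g ⊗ h ↦ R g h`. -/
def formOf (R : H →ₐ[k] WithConv (H →ₗ[k] k)) : (Form k H)ˣ where
  val := uncurry k H H (toConv R.toLinearMap)
  -- Composition with an algebra map respects convolution, so the inverse of `R` is `R` after the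
  -- antipode.
  inv := uncurry k H H (toConv (R.toLinearMap ∘ₗ HopfAlgebra.antipode k))
  val_inv := by
    rw [← map_mul, ← map_one (uncurry k H H)]
    congr 1
    have := congrArg (fun z => toConv (R.toLinearMap ∘ₗ z.ofConv))
      (LinearMap.id_mul_antipode (R := k) (C := H))
    simp only [LinearMap.algHom_comp_convMul_distrib] at this
    refine Eq.trans this (conv_ext fun h => ?_)
    exact AlgHom.commutes R _
  inv_val := by
    rw [← map_mul, ← map_one (uncurry k H H)]
    congr 1
    have := congrArg (fun z => toConv (R.toLinearMap ∘ₗ z.ofConv))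
      (LinearMap.antipode_mul_id (R := k) (C := H))
    simp only [LinearMap.algHom_comp_convMul_distrib] at this
    refine Eq.trans this (conv_ext fun h => ?_)
    exact AlgHom.commutes R _

section lift
variable {B : Type*} [Ring B] [Algebra k B] (f f' : H →ₐ[k] B) (hf : ∀ a b, Commute (f a) (f' b))

lemma lift_comul_tmul {g a b : H} (h : Coalgebra.comul (R := k) g = a ⊗ₜ b) :
    (Algebra.TensorProduct.lift f f' hf).comp (Bialgebra.comulAlgHom k H) g = f a * f' b := by
  rw [AlgHom.comp_apply, Bialgebra.comulAlgHom_apply, h, Algebra.TensorProduct.lift_tmul]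

lemma lift_comul_add {g a b a' b' : H} (h : Coalgebra.comul (R := k) g = a ⊗ₜ b + a' ⊗ₜ b') :
    (Algebra.TensorProduct.lift f f' hf).comp (Bialgebra.comulAlgHom k H) g =
      f a * f' b + f a' * f' b' := by
  rw [AlgHom.comp_apply, Bialgebra.comulAlgHom_apply, h, map_add, Algebra.TensorProduct.lift_tmul,
    Algebra.TensorProduct.lift_tmul]
end lift

/-- `g ↦ (h ↦ ∑ R g₁ h ⋅ g₂)`. -/
def leftHom (R : H →ₐ[k] WithConv (H →ₗ[k] k)) : H →ₐ[k] WithConv (H →ₗ[k] H) :=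
  (Algebra.TensorProduct.lift ((embAlg k H H).comp R) (cst k H)
    (fun _ _ => embAlg_commute_cst _ _)).comp (Bialgebra.comulAlgHom k H)

/-- `g ↦ (h ↦ ∑ g₁ ⋅ R g₂ h)`. -/
def rightHom (R : H →ₐ[k] WithConv (H →ₗ[k] k)) : H →ₐ[k] WithConv (H →ₗ[k] H) :=
  (Algebra.TensorProduct.lift (cst k H) ((embAlg k H H).comp R)
    (fun _ _ => (embAlg_commute_cst _ _).symm)).comp (Bialgebra.comulAlgHom k H)

lemma emb_formOf_mul_mulForm_apply (R : H →ₐ[k] WithConv (H →ₗ[k] k)) (g h : H) :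
    (emb H (formOf R).1 * mulForm k H).ofConv (g ⊗ₜ h) =
      (leftHom R g * toConv LinearMap.id).ofConv h := by
  let a := Coalgebra.Repr.arbitrary k g
  let b := Coalgebra.Repr.arbitrary k h
  have e : leftHom R g = ∑ i ∈ a.index, embAlg k H H (R (a.left i)) * cst k H (a.right i) := by
    change Algebra.TensorProduct.lift ((embAlg k H H).comp R) (cst k H)
      (fun _ _ => embAlg_commute_cst _ _) (Coalgebra.comul g) = _
    rw [← a.eq, map_sum]
    exact Finset.sum_congr rfl fun i _ => Algebra.TensorProduct.lift_tmul ..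
  rw [e, (tmulRepr a b).convMul_apply, Finset.sum_mul, WithConv.ofConv_sum, LinearMap.sum_apply]
  refine (Finset.sum_product _ _ _).trans (Finset.sum_congr rfl fun i _ => ?_)
  rw [mul_assoc, b.convMul_apply]
  refine Finset.sum_congr rfl fun j _ => ?_
  rw [cst_mul_apply]
  rfl

lemma mulOpForm_mul_emb_formOf_apply (R : H →ₐ[k] WithConv (H →ₗ[k] k)) (g h : H) :
    (mulOpForm k H * emb H (formOf R).1).ofConv (g ⊗ₜ h) =
      (toConv LinearMap.id * rightHom R g).ofConv h := by
  let a := Coalgebra.Repr.arbitrary k g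
  let b := Coalgebra.Repr.arbitrary k h
  have e : rightHom R g = ∑ i ∈ a.index, cst k H (a.left i) * embAlg k H H (R (a.right i)) := by
    change Algebra.TensorProduct.lift (cst k H) ((embAlg k H H).comp R)
      (fun _ _ => (embAlg_commute_cst _ _).symm) (Coalgebra.comul g) = _
    rw [← a.eq, map_sum]
    exact Finset.sum_congr rfl fun i _ => Algebra.TensorProduct.lift_tmul ..
  rw [e, (tmulRepr a b).convMul_apply, Finset.mul_sum, WithConv.ofConv_sum, LinearMap.sum_apply]
  refine (Finset.sum_product _ _ _).trans (Finset.sum_congr rfl fun i _ => ?_)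
  rw [← mul_assoc, b.convMul_apply]
  refine Finset.sum_congr rfl fun j _ => ?_
  rw [mul_cst_apply]
  rfl

/-- The hypothesis is stable under products in `g`, since both sides involve `g` through algebra
maps; this makes it enough to check the third axiom on generators. -/
lemma comm_formOf (R : H →ₐ[k] WithConv (H →ₗ[k] k))
    (h : ∀ g, leftHom R g * toConv LinearMap.id = toConv LinearMap.id * rightHom R g) :
    emb H (formOf R).1 * mulForm k H = mulOpForm k H * emb H (formOf R).1 :=
  form_ext fun g m => by
    rw [emb_formOf_mul_mulForm_apply, mulOpForm_mul_emb_formOf_apply, h]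

variable (k H) in
/-- Pullback of `A`-valued maps along the multiplication `H ⊗ H → H`. -/
abbrev pm (A : Type*) [Ring A] [Algebra k A] := pullAlg (k := k) A (Bialgebra.mulCoalgHom k H)
variable (k H) in
/-- Pullback of `A`-valued maps along `h ⊗ m ↦ ε(m) h`. -/
abbrev pl (A : Type*) [Ring A] [Algebra k A] := pullAlg (k := k) A (prL k H H)
variable (k H) in
/-- Pullback of `A`-valued maps along `h ⊗ m ↦ ε(h) m`. -/
abbrev pr (A : Type*) [Ring A] [Algebra k A] := pullAlg (k := k) A (prR k H H)

section pulls
variable {A : Type*} [Ring A] [Algebra k A]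

lemma pm_apply (F : WithConv (H →ₗ[k] A)) (h m : H) :
    (pm k H A F).ofConv (h ⊗ₜ m) = F.ofConv (h * m) := rfl

lemma pl_mul_pr_apply (F G : WithConv (H →ₗ[k] A)) (h m : H) :
    (pl k H A F * pr k H A G).ofConv (h ⊗ₜ m) = F.ofConv h * G.ofConv m :=
  pull_prL_mul_pull_prR F G h m

lemma pr_mul_pl_apply (F G : WithConv (H →ₗ[k] A)) (h m : H) :
    (pr k H A G * pl k H A F).ofConv (h ⊗ₜ m) = G.ofConv m * F.ofConv h :=
  pull_prR_mul_pull_prL F G h m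

lemma pl_apply (F : WithConv (H →ₗ[k] A)) (h m : H) :
    (pl k H A F).ofConv (h ⊗ₜ m) = Coalgebra.counit (R := k) m • F.ofConv h :=
  map_smul F.ofConv _ _

lemma pl_pr_commute (F G : WithConv (H →ₗ[k] k)) : pl k H k F * pr k H k G = pr k H k G * pl k H k F :=
  form_ext fun h m => by rw [pl_mul_pr_apply, pr_mul_pl_apply, mul_comm]

lemma pr_embAlg_commute (f : WithConv (H →ₗ[k] k)) (F : WithConv (H →ₗ[k] A)) :
    pr k H A (embAlg k H A f) * pl k H A F = pl k H A F * pr k H A (embAlg k H A f) :=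
  form_ext fun h m => by
    rw [pl_mul_pr_apply, pr_mul_pl_apply, embAlg_apply, Algebra.commutes]

lemma pl_embAlg_commute (f : WithConv (H →ₗ[k] k)) (F : WithConv (H →ₗ[k] A)) :
    pr k H A F * pl k H A (embAlg k H A f) = pl k H A (embAlg k H A f) * pr k H A F :=
  form_ext fun h m => by
    rw [pl_mul_pr_apply, pr_mul_pl_apply, embAlg_apply, Algebra.commutes]

lemma pm_id : pm k H H (toConv LinearMap.id) =
    pl k H H (toConv LinearMap.id) * pr k H H (toConv LinearMap.id) :=
  form_ext fun h m => by rw [pl_mul_pr_apply]; rfl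

lemma pm_embAlg (f : WithConv (H →ₗ[k] k)) : pm k H A (embAlg k H A f) = embAlg k (H ⊗[k] H) A (pm k H k f) := rfl
lemma pl_embAlg (f : WithConv (H →ₗ[k] k)) : pl k H A (embAlg k H A f) = embAlg k (H ⊗[k] H) A (pl k H k f) := rfl
lemma pr_embAlg (f : WithConv (H →ₗ[k] k)) : pr k H A (embAlg k H A f) = embAlg k (H ⊗[k] H) A (pr k H k f) := rfl
end pulls

/-- If `f (h m) = ∑ u (h) v (m)` for a family `u`, `v`, then `f ⇀ id` obeys the same rule. -/
lemma emb_mul_id_apply_mul {f u v u' v' : WithConv (H →ₗ[k] k)}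
    (hf : pm k H k f = pl k H k u * pr k H k v + pl k H k u' * pr k H k v') (h m : H) :
    (embAlg k H H f * toConv LinearMap.id).ofConv (h * m) =
      (embAlg k H H u * toConv LinearMap.id).ofConv h * (embAlg k H H v * toConv LinearMap.id).ofConv m +
      (embAlg k H H u' * toConv LinearMap.id).ofConv h *
        (embAlg k H H v' * toConv LinearMap.id).ofConv m := by
  rw [← pl_mul_pr_apply, ← pl_mul_pr_apply, ← pm_apply, ← LinearMap.add_apply, ← WithConv.ofConv_add]
  congr 2
  simp only [map_mul, pm_id, pm_embAlg, hf, map_add, ← pl_embAlg, ← pr_embAlg, add_mul]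
  congr 1 <;>
  · rw [mul_assoc, mul_assoc, ← mul_assoc (pr k H H _), pr_embAlg_commute, mul_assoc]

lemma id_mul_emb_apply_mul {f u v u' v' : WithConv (H →ₗ[k] k)}
    (hf : pm k H k f = pl k H k u * pr k H k v + pl k H k u' * pr k H k v') (h m : H) :
    (toConv LinearMap.id * embAlg k H H f).ofConv (h * m) =
      (toConv LinearMap.id * embAlg k H H u).ofConv h * (toConv LinearMap.id * embAlg k H H v).ofConv m +
      (toConv LinearMap.id * embAlg k H H u').ofConv h *
        (toConv LinearMap.id * embAlg k H H v').ofConv m := by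
  rw [← pl_mul_pr_apply, ← pl_mul_pr_apply, ← pm_apply, ← LinearMap.add_apply, ← WithConv.ofConv_add]
  congr 2
  simp only [map_mul, pm_id, pm_embAlg, hf, map_add, ← pl_embAlg, ← pr_embAlg, mul_add]
  congr 1 <;>
  · rw [mul_assoc, mul_assoc, ← mul_assoc (pr k H H _), pl_embAlg_commute, mul_assoc]

/-- `g ↦ (h ⊗ m ↦ ∑ R g₁ m ⋅ R g₂ h)`. -/
def splitHom (R : H →ₐ[k] WithConv (H →ₗ[k] k)) : H →ₐ[k] WithConv (H ⊗[k] H →ₗ[k] k) :=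
  (Algebra.TensorProduct.lift ((pr k H k).comp R) ((pl k H k).comp R)
    (fun _ _ => (pl_pr_commute _ _).symm)).comp (Bialgebra.comulAlgHom k H)

lemma splitHom_apply (R : H →ₐ[k] WithConv (H →ₗ[k] k)) (g h m : H) :
    (splitHom R g).ofConv (h ⊗ₜ m) = (coev (formOf R).1 m * coev (formOf R).1 h).ofConv g := by
  let a := Coalgebra.Repr.arbitrary k g
  have e : splitHom R g = ∑ i ∈ a.index, pr k H k (R (a.left i)) * pl k H k (R (a.right i)) := by
    change Algebra.TensorProduct.lift ((pr k H k).comp R) ((pl k H k).comp R)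
      (fun _ _ => (pl_pr_commute _ _).symm) (Coalgebra.comul g) = _
    rw [← a.eq, map_sum]
    exact Finset.sum_congr rfl fun i _ => Algebra.TensorProduct.lift_tmul ..
  rw [e, a.convMul_apply, WithConv.ofConv_sum, LinearMap.sum_apply]
  refine Finset.sum_congr rfl fun i _ => ?_
  rw [pr_mul_pl_apply]; rfl

/-- The first axiom is the multiplicativity of `R`. The second has become an equality of two algebra
maps out of `H`, again verifiable on generators. -/
lemma isCQT_formOf {R : H →ₐ[k] WithConv (H →ₗ[k] k)} (hR : (pm k H k).comp R = splitHom R)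
    (h : ∀ g, leftHom R g * toConv LinearMap.id = toConv LinearMap.id * rightHom R g) :
    IsCQT (formOf R) where
  mul_left := (mul_left_iff _).2 fun g h => map_mul R g h
  mul_right := (mul_right_iff _).2 fun h m => conv_ext fun g => by
    rw [← splitHom_apply, ← hR]; rfl
  comm := comm_formOf R h
end General

/-! ### The functionals `chi` and `xi` on `E(n)`, and the structure attached to a matrix. -/

namespace E
variable {k : Type*} [Field k] {n : ℕ}

/-- A skew derivation is determined by its values on generators. This replaces a monomial basis:
identities between functionals or operators on `E(n)` are obtained by exhibiting the difference of
the two sides as such an `f`. -/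
lemma eq_zero_of_rule {B : Type*} [Ring B] [Algebra k B] {f : E k n → B} {u w : E k n → B}
    (hadd : ∀ a b, f (a + b) = f a + f b) (hsmul : ∀ (a : k) b, f (a • b) = a • f b)
    (h1 : f 1 = 0) (hc : f (c k n) = 0) (hx : ∀ i, f (x k n i) = 0)
    (hmul : ∀ h m, f (h * m) = u h * f m + f h * w m) (a : E k n) : f a = 0 := by
  induction a using E.induction with
  | hk r => rw [Algebra.algebraMap_eq_smul_one, hsmul, h1, smul_zero]
  | hc => exact hc
  | hx i => exact hx i
  | hadd a b ha hb => rw [hadd, ha, hb, add_zero]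
  | hmul a b ha hb => rw [hmul, ha, hb, mul_zero, zero_mul, add_zero]

variable (k n) in
/-- The character `c ↦ -1`, `x_i ↦ 0`. -/
def charHom : E k n →ₐ[k] k := lift (-1) (fun _ => 0) (by simp) (by simp) (by simp) (by simp)

variable (k n) in
/-- The character `c ↦ -1`, `x_i ↦ 0`, in the dual algebra. -/
def chi : WithConv (E k n →ₗ[k] k) := toConv (charHom k n).toLinearMap

lemma chi_one : (chi k n).ofConv 1 = 1 := map_one (charHom k n)
lemma chi_c : (chi k n).ofConv (c k n) = -1 := lift_c ..
lemma chi_x (i : Fin n) : (chi k n).ofConv (x k n i) = 0 := lift_x ..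
lemma chi_mul (a b : E k n) : (chi k n).ofConv (a * b) = (chi k n).ofConv a * (chi k n).ofConv b :=
  map_mul (charHom k n) a b

/-- The representation `c ↦ diag (-1, 1)`, `x_j ↦ v_j E₁₂`. -/
def matHom (v : Fin n → k) : E k n →ₐ[k] Matrix (Fin 2) (Fin 2) k :=
  lift !![-1, 0; 0, 1] (fun j => !![0, v j; 0, 0])
    (by ext i j; fin_cases i <;> fin_cases j <;> simp [Matrix.mul_apply])
    (fun _ => by ext i j; fin_cases i <;> fin_cases j <;> simp [Matrix.mul_apply])
    (fun _ => by ext i j; fin_cases i <;> fin_cases j <;> simp [Matrix.mul_apply])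
    (fun _ _ => by ext i j; fin_cases i <;> fin_cases j <;> simp [Matrix.mul_apply])

/-- The representation is triangular with diagonal characters `chi` and the counit; its corner entry
is therefore a skew derivation between them, which is `xi_mul`. -/
lemma matHom_entries (v : Fin n → k) (a : E k n) : matHom v a 0 0 = (chi k n).ofConv a ∧
    matHom v a 1 0 = 0 ∧ matHom v a 1 1 = Coalgebra.counit (R := k) a := by
  induction a using E.induction with
  | hk r => 
    refine ⟨?_, ?_, ?_⟩ <;> simp [Algebra.algebraMap_eq_smul_one, chi_one]
  | hc => 
    refine ⟨?_, ?_, ?_⟩ <;> simp [matHom, lift_c, chi_c, counit_c]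
  | hx i => 
    refine ⟨?_, ?_, ?_⟩ <;> simp [matHom, lift_x, chi_x, counit_x]
  | hadd a b ha hb => simp [ha, hb]
  | hmul a b ha hb => simp [Matrix.mul_apply, ha, hb, chi_mul]

/-- The functional with `xi v (x_j) = v_j`, `xi v c = 0`,
`xi v (h m) = chi h ⋅ xi v m + xi v h ⋅ ε m`. -/
def xi (v : Fin n → k) : WithConv (E k n →ₗ[k] k) :=
  toConv (Matrix.entryLinearMap k k 0 1 ∘ₗ (matHom v).toLinearMap)

lemma xi_one (v : Fin n → k) : (xi v).ofConv 1 = 0 := by simp [xi]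
lemma xi_c (v : Fin n → k) : (xi v).ofConv (c k n) = 0 := by simp [xi, matHom, lift_c]
lemma xi_x (v : Fin n → k) (j : Fin n) : (xi v).ofConv (x k n j) = v j := by
  simp [xi, matHom, lift_x]
lemma xi_mul (v : Fin n → k) (a b : E k n) : (xi v).ofConv (a * b) =
    (chi k n).ofConv a * (xi v).ofConv b + (xi v).ofConv a * Coalgebra.counit (R := k) b := by
  have ha := matHom_entries v a
  have hb := matHom_entries v b
  change matHom v (a * b) 0 1 = _
  rw [map_mul, Matrix.mul_apply, Fin.sum_univ_two, ha.1, hb.2.2]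
  rfl

lemma conv_c {A : Type*} [Ring A] [Algebra k A] (F G : WithConv (E k n →ₗ[k] A)) :
    (F * G).ofConv (c k n) = F.ofConv (c k n) * G.ofConv (c k n) := by
  simp [LinearMap.convMul_def, comul_c]
lemma conv_x {A : Type*} [Ring A] [Algebra k A] (F G : WithConv (E k n →ₗ[k] A)) (i : Fin n) :
    (F * G).ofConv (x k n i) = F.ofConv 1 * G.ofConv (x k n i) + F.ofConv (x k n i) * G.ofConv (c k n) := by
  simp [LinearMap.convMul_def, comul_x]
lemma conv_one {A : Type*} [Ring A] [Algebra k A] (F G : WithConv (E k n →ₗ[k] A)) :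
    (F * G).ofConv 1 = F.ofConv 1 * G.ofConv 1 := by
  simp [LinearMap.convMul_def, Algebra.TensorProduct.one_def]

lemma unit_apply (a : E k n) : (1 : WithConv (E k n →ₗ[k] k)).ofConv a = Coalgebra.counit (R := k) a := rfl

lemma pm_chi : pm k (E k n) k (chi k n) = pl k (E k n) k (chi k n) * pr k (E k n) k (chi k n) :=
  form_ext fun h m => by rw [pl_mul_pr_apply, ← chi_mul, pm_apply]

lemma pm_xi (v : Fin n → k) : pm k (E k n) k (xi v) =
    pl k (E k n) k (chi k n) * pr k (E k n) k (xi v) + pl k (E k n) k (xi v) :=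
  form_ext fun h m => by
    rw [WithConv.ofConv_add, LinearMap.add_apply, pl_mul_pr_apply, pm_apply, xi_mul, pl_apply,
      smul_eq_mul, mul_comm (Coalgebra.counit m)]

lemma apply_mul_of_pm {f u v u' v' : WithConv (E k n →ₗ[k] k)}
    (h : pm k (E k n) k f = pl k (E k n) k u * pr k (E k n) k v + pl k (E k n) k u' * pr k (E k n) k v')
    (a b : E k n) : f.ofConv (a * b) = u.ofConv a * v.ofConv b + u'.ofConv a * v'.ofConv b := by
  rw [← pm_apply, h, WithConv.ofConv_add, LinearMap.add_apply, pl_mul_pr_apply, pl_mul_pr_apply]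

lemma conv_mul_apply_mul {f g : WithConv (E k n →ₗ[k] k)}
    {t : WithConv (E k n ⊗[k] E k n →ₗ[k] k)}
    (h : pm k (E k n) k f * pm k (E k n) k g = t) (a b : E k n) :
    (f * g).ofConv (a * b) = t.ofConv (a ⊗ₜ b) := by
  rw [← h, ← map_mul, pm_apply]

/-- A difference of two characters is a skew derivation, so it suffices that `chi * chi` is
multiplicative and agrees with the counit on generators. -/
lemma chi_mul_chi : chi k n * chi k n = 1 := by
  have hm : ∀ a b, (chi k n * chi k n).ofConv (a * b) =
      (chi k n * chi k n).ofConv a * (chi k n * chi k n).ofConv b := fun a b => by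
    rw [← pl_mul_pr_apply]
    refine conv_mul_apply_mul ?_ a b
    rw [pm_chi, map_mul, map_mul, mul_assoc, ← mul_assoc (pr k _ k _), ← pl_pr_commute]
    simp only [mul_assoc]
  refine conv_ext fun a => sub_eq_zero.1 ?_
  refine eq_zero_of_rule (f := fun a => (chi k n * chi k n).ofConv a - (1 : WithConv (E k n →ₗ[k] k)).ofConv a)
    (u := (chi k n * chi k n).ofConv) (w := (1 : WithConv (E k n →ₗ[k] k)).ofConv)
    (fun a b => by simp only [map_add]; ring) (fun a b => by simp only [map_smul, smul_sub])
    ?_ ?_ (fun i => ?_) (fun h m => ?_) a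
  · simp [-LinearMap.convMul_apply, conv_one, chi_one]
  · simp [-LinearMap.convMul_apply, conv_c, chi_c, counit_c]
  · simp [-LinearMap.convMul_apply, conv_x, chi_x, counit_x]
  · simp only [hm, unit_apply, Bialgebra.counit_mul]; ring

/-- Because `chi * chi = 1`, the anticommutator is a skew derivation between the counit and `chi`.
On `x_i` its two terms are `v_i` and `-v_i`, since `chi` is `-1` on `c`. -/
lemma chi_mul_xi (v : Fin n → k) : chi k n * xi v = -(xi v * chi k n) := by
  refine conv_ext fun a => eq_neg_of_add_eq_zero_left ?_
  refine eq_zero_of_rule (f := (chi k n * xi v + xi v * chi k n).ofConv)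
    (u := (1 : WithConv (E k n →ₗ[k] k)).ofConv) (w := (chi k n).ofConv)
    (map_add _) (map_smul _) ?_ ?_ (fun i => ?_) (fun h m => ?_) a
  · simp [-LinearMap.convMul_apply, conv_one, xi_one]
  · simp [-LinearMap.convMul_apply, conv_c, xi_c]
  · simp [-LinearMap.convMul_apply, conv_x, chi_x, xi_x, chi_one, xi_one, chi_c, xi_c]
  · refine apply_mul_of_pm ?_ h m
    have hc := chi_mul_chi (k := k) (n := n)
    simp only [map_add, map_mul, pm_chi, pm_xi, map_one, one_mul]
    have e : pl k (E k n) k (chi k n) * pl k (E k n) k (chi k n) = 1 := by rw [← map_mul, hc, map_one]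
    have c1 := pl_pr_commute (chi k n) (chi k n)
    have c2 := pl_pr_commute (chi k n) (xi v)
    have c3 := pl_pr_commute (xi v) (chi k n)
    generalize pl k (E k n) k (chi k n) = X at *
    generalize pr k (E k n) k (chi k n) = Y at *
    generalize pl k (E k n) k (xi v) = a at *
    generalize pr k (E k n) k (xi v) = b at *
    have e1 : X * Y * (X * b) = Y * b := by
      rw [c1, mul_assoc, ← mul_assoc X, e, one_mul]
    have e2 : X * b * (X * Y) = b * Y := by
      rw [c2, mul_assoc, ← mul_assoc X, e, one_mul]
    have e3 : X * Y * a = X * a * Y := by rw [mul_assoc, ← c3, mul_assoc]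
    rw [mul_add, add_mul, e1, e2, e3]
    simp only [add_mul, mul_assoc]
    abel

/-- The mixed terms in the value on a product cancel, as `chi` anticommutes with `xi`; what remains
is an ordinary derivation with respect to the counit, zero on generators. -/
lemma xi_mul_xi_add (v w : Fin n → k) : xi v * xi w + xi w * xi v = 0 := by
  refine conv_ext fun a => ?_
  refine eq_zero_of_rule (f := (xi v * xi w + xi w * xi v).ofConv)
    (u := (1 : WithConv (E k n →ₗ[k] k)).ofConv) (w := (1 : WithConv (E k n →ₗ[k] k)).ofConv)
    (map_add _) (map_smul _) ?_ ?_ (fun i => ?_) (fun h m => ?_) a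
  · simp [-LinearMap.convMul_apply, conv_one, xi_one]
  · simp [-LinearMap.convMul_apply, conv_c, xi_c]
  · simp [-LinearMap.convMul_apply, conv_x, xi_x, xi_one, xi_c]
  · refine apply_mul_of_pm ?_ h m
    simp only [map_add, map_mul, pm_xi, map_one, one_mul, mul_one]
    have e : pl k (E k n) k (chi k n) * pl k (E k n) k (chi k n) = 1 := by
      rw [← map_mul, chi_mul_chi, map_one]
    have c0 : ∀ u : Fin n → k, pl k (E k n) k (chi k n) * pl k (E k n) k (xi u) =
        -(pl k (E k n) k (xi u) * pl k (E k n) k (chi k n)) := fun u => by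
      rw [← map_mul, chi_mul_xi, map_neg, map_mul]
    have c1 := pl_pr_commute (chi k n) (xi v)
    have c2 := pl_pr_commute (chi k n) (xi w)
    have c3 := pl_pr_commute (xi v) (xi w)
    have c4 := pl_pr_commute (xi w) (xi v)
    have c5 := c0 v
    have c6 := c0 w
    clear c0
    generalize pl k (E k n) k (chi k n) = X at *
    generalize pl k (E k n) k (xi v) = a at *
    generalize pr k (E k n) k (xi v) = b at *
    generalize pl k (E k n) k (xi w) = a' at *
    generalize pr k (E k n) k (xi w) = b' at *
    have hn : ∀ p q : WithConv (E k n ⊗[k] E k n →ₗ[k] k), -p * q = -(p * q) := fun p q => neg_mul p q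
    have e1 : X * b * (X * b') = b * b' := by rw [c1, mul_assoc, ← mul_assoc X, e, one_mul]
    have e2 : X * b' * (X * b) = b' * b := by rw [c2, mul_assoc, ← mul_assoc X, e, one_mul]
    have e3 : X * b * a' = -(a' * (X * b)) := by
      rw [mul_assoc, ← c4, ← mul_assoc, c6, hn, mul_assoc]
    have e4 : X * b' * a = -(a * (X * b')) := by
      rw [mul_assoc, ← c3, ← mul_assoc, c5, hn, mul_assoc]
    simp only [mul_add, add_mul, e1, e2, e3, e4]
    abel

lemma xi_mul_self (h2 : (2 : k) ≠ 0) (v : Fin n → k) : xi v * xi v = 0 := by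
  have h := xi_mul_xi_add v v
  rw [← two_smul k] at h
  exact (smul_eq_zero.1 h).resolve_left h2

/-- The algebra homomorphism `E(n) → E(n)^*` attached to a matrix. -/
def dualHom (h2 : (2 : k) ≠ 0) (A : Matrix (Fin n) (Fin n) k) : E k n →ₐ[k] WithConv (E k n →ₗ[k] k) :=
  lift (chi k n) (fun i => xi (A i)) chi_mul_chi (fun _ => xi_mul_self h2 _) (fun _ => chi_mul_xi _)
    (fun _ _ => eq_neg_of_add_eq_zero_left (xi_mul_xi_add _ _))

lemma dualHom_c (h2 : (2 : k) ≠ 0) (A : Matrix (Fin n) (Fin n) k) : dualHom h2 A (c k n) = chi k n :=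
  lift_c ..
lemma dualHom_x (h2 : (2 : k) ≠ 0) (A : Matrix (Fin n) (Fin n) k) (i : Fin n) :
    dualHom h2 A (x k n i) = xi (A i) := lift_x ..

/-- On generators this says that the coproducts of `chi` and `xi`, dual to multiplication, mirror
those of `c` and `x_i` with the legs exchanged. -/
lemma splitHom_dualHom (h2 : (2 : k) ≠ 0) (A : Matrix (Fin n) (Fin n) k) :
    (pm k (E k n) k).comp (dualHom h2 A) = splitHom (dualHom h2 A) := by
  refine hom_ext ?_ (fun i => ?_)
  · refine Eq.trans ?_ (lift_comul_tmul _ _ _ (comul_c k n)).symm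
    simp only [AlgHom.comp_apply, dualHom_c, pm_chi, pl_pr_commute]
  · refine Eq.trans ?_ (lift_comul_add _ _ _ (comul_x k n i)).symm
    simp only [AlgHom.comp_apply, dualHom_c, dualHom_x, pm_xi, pl_pr_commute, map_one, one_mul]
    rw [add_comm]

/-- `h ↦ ∑ f h₁ ⋅ h₂`. -/
abbrev hitL (f : WithConv (E k n →ₗ[k] k)) : WithConv (E k n →ₗ[k] E k n) :=
  embAlg k (E k n) (E k n) f * toConv LinearMap.id
/-- `h ↦ ∑ h₁ ⋅ f h₂`. -/
abbrev hitR (f : WithConv (E k n →ₗ[k] k)) : WithConv (E k n →ₗ[k] E k n) :=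
  toConv LinearMap.id * embAlg k (E k n) (E k n) f

lemma pm_chi' : pm k (E k n) k (chi k n) = pl k (E k n) k (chi k n) * pr k (E k n) k (chi k n) +
    pl k (E k n) k 0 * pr k (E k n) k 0 := by rw [pm_chi, map_zero, zero_mul, add_zero]
lemma pm_xi' (v : Fin n → k) : pm k (E k n) k (xi v) = pl k (E k n) k (chi k n) * pr k (E k n) k (xi v) +
    pl k (E k n) k (xi v) * pr k (E k n) k 1 := by rw [pm_xi, map_one, mul_one]

lemma hitL_chi_mul (h m : E k n) : (hitL (chi k n)).ofConv (h * m) =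
    (hitL (chi k n)).ofConv h * (hitL (chi k n)).ofConv m := by
  rw [emb_mul_id_apply_mul pm_chi']; simp
lemma hitR_chi_mul (h m : E k n) : (hitR (chi k n)).ofConv (h * m) =
    (hitR (chi k n)).ofConv h * (hitR (chi k n)).ofConv m := by
  rw [id_mul_emb_apply_mul pm_chi']; simp
lemma hitL_xi_mul (v : Fin n → k) (h m : E k n) : (hitL (xi v)).ofConv (h * m) =
    (hitL (chi k n)).ofConv h * (hitL (xi v)).ofConv m + (hitL (xi v)).ofConv h * m := by
  rw [emb_mul_id_apply_mul (pm_xi' v)]; simp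
lemma hitR_xi_mul (v : Fin n → k) (h m : E k n) : (hitR (xi v)).ofConv (h * m) =
    (hitR (chi k n)).ofConv h * (hitR (xi v)).ofConv m + (hitR (xi v)).ofConv h * m := by
  rw [id_mul_emb_apply_mul (pm_xi' v)]; simp

lemma hitL_chi_one : (hitL (chi k n)).ofConv 1 = 1 := by simp [-LinearMap.convMul_apply, hitL, conv_one, embAlg_apply, chi_one]
lemma hitR_chi_one : (hitR (chi k n)).ofConv 1 = 1 := by simp [-LinearMap.convMul_apply, hitR, conv_one, embAlg_apply, chi_one]
lemma hitL_chi_c : (hitL (chi k n)).ofConv (c k n) = -c k n := by simp [-LinearMap.convMul_apply, hitL, conv_c, embAlg_apply, chi_c]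
lemma hitR_chi_c : (hitR (chi k n)).ofConv (c k n) = -c k n := by simp [-LinearMap.convMul_apply, hitR, conv_c, embAlg_apply, chi_c]
lemma hitL_chi_x (i : Fin n) : (hitL (chi k n)).ofConv (x k n i) = x k n i := by
  simp [-LinearMap.convMul_apply, hitL, conv_x, embAlg_apply, chi_x, chi_one]
lemma hitR_chi_x (i : Fin n) : (hitR (chi k n)).ofConv (x k n i) = -x k n i := by
  simp [-LinearMap.convMul_apply, hitR, conv_x, embAlg_apply, chi_x, chi_c]
lemma hitL_xi_one (v : Fin n → k) : (hitL (xi v)).ofConv 1 = 0 := by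
  simp [-LinearMap.convMul_apply, hitL, conv_one, embAlg_apply, xi_one]
lemma hitR_xi_one (v : Fin n → k) : (hitR (xi v)).ofConv 1 = 0 := by
  simp [-LinearMap.convMul_apply, hitR, conv_one, embAlg_apply, xi_one]
lemma hitL_xi_c (v : Fin n → k) : (hitL (xi v)).ofConv (c k n) = 0 := by
  simp [-LinearMap.convMul_apply, hitL, conv_c, embAlg_apply, xi_c]
lemma hitR_xi_c (v : Fin n → k) : (hitR (xi v)).ofConv (c k n) = 0 := by
  simp [-LinearMap.convMul_apply, hitR, conv_c, embAlg_apply, xi_c]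
lemma hitL_xi_x (v : Fin n → k) (i : Fin n) : (hitL (xi v)).ofConv (x k n i) = v i • c k n := by
  simp [-LinearMap.convMul_apply, hitL, conv_x, embAlg_apply, xi_x, xi_one, Algebra.smul_def]
lemma hitR_xi_x (v : Fin n → k) (i : Fin n) : (hitR (xi v)).ofConv (x k n i) = v i • 1 := by
  simp [-LinearMap.convMul_apply, hitR, conv_x, embAlg_apply, xi_x, xi_c, Algebra.smul_def]

/-- The third axiom for `g = c`, as an identity in the second argument. -/
lemma c_mul_hitL_chi (h : E k n) : c k n * (hitL (chi k n)).ofConv h = (hitR (chi k n)).ofConv h * c k n := by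
  refine sub_eq_zero.1 ?_
  refine eq_zero_of_rule (f := fun h => c k n * (hitL (chi k n)).ofConv h - (hitR (chi k n)).ofConv h * c k n)
    (u := (hitR (chi k n)).ofConv) (w := (hitL (chi k n)).ofConv)
    (fun a b => by simp only [map_add, mul_add, add_mul]; abel)
    (fun a b => by simp only [map_smul, smul_sub, mul_smul_comm, smul_mul_assoc])
    ?_ ?_ (fun i => ?_) (fun h m => ?_) h
  · simp only [hitL_chi_one, hitR_chi_one]; simp
  · simp only [hitL_chi_c, hitR_chi_c]; simp
  · simp only [hitL_chi_x, hitR_chi_x]; simp [c_x]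
  · simp only [hitL_chi_mul, hitR_chi_mul, mul_sub, sub_mul, mul_assoc]; abel

/-- The third axiom for `g = x_i`. The case `g = c` is what makes the difference of the two sides a
skew derivation in `h`. -/
lemma x_mul_add_c_mul_hitL_xi (v : Fin n → k) (i : Fin n) (h : E k n) :
    x k n i * h + c k n * (hitL (xi v)).ofConv h =
      (hitR (xi v)).ofConv h + (hitR (chi k n)).ofConv h * x k n i := by
  refine sub_eq_zero.1 ?_
  refine eq_zero_of_rule (f := fun h => x k n i * h + c k n * (hitL (xi v)).ofConv h -
      ((hitR (xi v)).ofConv h + (hitR (chi k n)).ofConv h * x k n i))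
    (u := (hitR (chi k n)).ofConv) (w := id)
    (fun a b => by simp only [map_add, mul_add, add_mul]; abel)
    (fun a b => by simp only [map_smul, smul_sub, smul_add, mul_smul_comm, smul_mul_assoc])
    ?_ ?_ (fun j => ?_) (fun h m => ?_) h
  · simp only [hitL_xi_one, hitR_xi_one, hitR_chi_one]; simp
  · simp only [hitL_xi_c, hitR_xi_c, hitR_chi_c]; simp [c_x]
  · simp only [hitL_xi_x, hitR_xi_x, hitR_chi_x]; simp [c_sq, x_x i j]; abel
  · have e := c_mul_hitL_chi (k := k) (n := n) h
    simp only [hitL_xi_mul, hitR_xi_mul, hitR_chi_mul, id, mul_sub, sub_mul, mul_add, add_mul]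
    rw [← mul_assoc (c k n) ((hitL (chi k n)).ofConv h), e]
    simp only [mul_assoc]; abel

lemma leftHom_dualHom (h2 : (2 : k) ≠ 0) (A : Matrix (Fin n) (Fin n) k) (g : E k n) :
    leftHom (dualHom h2 A) g * toConv LinearMap.id = toConv LinearMap.id * rightHom (dualHom h2 A) g := by
  induction g using E.induction with
  | hk r =>
    rw [AlgHom.commutes, AlgHom.commutes, Algebra.commutes]
  | hc =>
    have e1 : leftHom (dualHom h2 A) (c k n) = _ := lift_comul_tmul _ _ _ (comul_c k n)
    have e2 : rightHom (dualHom h2 A) (c k n) = _ := lift_comul_tmul _ _ _ (comul_c k n)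
    simp only [AlgHom.comp_apply, dualHom_c] at e1 e2
    rw [e1, e2, (embAlg_commute_cst (chi k n) (c k n)).eq, mul_assoc (cst k (E k n) _),
      ← (embAlg_commute_cst (chi k n) (c k n)).eq, ← mul_assoc (toConv LinearMap.id)]
    refine conv_ext fun h => ?_
    rw [mul_cst_apply, ← c_mul_hitL_chi, cst_mul_apply]
  | hx i =>
    have e1 : leftHom (dualHom h2 A) (x k n i) = _ := lift_comul_add _ _ _ (comul_x k n i)
    have e2 : rightHom (dualHom h2 A) (x k n i) = _ := lift_comul_add _ _ _ (comul_x k n i)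
    simp only [AlgHom.comp_apply, dualHom_c, dualHom_x, map_one, one_mul] at e1 e2
    rw [e1, e2, (embAlg_commute_cst (xi (A i)) (c k n)).eq, add_mul, mul_add, mul_assoc (cst k (E k n) _),
      ← (embAlg_commute_cst (chi k n) (x k n i)).eq, ← mul_assoc (toConv LinearMap.id)]
    refine conv_ext fun h => ?_
    simp only [WithConv.ofConv_add, LinearMap.add_apply, cst_mul_apply, mul_cst_apply]
    exact x_mul_add_c_mul_hitL_xi (A i) i h
  | hadd a b ha hb => simp only [map_add, add_mul, mul_add, ha, hb]
  | hmul a b ha hb => rw [map_mul, map_mul, mul_assoc, hb, ← mul_assoc, ha, mul_assoc]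

/-- The coquasi-triangular structure attached to a matrix. -/
def cqt (h2 : (2 : k) ≠ 0) (A : Matrix (Fin n) (Fin n) k) : CQT k (E k n) :=
  ⟨formOf (dualHom h2 A), isCQT_formOf (splitHom_dualHom h2 A) (leftHom_dualHom h2 A)⟩

/-! ### Values on monomials as minors of the matrix. -/

lemma conv_apply_eq_hitL (f F : WithConv (E k n →ₗ[k] k)) (m : E k n) :
    (f * F).ofConv m = F.ofConv ((hitL f).ofConv m) := by
  let b := Coalgebra.Repr.arbitrary k m
  rw [b.convMul_apply, b.convMul_apply, map_sum]
  refine Finset.sum_congr rfl fun i _ => ?_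
  change _ = F.ofConv (algebraMap k (E k n) (f.ofConv (b.left i)) * b.right i)
  rw [← Algebra.smul_def, map_smul, smul_eq_mul]

/-- The product `x_{f 0} ⋯ x_{f (t - 1)}`. -/
def xs (k : Type*) [Field k] {n t : ℕ} (f : Fin t → Fin n) : E k n :=
  (List.ofFn fun i => x k n (f i)).prod

lemma xs_zero (f : Fin 0 → Fin n) : xs k f = 1 := rfl
lemma xs_succ {t : ℕ} (f : Fin (t + 1) → Fin n) : xs k f = x k n (f 0) * xs k (fun i => f i.succ) := by
  rw [xs, List.ofFn_succ, List.prod_cons]; rfl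

lemma hitL_chi_c_pow (b : ℕ) : (hitL (chi k n)).ofConv (c k n ^ b) = (-1) ^ b * c k n ^ b := by
  induction b with
  | zero => simp only [pow_zero, hitL_chi_one, one_mul]
  | succ b ih => rw [pow_succ, hitL_chi_mul, ih, hitL_chi_c, pow_succ]; simp [mul_assoc]

lemma hitL_xi_c_pow (v : Fin n → k) (b : ℕ) : (hitL (xi v)).ofConv (c k n ^ b) = 0 := by
  induction b with
  | zero => simp only [pow_zero, hitL_xi_one]
  | succ b ih => rw [pow_succ, hitL_xi_mul, ih, hitL_xi_c, mul_zero, zero_mul, add_zero]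

lemma hitL_chi_xs {t : ℕ} (f : Fin t → Fin n) : (hitL (chi k n)).ofConv (xs k f) = xs k f := by
  induction t with
  | zero => exact hitL_chi_one
  | succ t ih => rw [xs_succ, hitL_chi_mul, hitL_chi_x, ih]

/-- `xi` acts as a contraction: it replaces one factor by a scalar times `c`, and moving this `c` to
the front past the `j` earlier factors gives the sign. -/
lemma hitL_xi_xs (v : Fin n → k) {t : ℕ} (f : Fin (t + 1) → Fin n) :
    (hitL (xi v)).ofConv (xs k f) =
      ∑ j : Fin (t + 1), ((-1) ^ (j : ℕ) * v (f j)) • (c k n * xs k (fun i => f (j.succAbove i))) := by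
  induction t with
  | zero =>
    rw [xs_succ, xs_zero, mul_one, hitL_xi_x]
    simp [xs_zero]
  | succ t ih =>
    rw [xs_succ, hitL_xi_mul, hitL_chi_x, hitL_xi_x, ih, Fin.sum_univ_succ (n := t + 1), Finset.mul_sum, add_comm]
    congr 1
    · simp
    · refine Finset.sum_congr rfl fun j _ => ?_
      rw [mul_smul_comm, ← mul_assoc, x_c, xs_succ (fun i => f (j.succ.succAbove i))]
      simp [pow_succ, mul_assoc]

lemma hitL_xi_c_pow_mul (v : Fin n → k) (b : ℕ) (m : E k n) :
    (hitL (xi v)).ofConv (c k n ^ b * m) = (-1 : k) ^ b • (c k n ^ b * (hitL (xi v)).ofConv m) := by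
  rw [hitL_xi_mul, hitL_xi_c_pow, zero_mul, add_zero, hitL_chi_c_pow]
  rcases Nat.even_or_odd b with h | h <;> simp [h.neg_one_pow]

lemma counit_c_pow (b : ℕ) : Coalgebra.counit (R := k) (c k n ^ b) = 1 := by
  rw [Bialgebra.counit_pow, counit_c, one_pow]

section values
variable (h2 : (2 : k) ≠ 0) (A : Matrix (Fin n) (Fin n) k)

/-- The recursion behind the evaluation of `r_A`: a factor `x_i` on the left contracts the argument
on the right. -/
lemma dualHom_x_mul_apply (i : Fin n) (g m : E k n) : (dualHom h2 A (x k n i * g)).ofConv m =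
    (dualHom h2 A g).ofConv ((hitL (xi (A i))).ofConv m) := by
  rw [map_mul, dualHom_x, conv_apply_eq_hitL]

/-- Each `xi` strips one factor. Unequal lengths end either with the counit of a nonempty product of
`x`'s or with `xi` of a power of `c`, both zero. -/
lemma dualHom_xs_apply_eq_zero {s t : ℕ} (hst : s ≠ t) (p : Fin s → Fin n) (f : Fin t → Fin n) (b : ℕ) :
    (dualHom h2 A (xs k p)).ofConv (c k n ^ b * xs k f) = 0 := by
  induction s generalizing t b with
  | zero =>
    obtain ⟨t, rfl⟩ := Nat.exists_eq_succ_of_ne_zero hst.symm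
    rw [xs_zero, map_one, unit_apply, Bialgebra.counit_mul, xs_succ, Bialgebra.counit_mul, counit_x]
    simp
  | succ s ih =>
    rw [xs_succ, dualHom_x_mul_apply, hitL_xi_c_pow_mul]
    cases t with
    | zero => rw [xs_zero, hitL_xi_one]; simp
    | succ t =>
      rw [hitL_xi_xs, Finset.mul_sum]
      simp only [map_smul, map_sum, mul_smul_comm, ← mul_assoc, ← pow_succ]
      rw [Finset.sum_eq_zero, smul_zero]
      intro j _
      rw [ih (by omega), smul_zero]

/-- The contraction is Laplace expansion along the first row. The power of `c` grows by one per
step, so the signs have exponents `b, b + 1, …, b + s - 1`, with sum `b s + s (s - 1) / 2`. -/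
lemma dualHom_xs_apply {s : ℕ} (p f : Fin s → Fin n) (b : ℕ) :
    (dualHom h2 A (xs k p)).ofConv (c k n ^ b * xs k f) =
      (-1) ^ (b * s) * (-1) ^ (s * (s - 1) / 2) * (A.submatrix p f).det := by
  induction s generalizing b with
  | zero =>
    rw [xs_zero, xs_zero, map_one, unit_apply, mul_one, counit_c_pow]
    simp
  | succ s ih =>
    rw [xs_succ, dualHom_x_mul_apply, hitL_xi_c_pow_mul, hitL_xi_xs, Finset.mul_sum, Matrix.det_succ_row_zero]
    simp only [map_smul, map_sum, mul_smul_comm, ← mul_assoc, ← pow_succ, ih, smul_eq_mul, Finset.mul_sum,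
      Nat.triangle_succ]
    refine Finset.sum_congr rfl fun j _ => ?_
    have e : (A.submatrix p f).submatrix Fin.succ j.succAbove =
      A.submatrix (fun i => p i.succ) (fun i => f (j.succAbove i)) := rfl
    rw [e, Matrix.submatrix_apply]
    ring
end values

lemma sort_map_prod {s : ℕ} (P : Finset (Fin n)) (h : P.card = s) :
    ((P.sort (· ≤ ·)).map (x k n)).prod = xs k (P.orderEmbOfFin h) := by
  rw [xs]
  congr 1
  refine List.ext_getElem (by simp [h]) fun i h1 h2 => ?_
  simp [Finset.orderEmbOfFin_apply]

lemma dualHom_c_pow_mul_apply (h2 : (2 : k) ≠ 0) (A : Matrix (Fin n) (Fin n) k) (a b : ℕ)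
    (g : E k n) {t : ℕ} (f : Fin t → Fin n) :
    (dualHom h2 A (c k n ^ a * g)).ofConv (c k n ^ b * xs k f) =
      (-1) ^ (a * b) * (dualHom h2 A g).ofConv (c k n ^ b * xs k f) := by
  induction a with
  | zero => simp
  | succ a ih =>
    have e : (hitL (chi k n)).ofConv (c k n ^ b * xs k f) = (-1 : k) ^ b • (c k n ^ b * xs k f) := by
      rw [hitL_chi_mul, hitL_chi_xs, hitL_chi_c_pow]
      rcases Nat.even_or_odd b with h | h <;> simp [h.neg_one_pow]
    rw [pow_succ', mul_assoc, map_mul (dualHom h2 A), dualHom_c, conv_apply_eq_hitL, e, map_smul, ih, smul_eq_mul]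
    ring

lemma isStructureOf_cqt (h2 : (2 : k) ≠ 0) (A : Matrix (Fin n) (Fin n) k) : IsStructureOf A (cqt h2 A) := by
  intro a P b F
  change (dualHom h2 A (monomial k n a P)).ofConv (monomial k n b F) = _
  rw [monomial, monomial, sort_map_prod P rfl, structureValue]
  split_ifs with h
  -- The transpose is needed because `Matrix.det_apply'` permutes row indices, whereas the formula
  -- for `r_A` permutes columns.
  · rw [sort_map_prod F h, dualHom_c_pow_mul_apply, dualHom_xs_apply, ← Matrix.det_transpose,
      Matrix.det_apply']
    simp only [Matrix.transpose_apply, Matrix.submatrix_apply]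
    ring
  · rw [sort_map_prod F rfl, dualHom_c_pow_mul_apply, dualHom_xs_apply_eq_zero h2 A (Ne.symm h), mul_zero]
end E

/-! ### Convolution products evaluated on elements with short coproducts. -/

section General
variable {k : Type*} {H : Type*} [Field k] [Ring H] [HopfAlgebra k H]

/-- `g ↦ r (g ⊗ -)` for a coquasi-triangular structure `r`, as an algebra homomorphism. -/
def evHom {r : (Form k H)ˣ} (hr : IsCQT r) : H →ₐ[k] WithConv (H →ₗ[k] k) :=
  AlgHom.ofLinearMap (ev r.1) hr.ev_one hr.ev_mul

lemma evHom_apply {r : (Form k H)ˣ} (hr : IsCQT r) (g h : H) :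
    (evHom hr g).ofConv h = r.1.ofConv (g ⊗ₜ h) := rfl

lemma formOf_evHom {r : (Form k H)ˣ} (hr : IsCQT r) : formOf (evHom hr) = r :=
  Units.ext (form_ext fun _ _ => rfl)

lemma leftHom_evHom {r : (Form k H)ˣ} (hr : IsCQT r) (g : H) :
    leftHom (evHom hr) g * toConv LinearMap.id = toConv LinearMap.id * rightHom (evHom hr) g :=
  conv_ext fun h => by
    rw [← emb_formOf_mul_mulForm_apply, ← mulOpForm_mul_emb_formOf_apply, formOf_evHom, hr.comm]

section conv
variable {A : Type*} [Ring A] [Algebra k A] (F G : WithConv (H ⊗[k] H →ₗ[k] A))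
  {g h a b a' b' p q p' q' : H}

lemma conv_tmul_one_one (hg : Coalgebra.comul (R := k) g = a ⊗ₜ b)
    (hh : Coalgebra.comul (R := k) h = p ⊗ₜ q) :
    (F * G).ofConv (g ⊗ₜ h) = F.ofConv (a ⊗ₜ p) * G.ofConv (b ⊗ₜ q) := by
  simp [LinearMap.convMul_def, TensorProduct.comul_tmul, hg, hh]

lemma conv_tmul_one_two (hg : Coalgebra.comul (R := k) g = a ⊗ₜ b)
    (hh : Coalgebra.comul (R := k) h = p ⊗ₜ q + p' ⊗ₜ q') :
    (F * G).ofConv (g ⊗ₜ h) = F.ofConv (a ⊗ₜ p) * G.ofConv (b ⊗ₜ q) +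
      F.ofConv (a ⊗ₜ p') * G.ofConv (b ⊗ₜ q') := by
  simp [LinearMap.convMul_def, TensorProduct.comul_tmul, hg, hh, TensorProduct.tmul_add]

lemma conv_tmul_two_one (hg : Coalgebra.comul (R := k) g = a ⊗ₜ b + a' ⊗ₜ b')
    (hh : Coalgebra.comul (R := k) h = p ⊗ₜ q) :
    (F * G).ofConv (g ⊗ₜ h) = F.ofConv (a ⊗ₜ p) * G.ofConv (b ⊗ₜ q) +
      F.ofConv (a' ⊗ₜ p) * G.ofConv (b' ⊗ₜ q) := by
  simp [LinearMap.convMul_def, TensorProduct.comul_tmul, hg, hh, TensorProduct.add_tmul]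

lemma conv_tmul_two_two (hg : Coalgebra.comul (R := k) g = a ⊗ₜ b + a' ⊗ₜ b')
    (hh : Coalgebra.comul (R := k) h = p ⊗ₜ q + p' ⊗ₜ q') :
    (F * G).ofConv (g ⊗ₜ h) = F.ofConv (a ⊗ₜ p) * G.ofConv (b ⊗ₜ q) +
      F.ofConv (a ⊗ₜ p') * G.ofConv (b ⊗ₜ q') + F.ofConv (a' ⊗ₜ p) * G.ofConv (b' ⊗ₜ q) +
      F.ofConv (a' ⊗ₜ p') * G.ofConv (b' ⊗ₜ q') := by
  simp [LinearMap.convMul_def, TensorProduct.comul_tmul, hg, hh, TensorProduct.add_tmul,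
    TensorProduct.tmul_add]
  abel
end conv

lemma comul_one' : Coalgebra.comul (R := k) (1 : H) = 1 ⊗ₜ 1 := by
  rw [Bialgebra.comul_one, Algebra.TensorProduct.one_def]
end General

/-! ### Every coquasi-triangular structure on `E(n)` comes from a matrix. -/

namespace E
variable {k : Type*} [Field k] {n : ℕ}

lemma eq_zero_of_eq_neg_self (h2 : (2 : k) ≠ 0) {a : k} (h : a = -a) : a = 0 := by
  have : (2 : k) * a = 0 := by linear_combination h
  exact (mul_eq_zero.1 this).resolve_left h2

lemma functional_ext {f g : WithConv (E k n →ₗ[k] k)} {u w : E k n → k} (h1 : f.ofConv 1 = g.ofConv 1)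
    (hc : f.ofConv (c k n) = g.ofConv (c k n)) (hx : ∀ i, f.ofConv (x k n i) = g.ofConv (x k n i))
    (hmul : ∀ h m, f.ofConv (h * m) - g.ofConv (h * m) =
      u h * (f.ofConv m - g.ofConv m) + (f.ofConv h - g.ofConv h) * w m) : f = g := by
  refine conv_ext fun a => sub_eq_zero.1 ?_
  exact eq_zero_of_rule (f := fun a => f.ofConv a - g.ofConv a)
    (fun a b => by simp only [map_add]; ring) (fun a b => by simp only [map_smul, smul_sub])
    (sub_eq_zero.2 h1) (sub_eq_zero.2 hc) (fun i => sub_eq_zero.2 (hx i)) hmul a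

lemma eq_chi {f : WithConv (E k n →ₗ[k] k)} (h1 : f.ofConv 1 = 1)
    (hc : f.ofConv (c k n) = -1) (hx : ∀ i, f.ofConv (x k n i) = 0)
    (hmul : ∀ h m, f.ofConv (h * m) = f.ofConv h * f.ofConv m) : f = chi k n :=
  functional_ext (u := f.ofConv) (w := (chi k n).ofConv) (by rw [h1, chi_one]) (by rw [hc, chi_c])
    (fun i => by rw [hx, chi_x]) fun h m => by rw [hmul, chi_mul]; ring

lemma eq_xi {f : WithConv (E k n →ₗ[k] k)} (hc : f.ofConv (c k n) = 0)
    (hmul : ∀ h m, f.ofConv (h * m) = (chi k n).ofConv h * f.ofConv m +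
      f.ofConv h * Coalgebra.counit (R := k) m) : f = xi fun i => f.ofConv (x k n i) := by
  refine functional_ext (u := (chi k n).ofConv) (w := Coalgebra.counit (R := k)) ?_ (by rw [hc, xi_c])
    (fun i => by rw [xi_x]) fun h m => by rw [hmul, xi_mul]; ring
  have := hmul 1 1
  rw [mul_one, chi_one, Bialgebra.counit_one, one_mul, mul_one] at this
  rw [xi_one]
  linear_combination -this

/-- Multiplying `xi` by `chi` exchanges the roles of `chi` and the counit in its product rule,
because `chi * chi = 1`. -/
lemma eq_chi_mul_xi {f : WithConv (E k n →ₗ[k] k)} (hc : f.ofConv (c k n) = 0)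
    (hmul : ∀ h m, f.ofConv (h * m) = Coalgebra.counit (R := k) h * f.ofConv m +
      f.ofConv h * (chi k n).ofConv m) : f = chi k n * xi fun i => f.ofConv (x k n i) := by
  have hm : ∀ (v : Fin n → k) h m, (chi k n * xi v).ofConv (h * m) =
      Coalgebra.counit (R := k) h * (chi k n * xi v).ofConv m +
        (chi k n * xi v).ofConv h * (chi k n).ofConv m := fun v h m => by
    refine apply_mul_of_pm (u := 1) ?_ h m
    rw [map_mul, pm_chi, pm_xi, mul_add, mul_assoc, mul_assoc (pl k _ k _) (pr k _ k _),
      ← mul_assoc (pr k _ k _) (pl k _ k _), ← pl_pr_commute, ← pl_pr_commute]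
    simp only [← mul_assoc, ← map_mul, chi_mul_chi]
    simp only [mul_assoc, ← map_mul]
  refine functional_ext (u := Coalgebra.counit (R := k)) (w := (chi k n).ofConv) ?_ ?_
    (fun i => ?_) fun h m => by rw [hmul, hm]; ring
  · have := hmul 1 1
    rw [mul_one, chi_one, Bialgebra.counit_one, one_mul, mul_one] at this
    rw [conv_one, xi_one]
    linear_combination -this
  · rw [conv_c, hc, xi_c, mul_zero]
  · rw [conv_x, xi_x, xi_c, chi_one]; ring

lemma xi_c_mul_x (v : Fin n → k) (i : Fin n) : (xi v).ofConv (c k n * x k n i) = -v i := by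
  rw [xi_mul, chi_c, xi_x, xi_c]; ring

lemma xi_x_mul_c (v : Fin n → k) (i : Fin n) : (xi v).ofConv (x k n i * c k n) = v i := by
  rw [xi_mul, chi_x, xi_x, counit_c]; ring

section uniqueness
variable (h2 : (2 : k) ≠ 0) {r : (Form k (E k n))ˣ} (hr : IsCQT r)
include h2 hr

/-- With `s = r (c ⊗ x_i)` and `t = r (c ⊗ c)`, the third axiom at `(c, x_i)` reads `c x_i + s = s c
+ t x_i c`. Applying `chi` gives `s = -s`; applying `xi` gives `t = -1`. -/
lemma evHom_c_aux (i : Fin n) : (evHom hr (c k n)).ofConv (x k n i) = 0 ∧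
    (evHom hr (c k n)).ofConv (c k n) = -1 := by
  have h := leftHom_evHom hr (c k n)
  have e1 : leftHom (evHom hr) (c k n) = _ := lift_comul_tmul _ _ _ (comul_c k n)
  have e2 : rightHom (evHom hr) (c k n) = _ := lift_comul_tmul _ _ _ (comul_c k n)
  rw [e1, e2, AlgHom.comp_apply, (embAlg_commute_cst _ (c k n)).eq, mul_assoc (cst k (E k n) _),
    ← (embAlg_commute_cst _ (c k n)).eq, ← mul_assoc (toConv LinearMap.id)] at h
  have h := congrArg (fun z => z.ofConv (x k n i)) h
  simp only [cst_mul_apply, mul_cst_apply] at h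
  have hf : (evHom hr (c k n)).ofConv 1 = 1 := by
    have := congrArg (fun z => z.ofConv (c k n)) hr.coev_one
    exact this.trans (counit_c k n)
  rw [conv_x, conv_x] at h
  simp only [embAlg_apply, hf, map_one, one_mul, LinearMap.id_apply] at h
  simp only [mul_add, add_mul, mul_smul_comm, smul_mul_assoc,
    c_sq, one_mul, mul_one, Algebra.algebraMap_eq_smul_one] at h
  generalize (evHom hr (c k n)).ofConv (x k n i) = s at h ⊢
  generalize (evHom hr (c k n)).ofConv (c k n) = t at h ⊢
  constructor
  · have h' := congrArg (chi k n).ofConv h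
    simp only [map_add, map_smul, chi_mul, chi_c, chi_x, chi_one, smul_eq_mul] at h'
    exact eq_zero_of_eq_neg_self h2 (by linear_combination h')
  · have h' := congrArg (xi (n := n) fun _ => 1).ofConv h
    simp only [map_add, map_smul, xi_c_mul_x, xi_x_mul_c, xi_c, xi_one, smul_eq_mul] at h'
    linear_combination -h'

/-- As `c` is group-like, `r (c ⊗ -)` is a character. At least one `x_i` is needed to force `r (c ⊗
c) = -1`: for `n = 0` the value `1` is also possible. -/
lemma evHom_c (hn : 1 ≤ n) : evHom hr (c k n) = chi k n := by
  refine eq_chi ?_ (evHom_c_aux h2 hr ⟨0, hn⟩).2 (fun i => (evHom_c_aux h2 hr i).1) fun h m => ?_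
  · have := congrArg (fun z => z.ofConv (c k n)) hr.coev_one
    exact this.trans (counit_c k n)
  · have := congrArg (fun z => z.ofConv (c k n)) (hr.coev_mul h m)
    simp only [conv_c] at this
    exact this.trans (mul_comm _ _)

/-- In the third axiom at `(x_i, c)` the unknown value multiplies `1` on one side and `c` on the
other; `chi` tells these apart up to sign. -/
lemma evHom_x_c (hn : 1 ≤ n) (i : Fin n) : (evHom hr (x k n i)).ofConv (c k n) = 0 := by
  have h := leftHom_evHom hr (x k n i)
  have e1 : leftHom (evHom hr) (x k n i) = _ := lift_comul_add _ _ _ (comul_x k n i)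
  have e2 : rightHom (evHom hr) (x k n i) = _ := lift_comul_add _ _ _ (comul_x k n i)
  simp only [AlgHom.comp_apply, evHom_c h2 hr hn, map_one, one_mul] at e1 e2
  rw [e1, e2, (embAlg_commute_cst _ (c k n)).eq, add_mul, mul_add, mul_assoc (cst k (E k n) _),
      ← (embAlg_commute_cst (chi k n) (x k n i)).eq, ← mul_assoc (toConv LinearMap.id)] at h
  have h := congrArg (fun z => z.ofConv (c k n)) h
  simp only [WithConv.ofConv_add, LinearMap.add_apply, cst_mul_apply, mul_cst_apply] at h
  rw [conv_c, conv_c, conv_c] at h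
  simp only [embAlg_apply, LinearMap.id_apply, chi_c, ← Algebra.smul_def, ← Algebra.commutes,
    mul_smul_comm, smul_mul_assoc, c_sq] at h
  have h' := congrArg (chi k n).ofConv h
  simp only [map_add, map_smul, chi_mul, chi_c, chi_x, chi_one, smul_eq_mul] at h'
  exact eq_zero_of_eq_neg_self h2 (by linear_combination h')

/-- Evaluating the second axiom at `x_i`, with `r (1 ⊗ -)` the counit and `r (c ⊗ -) = chi`, gives
precisely the product rule of `xi`. -/
lemma evHom_x (hn : 1 ≤ n) (i : Fin n) :
    evHom hr (x k n i) = xi fun j => r.1.ofConv (x k n i ⊗ₜ x k n j) := by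
  refine eq_xi (evHom_x_c h2 hr hn i) fun h m => ?_
  have := congrArg (fun z => z.ofConv (x k n i)) (hr.coev_mul h m)
  simp only [conv_x] at this
  have e1 : (coev r.1 m).ofConv 1 = Coalgebra.counit (R := k) m :=
    congrArg (fun z => z.ofConv m) hr.ev_one
  have e2 : (coev r.1 h).ofConv (c k n) = (chi k n).ofConv h :=
    congrArg (fun z => z.ofConv h) (evHom_c h2 hr hn)
  rw [e1, e2] at this
  refine this.trans ?_
  simp only [coev_apply, evHom_apply]
  ring

lemma evHom_eq_dualHom (hn : 1 ≤ n) :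
    evHom hr = dualHom h2 (Matrix.of fun i j => r.1.ofConv (x k n i ⊗ₜ x k n j)) :=
  hom_ext (by rw [evHom_c h2 hr hn, dualHom_c]) fun i => by
    rw [evHom_x h2 hr hn, dualHom_x]; rfl
end uniqueness

/-- The matrix `(r (x_i ⊗ x_j))` of a form. -/
def mat (r : Form k (E k n)) : Matrix (Fin n) (Fin n) k :=
  Matrix.of fun i j => r.ofConv (x k n i ⊗ₜ x k n j)

lemma mat_apply (r : Form k (E k n)) (i j : Fin n) : mat r i j = r.ofConv (x k n i ⊗ₜ x k n j) := rfl

lemma mat_cqt (h2 : (2 : k) ≠ 0) (A : Matrix (Fin n) (Fin n) k) : mat (cqt h2 A).1.1 = A := by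
  ext i j
  change (dualHom h2 A (x k n i)).ofConv (x k n j) = _
  rw [dualHom_x, xi_x]

lemma cqt_mat (h2 : (2 : k) ≠ 0) (hn : 1 ≤ n) (r : CQT k (E k n)) : cqt h2 (mat r.1.1) = r := by
  refine Subtype.ext ?_
  change formOf (dualHom h2 (mat r.1.1)) = r.1
  rw [mat, ← evHom_eq_dualHom h2 r.2 hn, formOf_evHom]

/-- Matrices correspond to coquasi-triangular structures on `E(n)`. -/
def cqtEquiv (h2 : (2 : k) ≠ 0) (hn : 1 ≤ n) : Matrix (Fin n) (Fin n) k ≃ CQT k (E k n) where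
  toFun := cqt h2
  invFun r := mat r.1.1
  left_inv := mat_cqt h2
  right_inv := cqt_mat h2 hn

/-! ### Lazy cocycles and their effect on the matrix. -/

section lazy
variable (h2 : (2 : k) ≠ 0) {s : (Form k (E k n))ˣ} (hs : IsLazy s)
include hs

lemma IsLazy.apply (g h : E k n) : (embAlg k (E k n ⊗[k] E k n) (E k n) s.1 * mulForm k (E k n)).ofConv (g ⊗ₜ h) =
    (mulForm k (E k n) * embAlg k (E k n ⊗[k] E k n) (E k n) s.1).ofConv (g ⊗ₜ h) :=
  congrArg (fun z => z.ofConv (g ⊗ₜ h)) hs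

include h2

/-- Laziness at `(x_i, 1)` equates two combinations of `1`, `c` and `x_i`; `chi` and `xi` extract
the coefficients. The three lemmas that follow use the same device at other pairs of generators. -/
lemma IsLazy.x_one (i : Fin n) : s.1.ofConv (x k n i ⊗ₜ 1) = 0 ∧
    s.1.ofConv (c k n ⊗ₜ 1) = s.1.ofConv (1 ⊗ₜ 1) := by
  have h := IsLazy.apply hs (x k n i) 1
  rw [conv_tmul_two_one _ _ (comul_x k n i) comul_one', conv_tmul_two_one _ _ (comul_x k n i) comul_one'] at h
  simp only [embAlg_apply, mulForm, LinearMap.mul'_apply, mul_one, one_mul, Algebra.algebraMap_eq_smul_one,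
    smul_mul_assoc, mul_smul_comm] at h
  have h' := congrArg (chi k n).ofConv h
  have h'' := congrArg (xi (n := n) fun _ => 1).ofConv h
  simp only [map_add, map_smul, chi_c, chi_x, chi_one, xi_c, xi_x, xi_one, smul_eq_mul] at h' h''
  exact ⟨eq_zero_of_eq_neg_self h2 (by linear_combination -h'), by linear_combination -h''⟩

lemma IsLazy.one_x (i : Fin n) : s.1.ofConv (1 ⊗ₜ x k n i) = 0 ∧
    s.1.ofConv (1 ⊗ₜ c k n) = s.1.ofConv (1 ⊗ₜ 1) := by
  have h := IsLazy.apply hs 1 (x k n i)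
  rw [conv_tmul_one_two _ _ comul_one' (comul_x k n i), conv_tmul_one_two _ _ comul_one' (comul_x k n i)] at h
  simp only [embAlg_apply, mulForm, LinearMap.mul'_apply, mul_one, one_mul, Algebra.algebraMap_eq_smul_one,
    smul_mul_assoc, mul_smul_comm] at h
  have h' := congrArg (chi k n).ofConv h
  have h'' := congrArg (xi (n := n) fun _ => 1).ofConv h
  simp only [map_add, map_smul, chi_c, chi_x, chi_one, xi_c, xi_x, xi_one, smul_eq_mul] at h' h''
  exact ⟨eq_zero_of_eq_neg_self h2 (by linear_combination -h'), by linear_combination -h''⟩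

lemma IsLazy.x_c (i : Fin n) : s.1.ofConv (x k n i ⊗ₜ c k n) = 0 ∧
    s.1.ofConv (1 ⊗ₜ c k n) = s.1.ofConv (c k n ⊗ₜ c k n) := by
  have h := IsLazy.apply hs (x k n i) (c k n)
  rw [conv_tmul_two_one _ _ (comul_x k n i) (comul_c k n),
    conv_tmul_two_one _ _ (comul_x k n i) (comul_c k n)] at h
  simp only [embAlg_apply, mulForm, LinearMap.mul'_apply, mul_one, one_mul, Algebra.algebraMap_eq_smul_one,
    smul_mul_assoc, mul_smul_comm, c_sq] at h
  have h' := congrArg (chi k n).ofConv h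
  have h'' := congrArg (xi (n := n) fun _ => 1).ofConv h
  simp only [map_add, map_smul, chi_mul, chi_c, chi_x, chi_one, xi_x_mul_c, xi_c, xi_one, smul_eq_mul] at h' h''
  exact ⟨eq_zero_of_eq_neg_self h2 (by linear_combination h'), by linear_combination h''⟩

lemma IsLazy.c_x (i : Fin n) : s.1.ofConv (c k n ⊗ₜ x k n i) = 0 := by
  have h := IsLazy.apply hs (c k n) (x k n i)
  rw [conv_tmul_one_two _ _ (comul_c k n) (comul_x k n i),
    conv_tmul_one_two _ _ (comul_c k n) (comul_x k n i)] at h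
  simp only [embAlg_apply, mulForm, LinearMap.mul'_apply, mul_one, one_mul, Algebra.algebraMap_eq_smul_one,
    smul_mul_assoc, mul_smul_comm, c_sq] at h
  have h' := congrArg (chi k n).ofConv h
  simp only [map_add, map_smul, chi_mul, chi_c, chi_x, chi_one, smul_eq_mul] at h'
  exact eq_zero_of_eq_neg_self h2 (by linear_combination h')

lemma IsLazy.c_c (hn : 1 ≤ n) : s.1.ofConv (c k n ⊗ₜ c k n) = s.1.ofConv (1 ⊗ₜ 1) := by
  rw [← (IsLazy.x_c h2 hs ⟨0, hn⟩).2, (IsLazy.one_x h2 hs ⟨0, hn⟩).2]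

/-- Convolution with a lazy form, on generators. -/
lemma IsLazy.mul_x_x (hn : 1 ≤ n) (t : Form k (E k n)) (i j : Fin n) :
    (t * s.1).ofConv (x k n i ⊗ₜ x k n j) = t.ofConv (1 ⊗ₜ 1) * s.1.ofConv (x k n i ⊗ₜ x k n j) +
      t.ofConv (x k n i ⊗ₜ x k n j) * s.1.ofConv (1 ⊗ₜ 1) := by
  rw [conv_tmul_two_two _ _ (comul_x k n i) (comul_x k n j), IsLazy.x_c h2 hs i |>.1, IsLazy.c_x h2 hs j,
    IsLazy.c_c h2 hs hn]
  ring

end lazy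

lemma conv_one_one (s t : Form k (E k n)) :
    (s * t).ofConv (1 ⊗ₜ 1) = s.ofConv (1 ⊗ₜ 1) * t.ofConv (1 ⊗ₜ 1) :=
  conv_tmul_one_one _ _ comul_one' comul_one'

lemma form_one_one : (1 : Form k (E k n)).ofConv (1 ⊗ₜ 1) = 1 := by simp [LinearMap.convOne_def]
lemma form_one_x_x (i j : Fin n) : (1 : Form k (E k n)).ofConv (x k n i ⊗ₜ x k n j) = 0 := by
  simp [LinearMap.convOne_def, counit_x]

section
variable (h2 : (2 : k) ≠ 0) (hn : 1 ≤ n) {r : (Form k (E k n))ˣ} (hr : IsCQT r)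
include h2 hr hn
lemma IsCQT.apply_c_c : r.1.ofConv (c k n ⊗ₜ c k n) = -1 := (evHom_c_aux h2 hr ⟨0, hn⟩).2
omit h2 hn in
lemma IsCQT.apply_one_one : r.1.ofConv ((1 : E k n) ⊗ₜ 1) = 1 := by
  have := congrArg (fun z => z.ofConv 1) hr.ev_one
  exact this.trans (Bialgebra.counit_one)

/-- The flipped cocycle meets `r (c ⊗ c) = -1`, so it enters with a minus sign, like the
contribution of `s⁻¹`. Hence the correction is a symmetric matrix. -/
lemma mat_twist {s : (Form k (E k n))ˣ} (hs : s ∈ lazyCocycles k (E k n)) :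
    mat (twist s r).1 = mat r.1 -
      (s⁻¹).1.ofConv (1 ⊗ₜ 1) • (mat s.1 + (mat s.1).transpose) := by
  have hl := hs.2
  have hl' := ((lazyCocycles k (E k n)).inv_mem hs).2
  ext i j
  have e1 : (pull (flip k (E k n)) s.1 * r.1).ofConv (x k n i ⊗ₜ x k n j) =
      s.1.ofConv (1 ⊗ₜ 1) * r.1.ofConv (x k n i ⊗ₜ x k n j) - s.1.ofConv (x k n j ⊗ₜ x k n i) := by
    rw [conv_tmul_two_two _ _ (comul_x k n i) (comul_x k n j), IsCQT.apply_c_c h2 hn hr]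
    have e2 : (pull (flip k (E k n)) s.1).ofConv (1 ⊗ₜ x k n j) = 0 := (IsLazy.x_one h2 hl j).1
    have e3 : (pull (flip k (E k n)) s.1).ofConv (x k n i ⊗ₜ 1) = 0 := (IsLazy.one_x h2 hl i).1
    rw [e2, e3]
    change s.1.ofConv (1 ⊗ₜ 1) * _ + _ + _ + s.1.ofConv (x k n j ⊗ₜ x k n i) * _ = _
    ring
  have e4 : s.1.ofConv (1 ⊗ₜ 1) * (s⁻¹).1.ofConv (1 ⊗ₜ 1) = 1 := by
    rw [← conv_one_one, Units.mul_inv, form_one_one]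
  have e5 : s.1.ofConv (1 ⊗ₜ 1) * (s⁻¹).1.ofConv (x k n i ⊗ₜ x k n j) +
      s.1.ofConv (x k n i ⊗ₜ x k n j) * (s⁻¹).1.ofConv (1 ⊗ₜ 1) = 0 := by
    rw [← IsLazy.mul_x_x h2 hl' hn, Units.mul_inv, form_one_x_x]
  have e6 : (pull (flip k (E k n)) s.1 * r.1).ofConv (1 ⊗ₜ 1) = s.1.ofConv (1 ⊗ₜ 1) := by
    rw [conv_one_one, IsCQT.apply_one_one hr, mul_one]; rfl
  change (pull (flip k (E k n)) s.1 * r.1 * (s⁻¹).1).ofConv (x k n i ⊗ₜ x k n j) = _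
  rw [IsLazy.mul_x_x h2 hl' hn, e1, e6]
  simp only [Matrix.sub_apply, Matrix.smul_apply, Matrix.add_apply, Matrix.transpose_apply, mat_apply,
    smul_eq_mul]
  linear_combination e5 + r.1.ofConv (x k n i ⊗ₜ x k n j) * e4
end

/-- Every matrix is the matrix of a normalized lazy cocycle. -/
lemma exists_lazyCocycle (h2 : (2 : k) ≠ 0) (hn : 1 ≤ n) (B : Matrix (Fin n) (Fin n) k) :
    ∃ s ∈ lazyCocycles k (E k n), (s⁻¹).1.ofConv (1 ⊗ₜ 1) = 1 ∧ mat s.1 = B := by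
  -- The cocycle is `r_0⁻¹ * r_B`. Since `r_0` vanishes on `x_i ⊗ x_j` and both structures are `1`
  -- at `1 ⊗ 1`, its matrix is `B`.
  have hs := IsCQT.inv_mul_mem_lazyCocycles (cqt h2 B).2 (cqt h2 (0 : Matrix (Fin n) (Fin n) k)).2
  set b := (cqt h2 (0 : Matrix (Fin n) (Fin n) k)).1 with hb
  set a := (cqt h2 B).1 with ha
  have e1 : b.1 * (b⁻¹ * a).1 = a.1 := by rw [← Units.val_mul, mul_inv_cancel_left]
  have e2 : (b⁻¹ * a).1.ofConv (1 ⊗ₜ 1) = 1 := by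
    have := congrArg (fun z => z.ofConv ((1 : E k n) ⊗ₜ (1 : E k n))) e1
    simp only [conv_one_one, IsCQT.apply_one_one (cqt h2 B).2, IsCQT.apply_one_one (cqt h2 0).2, a, b,
      one_mul] at this
    exact this
  refine ⟨b⁻¹ * a, hs, ?_, ?_⟩
  · have : (b⁻¹ * a).1.ofConv (1 ⊗ₜ 1) * ((b⁻¹ * a)⁻¹).1.ofConv (1 ⊗ₜ 1) = 1 := by
      rw [← conv_one_one, Units.mul_inv, form_one_one]
    rwa [e2, one_mul] at this
  · ext i j
    have h := congrArg (fun z => z.ofConv (x k n i ⊗ₜ x k n j)) e1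
    simp only [IsLazy.mul_x_x h2 hs.2 hn] at h
    rw [e2, ← mat_apply, ← mat_apply, ← mat_apply, ha, hb, mat_cqt, mat_cqt,
      IsCQT.apply_one_one (cqt h2 0).2] at h
    simpa using h

/-! ### Hopf automorphisms act on matrices by congruence; description of the orbits. -/

/-- The only characters of `E(n)` are the counit and `chi`. If `chi ∘ γ` were the counit, evaluation
at `γ⁻¹ c` would give `-1 = 1`. -/
lemma chi_aut (h2 : (2 : k) ≠ 0) (γ : E k n ≃ₐc[k] E k n) (a : E k n) :
    (chi k n).ofConv (γ a) = (chi k n).ofConv a := by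
  let f : E k n →ₐ[k] k := (charHom k n).comp (γ : E k n →ₐ[k] E k n)
  have hx : ∀ i, f (x k n i) = 0 := fun i => by
    have : f (x k n i) * f (x k n i) = 0 := by rw [← map_mul, x_sq, map_zero]
    exact mul_self_eq_zero.1 this
  have hc : f (c k n) * f (c k n) = 1 := by rw [← map_mul, c_sq, map_one]
  rcases mul_self_eq_one_iff.1 hc with hc | hc
  · exfalso
    have e : f = counitHom k n := hom_ext (by rw [hc, counitHom_c]) fun i => by rw [hx, counitHom_x]
    have e1 : f (γ⁻¹ (c k n)) = -1 := by
      change charHom k n (γ (γ.symm (c k n))) = -1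
      rw [BialgEquiv.apply_symm_apply]
      exact chi_c
    have e2 : counitHom k n (γ⁻¹ (c k n)) = 1 := 
      (CoalgHomClass.counit_comp_apply (γ⁻¹ : E k n ≃ₐc[k] E k n) (c k n)).trans (counit_c k n)
    rw [e, e2] at e1
    exact h2 (by linear_combination e1)
  · have e : f = charHom k n := hom_ext (hc.trans chi_c.symm) fun i => (hx i).trans (chi_x i).symm
    exact congrArg (fun z : E k n →ₐ[k] k => z a) e

lemma counit_aut (γ : E k n ≃ₐc[k] E k n) (a : E k n) :
    Coalgebra.counit (R := k) (γ a) = Coalgebra.counit (R := k) a :=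
  CoalgHomClass.counit_comp_apply γ a

lemma transport_tmul (α : E k n ≃ₐc[k] E k n) (r : (Form k (E k n))ˣ) (a b : E k n) :
    (transport α r).1.ofConv (a ⊗ₜ b) = r.1.ofConv (α⁻¹ a ⊗ₜ α⁻¹ b) := rfl

/-- `r (- ⊗ c)` is the character `chi`. -/
lemma IsCQT.apply_c (h2 : (2 : k) ≠ 0) (hn : 1 ≤ n) {r : (Form k (E k n))ˣ} (hr : IsCQT r) :
    coev r.1 (c k n) = chi k n := by
  refine eq_chi ?_ (IsCQT.apply_c_c h2 hn hr) (fun i => evHom_x_c h2 hr hn i) fun h m => ?_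
  · have := congrArg (fun z => z.ofConv (c k n)) hr.ev_one
    exact this.trans (counit_c k n)
  · have := congrArg (fun z => z.ofConv (c k n)) (hr.ev_mul h m)
    simp only [conv_c] at this
    exact this

/-- Found without determining the group-likes. Transport a structure by `γ⁻¹`: its pairing with `c`
must again be `chi`, which vanishes at `γ⁻¹ x_i`. -/
lemma xi_aut_c (h2 : (2 : k) ≠ 0) (hn : 1 ≤ n) (v : Fin n → k) (γ : E k n ≃ₐc[k] E k n) :
    (xi v).ofConv (γ (c k n)) = 0 := by
  let i : Fin n := ⟨0, hn⟩
  -- All rows equal `v`, so that `r (x_i ⊗ -) = xi v`.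
  let r := (cqt h2 (Matrix.of fun _ => v)).1
  have hr : IsCQT (transport γ⁻¹ r) := transport_isCQT (cqt h2 (Matrix.of fun _ => v)).2
  have e := congrArg (fun z => z.ofConv (γ⁻¹ (x k n i))) (IsCQT.apply_c h2 hn hr)
  have e1 : (coev (transport γ⁻¹ r).1 (c k n)).ofConv (γ⁻¹ (x k n i)) =
      r.1.ofConv (x k n i ⊗ₜ γ (c k n)) := by
    rw [coev_apply, transport_tmul, inv_inv]
    congr 2
    exact γ.apply_symm_apply _
  simp only [e1, chi_aut h2, chi_x] at e
  change (dualHom h2 (Matrix.of fun _ => v) (x k n i)).ofConv (γ (c k n)) = 0 at e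
  rw [dualHom_x] at e
  exact e

/-- The matrix `M` with `xi v (γ a) = xi (v M) a`. -/
def autMatrix (γ : E k n ≃ₐc[k] E k n) : Matrix (Fin n) (Fin n) k :=
  Matrix.of fun l j => (xi (Pi.single l 1)).ofConv (γ (x k n j))

lemma xi_eq_sum (v : Fin n → k) : xi v = ∑ l, v l • xi (n := n) (Pi.single l 1) := by
  refine ((eq_xi (f := ∑ l, v l • xi (n := n) (Pi.single l 1)) ?_ fun h m => ?_).trans ?_).symm
  · simp [WithConv.ofConv_sum, xi_c]
  · simp only [WithConv.ofConv_sum, WithConv.ofConv_smul, LinearMap.sum_apply, LinearMap.smul_apply,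
      xi_mul, smul_eq_mul, Finset.mul_sum, Finset.sum_mul, ← Finset.sum_add_distrib]
    exact Finset.sum_congr rfl fun i _ => by ring
  · congr 1
    ext j
    simp [WithConv.ofConv_sum, xi_x, Pi.single_apply]

/-- `xi v ∘ γ` kills `c` and keeps the product rule of `xi v`, because `γ` preserves `chi` and the
counit; so it is again some `xi`. Automorphisms are thus handled through their action on these
functionals, without being classified. -/
lemma xi_aut_apply (h2 : (2 : k) ≠ 0) (hn : 1 ≤ n) (v : Fin n → k) (γ : E k n ≃ₐc[k] E k n)
    (a : E k n) : (xi v).ofConv (γ a) = (xi (Matrix.vecMul v (autMatrix γ))).ofConv a := by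
  have h := eq_xi (f := toConv ((xi v).ofConv ∘ₗ (γ : E k n →ₐ[k] E k n).toLinearMap))
    (xi_aut_c h2 hn v γ) fun h m => by
      change (xi v).ofConv (γ (h * m)) = _ * (xi v).ofConv (γ m) + (xi v).ofConv (γ h) * _
      rw [map_mul, xi_mul, chi_aut h2, counit_aut]
  have h' := congrArg (fun z => z.ofConv a) h
  refine h'.trans ?_
  congr 3
  ext j
  change (xi v).ofConv (γ (x k n j)) = _
  rw [xi_eq_sum v]
  simp [WithConv.ofConv_sum, Matrix.vecMul, dotProduct, autMatrix]

lemma autMatrix_mul_autMatrix_inv (h2 : (2 : k) ≠ 0) (hn : 1 ≤ n) (γ : E k n ≃ₐc[k] E k n) :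
    autMatrix γ * autMatrix γ⁻¹ = 1 := by
  ext l j
  have h : (xi (Pi.single l 1)).ofConv (γ (γ⁻¹ (x k n j))) = (1 : Matrix (Fin n) (Fin n) k) l j := by
    rw [show γ (γ⁻¹ (x k n j)) = x k n j from γ.apply_symm_apply _, xi_x, Matrix.one_apply, Pi.single_apply]
    simp only [eq_comm]
  rw [← h, xi_aut_apply h2 hn, xi_aut_apply h2 hn, xi_x, Matrix.vecMul_vecMul, Matrix.single_one_vecMul]
  rfl

/-- `r (- ⊗ x_j)`. -/
lemma IsCQT.coev_x (h2 : (2 : k) ≠ 0) (hn : 1 ≤ n) {r : (Form k (E k n))ˣ} (hr : IsCQT r) (j : Fin n) :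
    coev r.1 (x k n j) = chi k n * xi fun i => mat r.1 i j := by
  refine eq_chi_mul_xi (f := coev r.1 (x k n j)) (evHom_c_aux h2 hr j).1 fun h m => ?_
  have := congrArg (fun z => z.ofConv (x k n j)) (hr.ev_mul h m)
  simp only [conv_x] at this
  have e1 : (ev r.1 h).ofConv 1 = Coalgebra.counit (R := k) h :=
    congrArg (fun z => z.ofConv h) hr.coev_one
  have e2 : (ev r.1 m).ofConv (c k n) = (chi k n).ofConv m :=
    congrArg (fun z => z.ofConv m) (IsCQT.apply_c h2 hn hr)
  rw [e1, e2] at this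
  exact this

lemma comul_aut_x (γ : E k n ≃ₐc[k] E k n) (i : Fin n) :
    Coalgebra.comul (R := k) (γ (x k n i)) = 1 ⊗ₜ γ (x k n i) + γ (x k n i) ⊗ₜ γ (c k n) := by
  have := CoalgHomClass.map_comp_comul_apply γ (x k n i)
  rw [← this, comul_x, map_add]
  simp

/-- Compute `r (α⁻¹ x_i ⊗ x_j)` twice: as the transported structure at `x_i ⊗ α x_j`, using its row
functional `xi`, and directly in the first slot, using `IsCQT.coev_x`. Only one argument is moved
each time. -/
lemma mat_transport (h2 : (2 : k) ≠ 0) (hn : 1 ≤ n) {r : (Form k (E k n))ˣ} (hr : IsCQT r)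
    (α : E k n ≃ₐc[k] E k n) :
    mat (transport α r).1 = (autMatrix α⁻¹).transpose * mat r.1 * autMatrix α⁻¹ := by
  have key : mat (transport α r).1 * autMatrix α = (autMatrix α⁻¹).transpose * mat r.1 := by
    ext i j
    have e1 : r.1.ofConv (α⁻¹ (x k n i) ⊗ₜ x k n j) = (mat (transport α r).1 * autMatrix α) i j := by
      have h := congrArg (fun z => z.ofConv (α (x k n j))) (evHom_x h2 (transport_isCQT (a := α) hr) hn i)
      simp only [xi_aut_apply h2 hn, xi_x] at h
      refine Eq.trans ?_ h
      change _ = r.1.ofConv (α⁻¹ (x k n i) ⊗ₜ α.symm (α (x k n j)))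
      rw [BialgEquiv.symm_apply_apply]
    have e2 : r.1.ofConv (α⁻¹ (x k n i) ⊗ₜ x k n j) = ((autMatrix α⁻¹).transpose * mat r.1) i j := by
      have h := congrArg (fun z => z.ofConv (α⁻¹ (x k n i))) (IsCQT.coev_x h2 hn hr j)
      refine h.trans ?_
      have e3 : ∀ F G : WithConv (E k n →ₗ[k] k), (F * G).ofConv (α⁻¹ (x k n i)) =
          F.ofConv 1 * G.ofConv (α⁻¹ (x k n i)) + F.ofConv (α⁻¹ (x k n i)) * G.ofConv (α⁻¹ (c k n)) := by
        intro F G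
        simp [LinearMap.convMul_def, comul_aut_x]
      simp only [e3, chi_one, chi_aut h2, chi_x, xi_aut_apply h2 hn, xi_x, one_mul, zero_mul, add_zero]
      simp only [Matrix.vecMul, dotProduct, Matrix.mul_apply, Matrix.transpose_apply]
      exact Finset.sum_congr rfl fun l _ => mul_comm _ _
    rw [← e1, e2]
  rw [← key, mul_assoc, autMatrix_mul_autMatrix_inv h2 hn, mul_one]

lemma sum_mul_self_eq_zero {R ι : Type*} [Ring R] {y : ι → R} (h : ∀ i, y i * y i = 0)
    (h' : ∀ i j, y i * y j = -(y j * y i)) (s : Finset ι) : (∑ i ∈ s, y i) * ∑ i ∈ s, y i = 0 := by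
  classical
  induction s using Finset.induction_on with
  | empty => simp
  | insert a s ha ih =>
    rw [Finset.sum_insert ha, mul_add, add_mul, add_mul, h, ih, Finset.sum_mul, Finset.mul_sum,
      Finset.sum_congr rfl fun i _ => h' i a]
    simp

/-- The algebra map `c ↦ c`, `x_j ↦ ∑ M_{lj} x_l`. -/
def linHom (M : Matrix (Fin n) (Fin n) k) : E k n →ₐ[k] E k n :=
  lift (c k n) (fun j => ∑ l, M l j • x k n l) c_sq
    (fun j => sum_mul_self_eq_zero (fun l => by simp [x_sq]) (fun l m => by
      simp only [mul_smul_comm, smul_mul_assoc]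
      rw [x_x l m, smul_neg, smul_neg, smul_comm]) Finset.univ)
    (fun j => by
      simp only [Finset.mul_sum, Finset.sum_mul, mul_smul_comm, smul_mul_assoc, c_x, smul_neg,
        Finset.sum_neg_distrib])
    (fun i j => by
      simp only [Finset.sum_mul_sum, mul_smul_comm, smul_mul_assoc]
      rw [Finset.sum_comm, ← Finset.sum_neg_distrib]
      refine Finset.sum_congr rfl fun l _ => ?_
      rw [← Finset.sum_neg_distrib]
      refine Finset.sum_congr rfl fun m _ => ?_
      rw [x_x m l, smul_neg, smul_neg, smul_comm])

lemma linHom_c (M : Matrix (Fin n) (Fin n) k) : linHom M (c k n) = c k n := lift_c ..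
lemma linHom_x (M : Matrix (Fin n) (Fin n) k) (j : Fin n) : linHom M (x k n j) = ∑ l, M l j • x k n l :=
  lift_x ..

lemma linHom_comp (M N : Matrix (Fin n) (Fin n) k) : (linHom M).comp (linHom N) = linHom (M * N) :=
  hom_ext (by simp [linHom_c]) fun j => by
    simp only [AlgHom.comp_apply, linHom_x, map_sum, map_smul, Finset.smul_sum, smul_smul, Matrix.mul_apply,
      Finset.sum_smul]
    rw [Finset.sum_comm]
    exact Finset.sum_congr rfl fun l _ => Finset.sum_congr rfl fun m _ => by rw [mul_comm]

lemma linHom_one : linHom (1 : Matrix (Fin n) (Fin n) k) = AlgHom.id k _ :=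
  hom_ext (by simp [linHom_c]) fun j => by
    simp [linHom_x, Matrix.one_apply]

/-- The Hopf automorphism `x_j ↦ ∑ M_{lj} x_l` for invertible `M`. -/
def linAut (M : (Matrix (Fin n) (Fin n) k)ˣ) : E k n ≃ₐc[k] E k n :=
  BialgEquiv.ofAlgEquiv
    (AlgEquiv.ofAlgHom (linHom M.1) (linHom (M⁻¹).1) (by rw [linHom_comp, M.mul_inv, linHom_one])
      (by rw [linHom_comp, M.inv_mul, linHom_one]))
    (hom_ext
      (by
        change Coalgebra.counit (R := k) (linHom M.1 (c k n)) = Coalgebra.counit (R := k) (c k n)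
        rw [linHom_c])
      (fun j => by
        change Coalgebra.counit (R := k) (linHom M.1 (x k n j)) = Coalgebra.counit (R := k) (x k n j)
        simp [linHom_x, counit_x]))
    (hom_ext
      (by
        change Algebra.TensorProduct.map (linHom M.1) (linHom M.1) (Coalgebra.comul (R := k) (c k n)) =
          Coalgebra.comul (R := k) (linHom M.1 (c k n))
        simp [linHom_c, comul_c])
      (fun j => by
        change Algebra.TensorProduct.map (linHom M.1) (linHom M.1) (Coalgebra.comul (R := k) (x k n j)) =
          Coalgebra.comul (R := k) (linHom M.1 (x k n j))
        simp [linHom_c, linHom_x, comul_x, TensorProduct.tmul_sum, TensorProduct.sum_tmul,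
          Finset.sum_add_distrib, TensorProduct.smul_tmul']))

lemma mat_transport_linAut (M : (Matrix (Fin n) (Fin n) k)ˣ) (r : (Form k (E k n))ˣ) :
    mat (transport (linAut M)⁻¹ r).1 = M.1.transpose * mat r.1 * M.1 := by
  ext i j
  rw [mat_apply, transport_tmul, inv_inv]
  change r.1.ofConv (linHom M.1 (x k n i) ⊗ₜ linHom M.1 (x k n j)) = _
  rw [linHom_x, linHom_x]
  simp only [TensorProduct.sum_tmul, TensorProduct.tmul_sum, map_sum, TensorProduct.tmul_smul, map_smul,
    ← TensorProduct.smul_tmul', Matrix.mul_apply, Matrix.transpose_apply, mat_apply, smul_eq_mul,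
    Finset.sum_mul, Finset.mul_sum]
  exact Finset.sum_congr rfl fun l _ => Finset.sum_congr rfl fun m _ => by ring

lemma smul_val (g : TwistGroup k (E k n)) (r : CQT k (E k n)) :
    (g • r).1 = twist (g.left : (Form k (E k n))ˣ) (transport g.right r.1) := rfl

lemma skew_smul_aux (A : Matrix (Fin n) (Fin n) k) (M : Matrix (Fin n) (Fin n) k) :
    (2 : k)⁻¹ • (M.transpose * A * M - (M.transpose * A * M).transpose) =
      M.transpose * ((2 : k)⁻¹ • (A - A.transpose)) * M := by
  simp only [Matrix.transpose_mul, Matrix.transpose_transpose, Matrix.mul_smul, Matrix.smul_mul,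
    mul_sub, sub_mul, mul_assoc]

/-- Two matrices give structures in the same orbit if and only if their skew-symmetric parts are
congruent. -/
lemma orbit_iff (h2 : (2 : k) ≠ 0) (hn : 1 ≤ n) (A B : Matrix (Fin n) (Fin n) k) :
    (∃ g : TwistGroup k (E k n), g • cqt h2 A = cqt h2 B) ↔
      congruence k n (skewPart A) (skewPart B) := by
  constructor
  · rintro ⟨g, hg⟩
    have h := congrArg (fun r : CQT k (E k n) => mat r.1.1) hg
    simp only [smul_val, mat_twist h2 hn (transport_isCQT (cqt h2 A).2) g.left.2,
      mat_transport h2 hn (cqt h2 A).2, mat_cqt] at h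
    refine ⟨autMatrix g.right⁻¹, ?_, ?_⟩
    · have := autMatrix_mul_autMatrix_inv h2 hn g.right⁻¹
      exact (Matrix.isUnit_iff_isUnit_det _).2 (Matrix.isUnit_det_of_right_inverse this)
    · change (2 : k)⁻¹ • (B - B.transpose) = _ * ((2 : k)⁻¹ • (A - A.transpose)) * _
      -- The cocycle's contribution to `B` is symmetric and cancels in `B - Bᵀ`.
      rw [← skew_smul_aux, ← h]
      congr 1
      simp only [Matrix.transpose_sub, Matrix.transpose_smul, Matrix.transpose_add, Matrix.transpose_transpose]
      rw [add_comm (mat _).transpose]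
      abel
  · rintro ⟨_, ⟨M, rfl⟩, hM⟩
    change (2 : k)⁻¹ • (B - B.transpose) = _ * ((2 : k)⁻¹ • (A - A.transpose)) * _ at hM
    rw [← skew_smul_aux] at hM
    have hS : B - B.transpose = M.1.transpose * A * M.1 - (M.1.transpose * A * M.1).transpose :=
      smul_right_injective _ (inv_ne_zero h2) hM
    -- `Mᵀ A M - B` is symmetric by `hS`. Half of it is taken because the twist subtracts the matrix
    -- of `s` plus its transpose.
    obtain ⟨s, hs, hs1, hsB⟩ := exists_lazyCocycle h2 hn ((2 : k)⁻¹ • (M.1.transpose * A * M.1 - B))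
    refine ⟨⟨⟨s, hs⟩, (linAut M)⁻¹⟩, ?_⟩
    refine (cqtEquiv h2 hn).symm.injective ?_
    change mat (twist s (transport (linAut M)⁻¹ (cqt h2 A).1)).1 = mat (cqt h2 B).1.1
    simp only [mat_twist h2 hn (transport_isCQT (cqt h2 A).2) hs, mat_transport_linAut, mat_cqt, hs1, hsB,
      one_smul]
    have h3 : B.transpose = B - (M.1.transpose * A * M.1 - (M.1.transpose * A * M.1).transpose) := by
      rw [← hS]; abel
    rw [Matrix.transpose_smul, ← smul_add, Matrix.transpose_sub, h3]
    have h4 : M.1.transpose * A * M.1 - B + ((M.1.transpose * A * M.1).transpose -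
        (B - (M.1.transpose * A * M.1 - (M.1.transpose * A * M.1).transpose))) =
        (2 : k) • (M.1.transpose * A * M.1 - B) := by
      rw [two_smul]; abel
    rw [h4, smul_smul, inv_mul_cancel₀ h2, one_smul]
    abel
end E

/-! ### Skew-symmetric matrices up to congruence: rank and symplectic bases. -/

section Classification
variable {k : Type*} [Field k] {n : ℕ}

lemma J_transpose (l : ℕ) : (J k n l).transpose = -J k n l := by
  ext i j
  simp only [J, Matrix.transpose_apply, Matrix.of_apply, Matrix.neg_apply]
  split_ifs <;> first | (exfalso; omega) | simp

lemma skewPart_of_skew (h2 : (2 : k) ≠ 0) {S : Matrix (Fin n) (Fin n) k} (h : S.transpose = -S) :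
    skewPart S = ⟨S, h⟩ := by
  apply Subtype.ext
  change (2 : k)⁻¹ • (S - S.transpose) = S
  rw [h, sub_neg_eq_add, ← two_smul k, smul_smul, inv_mul_cancel₀ h2, one_smul]

/-- With `D` diagonal having `2 l` ones, `D * J = J` bounds the rank above and `J * Jᵀ = D` bounds
it below. -/
lemma rank_J {l : ℕ} (hl : l ≤ n / 2) : (J k n l).rank = 2 * l := by
  classical
  let d : Fin n → k := fun i => if (i : ℕ) < 2 * l then 1 else 0
  have hd : (Matrix.diagonal d).rank = 2 * l := by
    rw [Matrix.rank_diagonal]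
    have : {i : Fin n // d i ≠ 0} ≃ Fin (2 * l) :=
      { toFun := fun i => ⟨i.1, by
          have := i.2
          by_contra h
          exact this (if_neg h)⟩
        invFun := fun i => ⟨⟨i, by omega⟩, by simp [d]⟩
        left_inv := fun _ => rfl
        right_inv := fun _ => rfl }
    rw [Fintype.card_congr this, Fintype.card_fin]
  apply le_antisymm
  · have : Matrix.diagonal d * J k n l = J k n l := by
      ext i j
      rw [Matrix.diagonal_mul]
      simp only [J, Matrix.of_apply, d]
      split_ifs <;> first | (exfalso; omega) | simp
    rw [← hd, ← this]
    exact Matrix.rank_mul_le_left _ _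
  · have : J k n l * (J k n l).transpose = Matrix.diagonal d := by
      ext i j
      rw [Matrix.mul_apply]
      by_cases hi : (i : ℕ) < l
      · rw [Finset.sum_eq_single (⟨i + l, by omega⟩ : Fin n)]
        · simp only [J, Matrix.of_apply, Matrix.transpose_apply, d, Matrix.diagonal_apply, Fin.ext_iff]
          split_ifs <;> first | (exfalso; omega) | (simp; done) | simp_all
        · intro m _ hm
          rw [Ne, Fin.ext_iff] at hm
          simp only at hm
          simp only [J, Matrix.of_apply, Matrix.transpose_apply]
          split_ifs <;> first | (exfalso; omega) | simp
        · simp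
      · by_cases hi' : (i : ℕ) < 2 * l
        · rw [Finset.sum_eq_single (⟨i - l, by omega⟩ : Fin n)]
          · simp only [J, Matrix.of_apply, Matrix.transpose_apply, d, Matrix.diagonal_apply, Fin.ext_iff]
            split_ifs <;> first | (exfalso; omega) | simp
          · intro m _ hm
            rw [Ne, Fin.ext_iff] at hm
            simp only at hm
            simp only [J, Matrix.of_apply, Matrix.transpose_apply]
            split_ifs <;> first | (exfalso; omega) | simp
          · simp
        · rw [Finset.sum_eq_zero]
          · simp only [d, Matrix.diagonal_apply, if_neg hi']; simp
          · intro m _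
            simp only [J, Matrix.of_apply, Matrix.transpose_apply]
            split_ifs <;> first | (exfalso; omega) | simp
    rw [← hd, ← this]
    exact Matrix.rank_mul_le_left _ _

lemma rank_congr {S M : Matrix (Fin n) (Fin n) k} (hM : IsUnit M) :
    (M.transpose * S * M).rank = S.rank := by
  have h := (Matrix.isUnit_iff_isUnit_det _).1 hM
  rw [Matrix.rank_mul_eq_left_of_isUnit_det _ _ h,
    Matrix.rank_mul_eq_right_of_isUnit_det _ _ (by rwa [Matrix.det_transpose])]

section Darboux
variable {V : Type*} [AddCommGroup V] [Module k V]

/-- Families `e`, `f` spanning a hyperbolic subspace. -/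
structure IsHyperbolic (B : V →ₗ[k] V →ₗ[k] k) {l : ℕ} (e f : Fin l → V) : Prop where
  ee : ∀ i j, B (e i) (e j) = 0
  ff : ∀ i j, B (f i) (f j) = 0
  ef : ∀ i j, B (e i) (f j) = if i = j then 1 else 0

/-- Coordinates with respect to a hyperbolic pair of families. -/
def hypCoord (B : V →ₗ[k] V →ₗ[k] k) {l : ℕ} (e f : Fin l → V) :
    V →ₗ[k] (Fin l → k) × (Fin l → k) :=
  (LinearMap.pi fun i => B (e i)).prod (LinearMap.pi fun i => B (f i))

variable {B : V →ₗ[k] V →ₗ[k] k} (hB : ∀ x, B x x = 0)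
include hB

lemma alt_neg (x y : V) : B x y = -B y x := by
  have h := hB (x + y)
  simp only [map_add, LinearMap.add_apply, hB] at h
  linear_combination h

lemma IsHyperbolic.fe {l : ℕ} {e f : Fin l → V} (h : IsHyperbolic B e f) (i j : Fin l) :
    B (f i) (e j) = if i = j then -1 else 0 := by
  rw [alt_neg hB, h.ef]
  by_cases hij : i = j
  · simp [hij]
  · simp [hij, Ne.symm hij]

lemma IsHyperbolic.surjective {l : ℕ} {e f : Fin l → V} (h : IsHyperbolic B e f) :
    Function.Surjective (hypCoord B e f) := by
  rintro ⟨p, q⟩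
  -- The minus sign compensates `B (f i) (e j) = -1` for `i = j`.
  refine ⟨∑ j, p j • f j - ∑ j, q j • e j, ?_⟩
  refine Prod.ext (funext fun i => ?_) (funext fun i => ?_)
  · simp [hypCoord, map_sum, h.ee, h.ef]
  · simp [hypCoord, map_sum, h.ff, h.fe hB]

lemma IsHyperbolic.le_finrank [FiniteDimensional k V] {l : ℕ} {e f : Fin l → V} (h : IsHyperbolic B e f) :
    l + l + Module.finrank k (LinearMap.ker (hypCoord B e f)) = Module.finrank k V := by
  rw [← LinearMap.finrank_range_add_finrank_ker (hypCoord B e f),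
    LinearMap.range_eq_top.2 (h.surjective hB), finrank_top, Module.finrank_prod,
    Module.finrank_fin_fun]

/-- A hyperbolic pair can be enlarged as long as the form does not vanish on its complement. -/
lemma IsHyperbolic.extend {l : ℕ} {e f : Fin l → V} (h : IsHyperbolic B e f) {u v : V}
    (hu : hypCoord B e f u = 0) (hv : hypCoord B e f v = 0) (huv : B u v ≠ 0) :
    ∃ e' f' : Fin (l + 1) → V, IsHyperbolic B e' f' := by
  have h1 : ∀ i, B (e i) u = 0 := fun i => congrFun (congrArg Prod.fst hu) i
  have h2 : ∀ i, B (f i) u = 0 := fun i => congrFun (congrArg Prod.snd hu) i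
  have h3 : ∀ i, B (e i) v = 0 := fun i => congrFun (congrArg Prod.fst hv) i
  have h4 : ∀ i, B (f i) v = 0 := fun i => congrFun (congrArg Prod.snd hv) i
  have h1' : ∀ i, B u (e i) = 0 := fun i => by rw [alt_neg hB, h1, neg_zero]
  have h2' : ∀ i, B u (f i) = 0 := fun i => by rw [alt_neg hB, h2, neg_zero]
  have h4' : ∀ i, B v (f i) = 0 := fun i => by rw [alt_neg hB, h4, neg_zero]
  -- The vector `v` is rescaled so that it pairs with `u` to `1`.
  refine ⟨Fin.cons u e, Fin.cons ((B u v)⁻¹ • v) f, ⟨fun i j => ?_, fun i j => ?_, fun i j => ?_⟩⟩ <;>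
  refine Fin.cases ?_ (fun i => ?_) i <;> refine Fin.cases ?_ (fun j => ?_) j
  all_goals simp [h1, h4, h1', h2', h3, h4', hB, h.ee, h.ff, h.ef, huv, Fin.succ_ne_zero,
    (Fin.succ_ne_zero _).symm]

/-- Every alternating form on a finite-dimensional space has a symplectic basis. -/
lemma exists_symplectic_basis [FiniteDimensional k V] : ∃ (l m : ℕ) (e f : Fin l → V) (w : Fin m → V),
    IsHyperbolic B e f ∧ (∀ j, hypCoord B e f (w j) = 0) ∧ (∀ i j, B (w i) (w j) = 0) ∧
    LinearIndependent k (Sum.elim (Sum.elim e f) w) ∧ l + l + m = Module.finrank k V := by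
  classical
  let P : ℕ → Prop := fun l => ∃ e f : Fin l → V, IsHyperbolic B e f
  have hP : ∀ l, P l → l ≤ Module.finrank k V := by
    rintro l ⟨e, f, h⟩
    have := h.le_finrank hB
    omega
  have h0 : P 0 := ⟨Fin.elim0, Fin.elim0, ⟨fun i => i.elim0, fun i => i.elim0, fun i => i.elim0⟩⟩
  -- Take the longest hyperbolic pair; by `IsHyperbolic.extend` the form then vanishes on its
  -- orthogonal complement, and any basis of that complement serves as `w`.
  obtain ⟨l, ⟨e, f, h⟩, hmax⟩ : ∃ l, P l ∧ ¬ P (l + 1) := by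
    refine ⟨_, Nat.findGreatest_spec (P := P) (Nat.zero_le (Module.finrank k V)) h0, fun h' => ?_⟩
    have := Nat.le_findGreatest (hP _ h') h'
    omega
  let b := Module.finBasis k (LinearMap.ker (hypCoord B e f))
  refine ⟨l, _, e, f, fun j => (b j : V), h, fun j => (b j).2, fun i j => ?_, ?_, h.le_finrank hB⟩
  · by_contra hne
    exact hmax (h.extend hB (b i).2 (b j).2 hne)
  · rw [Fintype.linearIndependent_iff]
    intro g hg
    simp only [Fintype.sum_sum_type, Sum.elim_inl, Sum.elim_inr] at hg
    have hw1 : ∀ i j, B (e i) (b j : V) = 0 := fun i j => congrFun (congrArg Prod.fst (b j).2) i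
    have hw2 : ∀ i j, B (f i) (b j : V) = 0 := fun i j => congrFun (congrArg Prod.snd (b j).2) i
    -- Pairing the relation with `e i` isolates the coefficient of `f i`, and conversely.
    have hf : ∀ i, g (Sum.inl (Sum.inr i)) = 0 := fun i => by
      have := congrArg (B (e i)) hg
      simpa [h.ee, h.ef, hw1] using this
    have he : ∀ i, g (Sum.inl (Sum.inl i)) = 0 := fun i => by
      have := congrArg (B (f i)) hg
      simpa [h.fe hB, h.ff, hw2] using this
    have hb : ∑ j, g (Sum.inr j) • b j = 0 := by
      apply Subtype.ext
      simpa [he, hf] using hg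
    have hw := Fintype.linearIndependent_iff.1 b.linearIndependent _ hb
    rintro ((i | i) | i)
    exacts [he i, hf i, hw i]
end Darboux

/-- The Gram matrix of a symplectic basis, listed as `e`, then `f`, then the radical part `w`, is
`J_l`; the basis vectors are the columns of `M`. -/
lemma exists_congr_J (h2 : (2 : k) ≠ 0) {S : Matrix (Fin n) (Fin n) k} (hS : S.transpose = -S) :
    ∃ l ≤ n / 2, ∃ M : Matrix (Fin n) (Fin n) k, IsUnit M ∧ J k n l = M.transpose * S * M := by
  classical
  let B := (Matrix.toLinearMap₂' k S : (Fin n → k) →ₗ[k] (Fin n → k) →ₗ[k] k)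
  have hBd : ∀ x y, B x y = x ⬝ᵥ S.mulVec y := fun x y => Matrix.toLinearMap₂'_apply' S x y
  -- Skew symmetry gives `B x x = -B x x`, so the form is alternating in characteristic different
  -- from 2.
  have hB : ∀ x, B x x = 0 := fun x => by
    have : x ⬝ᵥ S.mulVec x = -(x ⬝ᵥ S.mulVec x) := by
      conv_lhs => rw [Matrix.dotProduct_mulVec, ← Matrix.mulVec_transpose, hS, dotProduct_comm]
      rw [Matrix.neg_mulVec, dotProduct_neg]
    rw [hBd]
    exact E.eq_zero_of_eq_neg_self h2 this
  obtain ⟨l, m, e, f, w, h, hw, hww, hli, hlm⟩ := exists_symplectic_basis hB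
  rw [Module.finrank_fin_fun] at hlm
  subst hlm
  let φ : (Fin l ⊕ Fin l) ⊕ Fin m ≃ Fin (l + l + m) :=
    (Equiv.sumCongr finSumFinEquiv (Equiv.refl _)).trans finSumFinEquiv
  let y : Fin (l + l + m) → Fin (l + l + m) → k := fun i => Sum.elim (Sum.elim e f) w (φ.symm i)
  have hy : LinearIndependent k y := hli.comp φ.symm φ.symm.injective
  refine ⟨l, by omega, (Matrix.of y).transpose, ?_, ?_⟩
  · rw [Matrix.isUnit_transpose, ← Matrix.linearIndependent_rows_iff_isUnit]
    exact hy
  · have hw1 : ∀ i j, B (e i) (w j) = 0 := fun i j => congrFun (congrArg Prod.fst (hw j)) i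
    have hw2 : ∀ i j, B (f i) (w j) = 0 := fun i j => congrFun (congrArg Prod.snd (hw j)) i
    have hw1' : ∀ i j, B (w j) (e i) = 0 := fun i j => by rw [alt_neg hB, hw1, neg_zero]
    have hw2' : ∀ i j, B (w j) (f i) = 0 := fun i j => by rw [alt_neg hB, hw2, neg_zero]
    have hG : ∀ i j, ((Matrix.of y).transpose.transpose * S * (Matrix.of y).transpose) i j = B (y i) (y j) := by
      intro i j
      rw [hBd, Matrix.dotProduct_mulVec, Matrix.transpose_transpose]
      rfl
    ext i j
    rw [hG]
    obtain ⟨i, rfl⟩ := φ.surjective i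
    obtain ⟨j, rfl⟩ := φ.surjective j
    simp only [y, Equiv.symm_apply_apply]
    rcases i with (i | i) | i <;> rcases j with (j | j) | j <;>
    simp only [Sum.elim_inl, Sum.elim_inr, h.ee, h.ff, h.ef, h.fe hB, hw1, hw2, hw1', hw2', hww, φ,
      Equiv.trans_apply, Equiv.sumCongr_apply, Sum.map_inl, Sum.map_inr, finSumFinEquiv_apply_left,
      finSumFinEquiv_apply_right, J, Matrix.of_apply, Fin.val_castAdd, Fin.val_natAdd, Fin.ext_iff,
      Equiv.refl_apply] <;>
    split_ifs <;> first | rfl | (exfalso; omega)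
end Classification

end HopfForms
end
theorem mainTheorem6 {k : Type*} [Field k] (hk : ringChar k ≠ 2) (n : ℕ) (hn : 1 ≤ n) :
    ∃ ρ : Matrix (Fin n) (Fin n) k ≃ HopfForms.CQT k (HopfForms.E k n),
      (∀ A : Matrix (Fin n) (Fin n) k, HopfForms.E.IsStructureOf A (ρ A)) ∧
      Function.Bijective (fun l : Fin (n / 2 + 1) =>
        (Quotient.mk _ (ρ (HopfForms.J k n l)) :
          MulAction.orbitRel.Quotient (HopfForms.TwistGroup k (HopfForms.E k n))
            (HopfForms.CQT k (HopfForms.E k n)))) ∧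
      ∃ Φ : MulAction.orbitRel.Quotient (HopfForms.TwistGroup k (HopfForms.E k n))
            (HopfForms.CQT k (HopfForms.E k n)) ≃ Quotient (HopfForms.congruence k n),
        ∀ A : Matrix (Fin n) (Fin n) k,
          Φ (Quotient.mk _ (ρ A)) = Quotient.mk _ (HopfForms.skewPart A) := by
  have h2 : (2 : k) ≠ 0 := Ring.two_ne_zero hk
  let ρ := HopfForms.E.cqtEquiv h2 hn
  -- The order of `A` and `B` is reversed because the orbit relation asks for a group element
  -- carrying the second structure to the first.
  have key : ∀ A B : Matrix (Fin n) (Fin n) k,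
      (Quotient.mk _ (ρ A) : MulAction.orbitRel.Quotient (HopfForms.TwistGroup k (HopfForms.E k n))
        (HopfForms.CQT k (HopfForms.E k n))) = Quotient.mk _ (ρ B) ↔
      HopfForms.congruence k n (HopfForms.skewPart B) (HopfForms.skewPart A) := fun A B =>
    Quotient.eq.trans (HopfForms.E.orbit_iff h2 hn B A)
  have hJ : ∀ l, HopfForms.skewPart (HopfForms.J k n l) = ⟨_, HopfForms.J_transpose l⟩ := fun l =>
    HopfForms.skewPart_of_skew h2 _
  refine ⟨ρ, HopfForms.E.isStructureOf_cqt h2, ⟨fun l m h => ?_, fun q => ?_⟩, ?_⟩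
  -- Congruence preserves the rank, which is `2 l` for `J_l`.
  · obtain ⟨M, hM, e⟩ := (key _ _).1 h
    rw [hJ, hJ] at e
    have e' := HopfForms.rank_congr (S := HopfForms.J k n m) hM
    rw [← show HopfForms.J k n l = _ from e, HopfForms.rank_J (by omega), HopfForms.rank_J (by omega)] at e'
    exact Fin.ext (by omega)
  · obtain ⟨r, rfl⟩ := Quotient.exists_rep q
    obtain ⟨A, rfl⟩ := ρ.surjective r
    obtain ⟨l, hl, M, hM, e⟩ := HopfForms.exists_congr_J h2 (HopfForms.skewPart A).2
    refine ⟨⟨l, by omega⟩, (key _ _).2 ⟨M, hM, ?_⟩⟩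
    rw [hJ]
    exact e
  · let Ψ : MulAction.orbitRel.Quotient (HopfForms.TwistGroup k (HopfForms.E k n))
        (HopfForms.CQT k (HopfForms.E k n)) → Quotient (HopfForms.congruence k n) :=
      Quotient.lift (fun r => Quotient.mk _ (HopfForms.skewPart (ρ.symm r))) fun r s h => by
        obtain ⟨A, rfl⟩ := ρ.surjective r
        obtain ⟨B, rfl⟩ := ρ.surjective s
        simp only [Equiv.symm_apply_apply]
        exact Quotient.sound ((HopfForms.congruence k n).symm ((key A B).1 (Quotient.sound h)))
    have hΨ : ∀ A, Ψ (Quotient.mk _ (ρ A)) = Quotient.mk _ (HopfForms.skewPart A) := fun A => by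
      change Quotient.mk _ (HopfForms.skewPart (ρ.symm (ρ A))) = _
      rw [Equiv.symm_apply_apply]
    refine ⟨Equiv.ofBijective Ψ ⟨fun q q' h => ?_, fun S => ?_⟩, hΨ⟩
    · obtain ⟨r, rfl⟩ := Quotient.exists_rep q
      obtain ⟨s, rfl⟩ := Quotient.exists_rep q'
      obtain ⟨A, rfl⟩ := ρ.surjective r
      obtain ⟨B, rfl⟩ := ρ.surjective s
      rw [hΨ, hΨ] at h
      exact (key A B).2 ((HopfForms.congruence k n).symm (Quotient.exact h))
    · obtain ⟨S, rfl⟩ := Quotient.exists_rep S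
      -- A skew-symmetric matrix is its own skew part, so it represents its class.
      refine ⟨Quotient.mk _ (ρ S.1), ?_⟩
      rw [hΨ, HopfForms.skewPart_of_skew h2 S.2]
      rfl
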